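/- All graphs are finite, simple and undirected. A graph $G$ on $N\ge 1$ vertices is $\epsilon$-far from a graph property $\Pi$ if at least $\epsilon N^2$ edges must be added to or deleted from $G$ to obtain a graph in $\Pi$. A randomized algorithm, which knows $N$ and queries whether given pairs of vertices are adjacent, is an $\epsilon$-tester for $\Pi$ if it accepts every graph in $\Pi$ with probability more than $2/3$ and rejects every graph that is $\epsilon$-far from $\Pi$ with probability more than $2/3$. It is non-adaptive if it determines all of its queries in advance, and adaptive if queries may depend on the answers to earlier ones. The adaptive (respectively non-adaptive) query complexity of $\epsilon$-testing $\Pi$ is the least $m$ such that, for every $N\ge 1$, there is an adaptive (respectively non-adaptive) $\epsilon$-tester for $\Pi$ on $N$-vertex graphs that never makes more than $m$ queries. A graph $G$ is a blow-up of a graph $H$ if its vertices can be partitioned into possibly empty clusters $V_i$, one for each vertex $i$ of $H$, such that for all $u\in V_i$ and $v\in V_j$, $uv$ is an edge of $G$ if and only if $ij$ is an edge of $H$. A graph $G$ is a blow-up collection of $H$ if its vertices can be partitioned into sets that each induce a blow-up of $H$ and that have no edges of $G$ between them. Theorem. For every integer $t\ge 8$ there is a constant $c>1$, depending only on $t$,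 such that the following holds. For $\epsilon>0$ let $\Pi_\epsilon$ be the graph property consisting of all graphs (on any number $N$ of vertices) that have maximum degree at most $c\epsilon N$ and are blow-up collections of the $t$-cycle. For all sufficiently small $\epsilon>0$, let $q=q(\epsilon)$ and $Q=Q(\epsilon)$ be the adaptive and the non-adaptive query complexity of $\epsilon$-testing $\Pi_\epsilon$; both are finite. Then, as $\epsilon\to 0^+$, $$q=\widetilde{\Theta}(\epsilon^{-1})\qquad\text{and}\qquad Q=\widetilde{\Theta}\left(q^{2-2/t}\right),$$ where $f=\widetilde{\Theta}(g)$ means that, for some $k$, $f=O(g\log^k g)$ and $g=O(f\log^k g)$; the implied constants and the exponents $k$ depend only on $t$. -/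

import Mathlib

open Filter Topology

namespace DenseGraphTesting

/-! ### Graph properties and distance -/

/-- A graph property: for every `N`, a set of graphs on the vertex set `Fin N`, invariant under
relabelling of the vertices. -/
structure GraphProperty where
  Mem : ∀ {N : ℕ}, SimpleGraph (Fin N) → Prop
  iso_mem : ∀ {N : ℕ} {G G' : SimpleGraph (Fin N)}, (G ≃g G') → Mem G → Mem G'

/-- The number of edges that have to be added or deleted to turn `G` into `G'`. -/
noncomputable def editDistance {N : ℕ} (G G' : SimpleGraph (Fin N)) : ℕ :=
  (symmDiff G.edgeSet G'.edgeSet).ncard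

/-- `G` is `ε`-far from `P`: at least `ε N ^ 2` edges have to be added or deleted in order to obtain
a graph with the property `P`. -/
def IsFar (P : GraphProperty) (ε : ℝ) {N : ℕ} (G : SimpleGraph (Fin N)) : Prop :=
  ∀ G' : SimpleGraph (Fin N), P.Mem G' → ε * (N : ℝ) ^ 2 ≤ (editDistance G G' : ℝ)

/-! ### Deterministic query algorithms -/

/-- A deterministic adaptive algorithm on `N`-vertex graphs: a decision tree whose inner nodes query
the adjacency of a pair of vertices and whose leaves accept (`true`) or reject (`false`). -/
inductive DecisionTree (N : ℕ) : Type
  | answer (b : Bool) : DecisionTree N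
  | query (u v : Fin N) (ifEdge ifNonEdge : DecisionTree N) : DecisionTree N

/-- The largest number of queries that the decision tree makes on any input. -/
def DecisionTree.queryCount {N : ℕ} : DecisionTree N → ℕ
  | .answer _ => 0
  | .query _ _ T₁ T₀ => max T₁.queryCount T₀.queryCount + 1

open Classical in
/-- The verdict of the decision tree on the input graph `G`. -/
noncomputable def DecisionTree.run {N : ℕ} (G : SimpleGraph (Fin N)) : DecisionTree N → Bool
  | .answer b => b
  | .query u v T₁ T₀ => if G.Adj u v then T₁.run G else T₀.run G

/-- A deterministic non-adaptive algorithm on `N`-vertex graphs: a list of queries that is fixed in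
advance, and a verdict computed from the list of answers. -/
structure NonAdaptiveAlgorithm (N : ℕ) : Type where
  queries : List (Fin N × Fin N)
  verdict : List Bool → Bool

/-- The number of queries of a non-adaptive algorithm. -/
def NonAdaptiveAlgorithm.queryCount {N : ℕ} (A : NonAdaptiveAlgorithm N) : ℕ :=
  A.queries.length

open Classical in
/-- The verdict of the non-adaptive algorithm on the input graph `G`. -/
noncomputable def NonAdaptiveAlgorithm.run {N : ℕ} (G : SimpleGraph (Fin N))
    (A : NonAdaptiveAlgorithm N) : Bool :=
  A.verdict (A.queries.map fun p => decide (G.Adj p.1 p.2))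

/-! ### Testers and query complexity -/

/-- A randomized algorithm, i.e. a probability distribution `μ` on deterministic algorithms, is an
`ε`-tester for `P` on `N`-vertex graphs: it accepts every graph in `P` with probability more than
`2/3` and rejects every graph that is `ε`-far from `P` with probability more than `2/3`. -/
def IsTester (P : GraphProperty) (ε : ℝ) {N : ℕ} {A : Type}
    (run : SimpleGraph (Fin N) → A → Bool) (μ : PMF A) : Prop :=
  (∀ G : SimpleGraph (Fin N), P.Mem G → 2 / 3 < (μ.map (run G)) true) ∧
  (∀ G : SimpleGraph (Fin N), IsFar P ε G → 2 / 3 < (μ.map (run G)) false)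

/-- `P` can be `ε`-tested adaptively with at most `q` queries, whatever the number `N ≥ 1` of
vertices is. -/
def AdaptivelyTestable (P : GraphProperty) (ε : ℝ) (q : ℕ) : Prop :=
  ∀ N : ℕ, 1 ≤ N → ∃ μ : PMF (DecisionTree N),
    (∀ T ∈ μ.support, T.queryCount ≤ q) ∧ IsTester P ε DecisionTree.run μ

/-- `P` can be `ε`-tested non-adaptively with at most `q` queries, whatever the number `N ≥ 1` of
vertices is. -/
def NonAdaptivelyTestable (P : GraphProperty) (ε : ℝ) (q : ℕ) : Prop :=
  ∀ N : ℕ, 1 ≤ N → ∃ μ : PMF (NonAdaptiveAlgorithm N),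
    (∀ A ∈ μ.support, A.queryCount ≤ q) ∧ IsTester P ε NonAdaptiveAlgorithm.run μ

/-- `q` is the adaptive query complexity of `ε`-testing `P`. -/
def IsAdaptiveQueryComplexity (P : GraphProperty) (ε : ℝ) (q : ℕ) : Prop :=
  IsLeast {m : ℕ | AdaptivelyTestable P ε m} q

/-- `q` is the non-adaptive query complexity of `ε`-testing `P`. -/
def IsNonAdaptiveQueryComplexity (P : GraphProperty) (ε : ℝ) (q : ℕ) : Prop :=
  IsLeast {m : ℕ | NonAdaptivelyTestable P ε m} q

/-! ### Blow-ups and blow-up collections -/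

/-- `G` is a blow-up of `H`: the vertices of `G` are partitioned into (possibly empty) clusters
`f ⁻¹' {i}`, one for every vertex `i` of `H`, and two vertices of `G` are adjacent if and only if
their clusters correspond to adjacent vertices of `H`. -/
def IsBlowUp {V W : Type} (H : SimpleGraph W) (G : SimpleGraph V) : Prop :=
  ∃ f : V → W, ∀ u v : V, G.Adj u v ↔ H.Adj (f u) (f v)

/-- `G` is a blow-up collection of `H`: the vertices of `G` are partitioned into parts `p ⁻¹' {i}`
that each induce a blow-up of `H` and have no edges between them. -/
def IsBlowUpCollection {V W : Type} (H : SimpleGraph W) (G : SimpleGraph V) : Prop :=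
  ∃ (k : ℕ) (p : V → Fin k),
    (∀ i : Fin k, IsBlowUp H (G.induce {v : V | p v = i})) ∧
    (∀ u v : V, p u ≠ p v → ¬ G.Adj u v)

/-- Every vertex of the `N`-vertex graph `G` has degree at most `d N`. -/
def HasLowDegree (d : ℝ) {N : ℕ} (G : SimpleGraph (Fin N)) : Prop :=
  ∀ v : Fin N, ((G.neighborSet v).ncard : ℝ) ≤ d * N

theorem IsBlowUpCollection.of_iso {V V' W : Type} {H : SimpleGraph W} {G : SimpleGraph V}
    {G' : SimpleGraph V'} (e : G ≃g G') (h : IsBlowUpCollection H G) :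
    IsBlowUpCollection H G' := by
  obtain ⟨k, p, h₁, h₂⟩ := h
  refine ⟨k, fun v => p (e.symm v), fun i => ?_, fun u v huv hadj =>
    h₂ _ _ huv (e.symm.map_adj_iff.2 hadj)⟩
  obtain ⟨f, hf⟩ := h₁ i
  refine ⟨fun v => f ⟨e.symm v.1, v.2⟩, fun u v => ?_⟩
  rw [← hf]
  exact e.symm.map_adj_iff.symm

theorem HasLowDegree.of_iso {d : ℝ} {N : ℕ} {G G' : SimpleGraph (Fin N)} (e : G ≃g G')
    (h : HasLowDegree d G) : HasLowDegree d G' := by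
  intro v
  have hcard : (G'.neighborSet v).ncard = (G.neighborSet (e.symm v)).ncard :=
    Nat.card_congr (e.symm.mapNeighborSet v)
  rw [hcard]
  exact h _

/-- The property of having maximum degree at most `d N` and being a blow-up collection of `H`. -/
def lowDegreeBlowUpCollection {W : Type} (H : SimpleGraph W) (d : ℝ) : GraphProperty where
  Mem := fun G => HasLowDegree d G ∧ IsBlowUpCollection H G
  iso_mem := fun e h => ⟨h.1.of_iso e, h.2.of_iso e⟩

/-! ### Asymptotics up to polylogarithmic factors -/

/-- `f = Θ̃(g)` along the filter `l`: for some `k`, both `f = O(g log ^ k g)` and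
`g = O(f log ^ k g)`. -/
def IsSoftTheta {α : Type} (l : Filter α) (f g : α → ℝ) : Prop :=
  ∃ k : ℕ, (f =O[l] fun x => g x * Real.log (g x) ^ k) ∧
    (g =O[l] fun x => f x * Real.log (g x) ^ k)

end DenseGraphTesting

open DenseGraphTesting

namespace DenseGraphTesting

/-! ### Uniform averages and probabilities over finite types -/

/-! Put `d = ⌊c ε N⌋` and let ρ be d/N up to a constant, so that ρ is of order ε. The constant is c
= 128 t.

Structure. In a graph whose degrees are at most ρN, a connected k-tuple has probability O(ρ^(k-1)),
so densities of small subgraphs are measured against ρ^(k-1). For t ≥ 8 a connected graph is a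
blow-up of the t-cycle as soon as all its connected induced subgraphs on at most t vertices are
(`isBlowUp_of_forall_orderly`). This has a robust form. Take a typical twin-free connected
"template" tuple of the largest size m that is still frequent. Almost every way of attaching two
more vertices creates only twins of template entries, since otherwise a small obstruction or a
frequent larger template would appear. Hence the vertices that look like template entries form a set
which is nearly a blow-up of the cycle and nearly separated from the rest (`exists_blob`). Splitting
off such sets repeatedly (`exists_labelGraph`) and trimming the clusters to degree d
(`exists_low_degree_labelGraph`) shows that a graph with few high degrees and few small obstructions
is not ε-far (`exists_not_isFar`).

Upper bounds. Degrees are tested on dyadic scales with Õ(1/ε) non-adaptive queries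
(`eventually_hasTest_degrees`). Obstructions are found adaptively by growing a connected tuple: pick
a random earlier vertex, query about 1/ε random candidates, keep the first neighbour. Each
obstruction is hit often enough for constant total success probability
(`hasTest_obstruction_adaptive`). Non-adaptively, all pairs in a random sample of M vertices are
queried; a second moment argument requires M^k ρ^(k-1) to be large for all k ≤ t, that is, M of
order ε^(-(1-1/t)), which costs M² queries (`eventually_hasTest_obstructions_nonAdaptive`).

Lower bounds. Label the vertices at random by B ≍ 1/ε copies of the two sheets of a double covering
of the cycle. The trivial covering gives blow-ups of t-cycles, a graph with the property; the
connected covering gives blow-ups of 2t-cycles, a graph that is far (`isFar_comap_coverGraph`).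
Every query meets an edge with probability O(ε), and the empty graph has the property, so 1/ε
adaptive queries are needed (`lt_of_adaptivelyTestable`). For non-adaptive queries, relabelling the
sheets makes the two coverings agree on all queried pairs unless the queried pairs over cycle edges
contain a cycle winding around the t-cycle, hence of length at least t
(`exists_long_cycle_of_no_gauge`). A graph with q edges has O(q^(l/2)) closed walks of length l, and
each open path of l-1 edges consists of links with probability O(ε)^(l-1). So q^(t/2) ε^(t-1) must
be bounded below, which gives the exponent 2 - 2/t (`pr_no_gauge_le`,
`lt_of_nonAdaptivelyTestable`). -/

open Classical in
/-- The indicator of a proposition. -/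
noncomputable def ind (p : Prop) : ℝ := if p then 1 else 0

theorem ind_of {p : Prop} (h : p) : ind p = 1 := if_pos h

theorem ind_of_not {p : Prop} (h : ¬ p) : ind p = 0 := if_neg h

theorem ind_nonneg (p : Prop) : 0 ≤ ind p := by
  by_cases h : p <;> simp [ind, h]

theorem ind_le_one (p : Prop) : ind p ≤ 1 := by
  by_cases h : p <;> simp [ind, h]

theorem ind_mono {p q : Prop} (h : p → q) : ind p ≤ ind q := by
  by_cases hp : p
  · rw [ind_of hp, ind_of (h hp)]
  · rw [ind_of_not hp]; exact ind_nonneg _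

theorem ind_congr {p q : Prop} (h : p ↔ q) : ind p = ind q :=
  le_antisymm (ind_mono h.1) (ind_mono h.2)

theorem ind_and (p q : Prop) : ind (p ∧ q) = ind p * ind q := by
  by_cases hp : p <;> by_cases hq : q <;> simp [ind, hp, hq]

theorem ind_not (p : Prop) : ind (¬ p) = 1 - ind p := by
  by_cases hp : p <;> simp [ind, hp]

theorem ind_exists_le {ι : Type*} (s : Finset ι) (p : ι → Prop) :
    ind (∃ i ∈ s, p i) ≤ ∑ i ∈ s, ind (p i) := by
  by_cases h : ∃ i ∈ s, p i
  · obtain ⟨i, hi, hp⟩ := h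
    rw [ind_of ⟨i, hi, hp⟩, ← ind_of hp]
    exact Finset.single_le_sum (f := fun i => ind (p i)) (fun i _ => ind_nonneg _) hi
  · rw [ind_of_not h]
    exact Finset.sum_nonneg fun i _ => ind_nonneg _

/-- The uniform average of a function on a finite type. -/
noncomputable def avg {α : Type*} [Fintype α] (f : α → ℝ) : ℝ := (∑ a, f a) / Fintype.card α

/-- The probability of an event under the uniform distribution on a finite type. -/
noncomputable def pr {α : Type*} [Fintype α] (P : α → Prop) : ℝ := avg fun a => ind (P a)

section Avg

variable {α β : Type*} [Fintype α] [Fintype β]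

theorem avg_mono {f g : α → ℝ} (h : ∀ a, f a ≤ g a) : avg f ≤ avg g := by
  unfold avg
  gcongr
  exact h _

theorem avg_add (f g : α → ℝ) : avg (fun a => f a + g a) = avg f + avg g := by
  simp only [avg, Finset.sum_add_distrib, add_div]

theorem avg_sub (f g : α → ℝ) : avg (fun a => f a - g a) = avg f - avg g := by
  simp only [avg, Finset.sum_sub_distrib, sub_div]

theorem avg_mul_left (c : ℝ) (f : α → ℝ) : avg (fun a => c * f a) = c * avg f := by
  simp only [avg, ← Finset.mul_sum, mul_div_assoc]

theorem avg_mul_right (c : ℝ) (f : α → ℝ) : avg (fun a => f a * c) = avg f * c := by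
  simp only [avg, ← Finset.sum_mul, div_mul_eq_mul_div]

theorem avg_const [Nonempty α] (c : ℝ) : avg (fun _ : α => c) = c := by
  have : (Fintype.card α : ℝ) ≠ 0 := Nat.cast_ne_zero.2 Fintype.card_ne_zero
  simp [avg, this]

theorem avg_nonneg {f : α → ℝ} (h : ∀ a, 0 ≤ f a) : 0 ≤ avg f :=
  div_nonneg (Finset.sum_nonneg fun a _ => h a) (Nat.cast_nonneg _)

theorem avg_sum {ι : Type*} (s : Finset ι) (f : ι → α → ℝ) :
    avg (fun a => ∑ i ∈ s, f i a) = ∑ i ∈ s, avg (f i) := by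
  simp only [avg, ← Finset.sum_div]
  rw [Finset.sum_comm]

theorem sum_eq_card_mul_avg [Nonempty α] (f : α → ℝ) :
    ∑ a, f a = Fintype.card α * avg f := by
  have : (Fintype.card α : ℝ) ≠ 0 := Nat.cast_ne_zero.2 Fintype.card_ne_zero
  unfold avg
  field_simp

theorem avg_equiv (e : α ≃ β) (f : β → ℝ) : avg (fun a => f (e a)) = avg f := by
  simp only [avg, Fintype.card_congr e, Equiv.sum_comp e]

theorem avg_prod (f : α × β → ℝ) : avg f = avg fun a => avg fun b => f (a, b) := by
  simp only [avg, Fintype.sum_prod_type, Fintype.card_prod, Nat.cast_mul, ← Finset.sum_div,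
    div_div]
  rw [mul_comm]

theorem avg_pi {ι : Type*} [Fintype ι] [DecidableEq ι] {κ : ι → Type*} [∀ i, Fintype (κ i)]
    (f : ∀ i, κ i → ℝ) : avg (fun x : ∀ i, κ i => ∏ i, f i (x i)) = ∏ i, avg (f i) := by
  simp only [avg, Finset.prod_div_distrib, Fintype.card_pi, Nat.cast_prod]
  rw [Fintype.prod_sum]

theorem pr_nonneg (P : α → Prop) : 0 ≤ pr P := avg_nonneg fun _ => ind_nonneg _

theorem pr_le_one (P : α → Prop) : pr P ≤ 1 := by
  rcases isEmpty_or_nonempty α with h | h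
  · simp [pr, avg]
  · calc pr P ≤ avg fun _ : α => (1 : ℝ) := avg_mono fun _ => ind_le_one _
      _ = 1 := avg_const 1

theorem pr_mono {P Q : α → Prop} (h : ∀ a, P a → Q a) : pr P ≤ pr Q :=
  avg_mono fun a => ind_mono (h a)

theorem pr_congr {P Q : α → Prop} (h : ∀ a, P a ↔ Q a) : pr P = pr Q :=
  le_antisymm (pr_mono fun a => (h a).1) (pr_mono fun a => (h a).2)

theorem pr_not [Nonempty α] (P : α → Prop) : pr (fun a => ¬ P a) = 1 - pr P := by
  simp only [pr, ind_not, avg_sub, avg_const]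

theorem pr_eq_zero {P : α → Prop} (h : ∀ a, ¬ P a) : pr P = 0 := by
  simp only [pr, ind_of_not (h _)]
  simp [avg]

theorem pr_eq_one [Nonempty α] {P : α → Prop} (h : ∀ a, P a) : pr P = 1 := by
  simp only [pr, ind_of (h _), avg_const]

theorem pr_exists_le {ι : Type*} (s : Finset ι) (P : ι → α → Prop) :
    pr (fun a => ∃ i ∈ s, P i a) ≤ ∑ i ∈ s, pr (P i) := by
  unfold pr
  rw [← avg_sum]
  exact avg_mono fun a => ind_exists_le s fun i => P i a

theorem pr_or_le (P Q : α → Prop) : pr (fun a => P a ∨ Q a) ≤ pr P + pr Q := by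
  unfold pr
  rw [← avg_add]
  refine avg_mono fun a => ?_
  by_cases hp : P a
  · rw [ind_of hp]
    linarith [ind_le_one (P a ∨ Q a), ind_nonneg (Q a)]
  · rw [ind_of_not hp, zero_add]
    exact ind_mono (by tauto)

theorem pr_equiv (e : α ≃ β) (P : β → Prop) : pr (fun a => P (e a)) = pr P :=
  avg_equiv e fun b => ind (P b)

theorem pr_prod (P : α × β → Prop) : pr P = avg fun a => pr fun b => P (a, b) :=
  avg_prod fun x => ind (P x)

theorem sum_ind_mem (s : Finset α) : ∑ a, ind (a ∈ s) = s.card := by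
  classical
  have h : ∀ a, ind (a ∈ s) = if a ∈ s then 1 else 0 := fun a => by
    by_cases ha : a ∈ s <;> simp [ind, ha]
  simp only [h]
  simp

theorem pr_mem (s : Finset α) : pr (fun a => a ∈ s) = (s.card : ℝ) / Fintype.card α := by
  rw [pr, avg, sum_ind_mem]

theorem pr_le_avg_div {X : α → ℝ} (h : ∀ a, 0 ≤ X a) {c : ℝ} (hc : 0 < c) :
    pr (fun a => c ≤ X a) ≤ avg X / c := by
  rw [le_div_iff₀ hc, pr, ← avg_mul_right]
  refine avg_mono fun a => ?_
  by_cases hX : c ≤ X a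
  · rw [ind_of hX, one_mul]; exact hX
  · rw [ind_of_not hX, zero_mul]; exact h a

/-- The second moment bound on the probability that a random variable vanishes. -/
theorem pr_eq_zero_le [Nonempty α] (X : α → ℝ) (hX : 0 < avg X) :
    pr (fun a => X a = 0) ≤ (avg (fun a => X a ^ 2) - avg X ^ 2) / avg X ^ 2 := by
  set μ := avg X
  have h1 : avg (fun a => (X a - μ) ^ 2) = avg (fun a => X a ^ 2) - μ ^ 2 := by
    have : (fun a => (X a - μ) ^ 2) = fun a => (X a ^ 2 - (2 * μ) * X a) + μ ^ 2 := by
      ext a; ring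
    rw [this, avg_add, avg_sub, avg_mul_left, avg_const]
    ring
  rw [← h1]
  refine le_trans (pr_mono fun a ha => ?_)
    (pr_le_avg_div (X := fun a => (X a - μ) ^ 2) (fun a => sq_nonneg _) (by positivity))
  rw [ha]
  simp

end Avg

/-! ### Resampling and independence of coordinates of a random tuple -/

section Resampling

variable {ι V : Type*} [Fintype ι] [DecidableEq ι] [Fintype V]

/-- Resampling one coordinate does not change an average. -/
theorem avg_resample [Nonempty V] (i : ι) (f : (ι → V) → ℝ) :
    (avg fun v => avg fun x => f (Function.update v i x)) = avg f := by
  -- Swapping the fresh value with the old coordinate is an involution, so it preserves the uniform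
  -- distribution.
  let e : (ι → V) × V ≃ (ι → V) × V :=
    { toFun := fun p => (Function.update p.1 i p.2, p.1 i)
      invFun := fun p => (Function.update p.1 i p.2, p.1 i)
      left_inv := fun p => by simp
      right_inv := fun p => by simp }
  have h := avg_equiv e fun p => f p.1
  rw [avg_prod, avg_prod] at h
  simpa [e, avg_const] using h

theorem avg_comp_sumInl {κ : Type*} [Fintype κ] [DecidableEq κ] [Nonempty V]
    (f : (ι → V) → ℝ) (g : (κ → V) → ℝ) :
    avg (fun v : ι ⊕ κ → V => f (v ∘ Sum.inl) * g (v ∘ Sum.inr)) = avg f * avg g := by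
  have h := avg_equiv (Equiv.sumArrowEquivProdArrow ι κ V) fun p => f p.1 * g p.2
  rw [avg_prod] at h
  simp only [avg_mul_left, avg_mul_right] at h
  rw [← h]
  rfl

/-- The restriction of a uniformly random tuple to a subset of its coordinates is uniform. -/
theorem avg_comp_injective {κ : Type*} [Fintype κ] [DecidableEq κ] [Nonempty V]
    {e : κ → ι} (he : Function.Injective e) (f : (κ → V) → ℝ) :
    avg (fun v : ι → V => f (v ∘ e)) = avg f := by
  classical
  let e' : κ ⊕ {i // i ∉ Set.range e} ≃ ι :=
    ((Equiv.ofInjective e he).sumCongr (Equiv.refl _)).trans (Equiv.Set.sumCompl (Set.range e))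
  have h := avg_equiv (e'.arrowCongr (Equiv.refl V)) fun v : ι → V => f (v ∘ e)
  rw [← h]
  have h2 := avg_comp_sumInl (V := V) (κ := {i // i ∉ Set.range e}) f fun _ => (1 : ℝ)
  rw [avg_const, mul_one] at h2
  rw [← h2]
  congr 1
  ext v
  rw [mul_one]
  congr 1
  ext k
  simp only [Function.comp, Equiv.arrowCongr_apply, Equiv.refl_apply]
  congr 1
  rw [Equiv.symm_apply_eq]
  exact (Equiv.Set.sumCompl_apply_inl (Set.range e) ⟨e k, k, rfl⟩).symm

theorem pr_comp_injective {κ : Type*} [Fintype κ] [DecidableEq κ] [Nonempty V]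
    {e : κ → ι} (he : Function.Injective e) (P : (κ → V) → Prop) :
    pr (fun v : ι → V => P (v ∘ e)) = pr P :=
  avg_comp_injective he fun v => ind (P v)

/-- Functions of disjoint sets of coordinates of a uniformly random tuple are independent. -/
theorem avg_mul_of_disjoint {κ κ' : Type*} [Fintype κ] [DecidableEq κ] [Fintype κ']
    [DecidableEq κ'] [Nonempty V] {e : κ → ι} {e' : κ' → ι} (he : Function.Injective e)
    (he' : Function.Injective e') (hd : ∀ a b, e a ≠ e' b) (f : (κ → V) → ℝ) (g : (κ' → V) → ℝ) :
    avg (fun v : ι → V => f (v ∘ e) * g (v ∘ e')) = avg f * avg g := by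
  rw [← avg_comp_sumInl f g]
  rw [← avg_comp_injective (e := Sum.elim e e')
    (Function.Injective.sumElim he he' hd)]
  rfl

end Resampling

theorem avg_finCons {V : Type*} [Fintype V] (k : ℕ) (f : (Fin (k + 1) → V) → ℝ) :
    avg f = avg fun x : V => avg fun v : Fin k → V => f (Fin.cons x v) := by
  rw [← avg_equiv (Fin.consEquiv fun _ : Fin (k + 1) => V) f, avg_prod]
  rfl


/-! ### Cycles -/

/-- Replaces subtraction modulo t by linear conditions with the wrap-around pair made explicit, so
that `omega` decides adjacency. -/
theorem cycle_adj_iff {t : ℕ} (ht : 3 ≤ t) (a b : Fin t) :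
    (SimpleGraph.cycleGraph t).Adj a b ↔ a.val + 1 = b.val ∨ b.val + 1 = a.val ∨
      (a.val = 0 ∧ b.val + 1 = t) ∨ (b.val = 0 ∧ a.val + 1 = t) := by
  rw [SimpleGraph.cycleGraph_adj', Fin.val_sub, Fin.val_sub]
  have key : ∀ a b : Fin t, (t - b.val + a.val) % t = 1 ↔
      b.val + 1 = a.val ∨ (a.val = 0 ∧ b.val + 1 = t) := by
    intro a b
    have ha := a.isLt
    have hb := b.isLt
    rcases le_or_gt b.val a.val with h | h
    · have : t - b.val + a.val = (a.val - b.val) + t := by omega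
      rw [this, Nat.add_mod_right, Nat.mod_eq_of_lt (by omega)]
      omega
    · rw [Nat.mod_eq_of_lt (by omega)]
      omega
  rw [key, key]
  omega

theorem exists_cycle_neighbors {t : ℕ} (ht : 3 ≤ t) (a : Fin t) :
    ∃ p q : Fin t, p ≠ q ∧ ∀ b, (SimpleGraph.cycleGraph t).Adj a b ↔ b = p ∨ b = q := by
  have ha := a.isLt
  refine ⟨if h : a.val + 1 = t then ⟨0, by omega⟩ else ⟨a.val + 1, by omega⟩,
    if h : a.val = 0 then ⟨t - 1, by omega⟩ else ⟨a.val - 1, by omega⟩, ?_, fun b => ?_⟩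
  · intro h
    split_ifs at h <;> simp at h <;> omega
  · have hb := b.isLt
    rw [cycle_adj_iff ht]
    split_ifs <;> simp only [Fin.ext_iff] <;> omega

/-! ### Twins, linked sets, and orderly tuples -/

/-- `G` has no two distinct vertices with the same neighbours. -/
def TwinFree {I : Type} (H : SimpleGraph I) : Prop :=
  ∀ a b, (∀ c, H.Adj a c ↔ H.Adj b c) → a = b

/-- Every vertex of the tuple but the first one is adjacent to an earlier one. -/
def Orderly {I : Type} (H : SimpleGraph I) {k : ℕ} (v : Fin k → I) : Prop :=
  ∀ j : Fin k, 0 < j.val → ∃ i < j, H.Adj (v i) (v j)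

/-- `H` induces a preconnected graph on `S`: no nonempty proper subset of `S` is closed under
adjacency in `S`. -/
def LinkedOn {I : Type} (H : SimpleGraph I) (S : Set I) : Prop :=
  ∀ T ⊆ S, T.Nonempty → (∀ a ∈ T, ∀ b ∈ S, H.Adj a b → b ∈ T) → T = S

section

variable {I J : Type} {H : SimpleGraph I}

theorem IsBlowUp.comap {W : Type} {C : SimpleGraph W} (h : IsBlowUp C H) (g : J → I) :
    IsBlowUp C (H.comap g) := by
  obtain ⟨f, hf⟩ := h
  exact ⟨f ∘ g, fun u v => hf _ _⟩

/-- A nonempty set closed under adjacency descends along earlier neighbours to the first entry and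
from there climbs to every entry. -/
theorem Orderly.linkedOn {k : ℕ} {v : Fin k → I} (h : Orderly H v) :
    LinkedOn H (Set.range v) := by
  intro T hT hne hcl
  obtain ⟨x, hx⟩ := hne
  obtain ⟨j, rfl⟩ := hT hx
  have hk : 0 < k := j.pos
  have down : ∀ n : ℕ, ∀ j : Fin k, j.val = n → v j ∈ T → v ⟨0, hk⟩ ∈ T := by
    intro n
    induction n using Nat.strong_induction_on with
    | _ n ih =>
      intro j hj hjT
      rcases Nat.eq_zero_or_pos j.val with h0 | h0
      · have : j = ⟨0, hk⟩ := Fin.ext h0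
        rwa [← this]
      · obtain ⟨i, hij, ha⟩ := h j h0
        exact ih i.val (by rw [← hj]; exact hij) i rfl (hcl _ hjT _ ⟨i, rfl⟩ ha.symm)
  have h0 := down _ j rfl hx
  have up : ∀ n : ℕ, ∀ j : Fin k, j.val = n → v j ∈ T := by
    intro n
    induction n using Nat.strong_induction_on with
    | _ n ih =>
      intro j hj
      rcases Nat.eq_zero_or_pos j.val with h1 | h1
      · have : j = ⟨0, hk⟩ := Fin.ext h1
        rwa [this]
      · obtain ⟨i, hij, ha⟩ := h j h1
        exact hcl _ (ih i.val (by rw [← hj]; exact hij) i rfl) _ ⟨j, rfl⟩ ha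
  refine Set.Subset.antisymm hT ?_
  rintro _ ⟨i, rfl⟩
  exact up _ i rfl

theorem LinkedOn.union {S T : Set I} (hS : LinkedOn H S) (hT : LinkedOn H T)
    (hne : (S ∩ T).Nonempty) : LinkedOn H (S ∪ T) := by
  intro U hU ⟨x, hx⟩ hcl
  have key : ∀ A, LinkedOn H A → A ⊆ S ∪ T → (U ∩ A).Nonempty → A ⊆ U := by
    intro A hA hAS hne'
    have := hA (U ∩ A) Set.inter_subset_right hne'
      (fun a ha b hb hab => ⟨hcl a ha.1 b (hAS hb) hab, hb⟩)
    rw [← this]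
    exact Set.inter_subset_left
  obtain ⟨y, hyS, hyT⟩ := hne
  have hSU : S ⊆ U ∧ T ⊆ U := by
    rcases hU hx with h | h
    · have h1 := key S hS Set.subset_union_left ⟨x, hx, h⟩
      exact ⟨h1, key T hT Set.subset_union_right ⟨y, h1 hyS, hyT⟩⟩
    · have h1 := key T hT Set.subset_union_right ⟨x, hx, h⟩
      exact ⟨key S hS Set.subset_union_left ⟨y, h1 hyT, hyS⟩, h1⟩
  exact Set.Subset.antisymm hU (Set.union_subset hSU.1 hSU.2)

theorem LinkedOn.insert {S : Set I} (hS : LinkedOn H S) {x y : I} (hx : x ∈ S)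
    (hxy : H.Adj x y) : LinkedOn H (insert y S) := by
  have h2 : LinkedOn H ({x, y} : Set I) := by
    intro T hT hne hcl
    refine Set.Subset.antisymm hT ?_
    obtain ⟨z, hz⟩ := hne
    have hxT : x ∈ T ∧ y ∈ T := by
      rcases hT hz with rfl | rfl
      · exact ⟨hz, hcl _ hz _ (by simp) hxy⟩
      · exact ⟨hcl _ hz _ (by simp) hxy.symm, hz⟩
    rintro w (rfl | rfl)
    · exact hxT.1
    · exact hxT.2
  have h3 := hS.union h2 ⟨x, hx, by simp⟩
  have : S ∪ {x, y} = Insert.insert y S := by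
    ext z
    simp only [Set.mem_union, Set.mem_insert_iff, Set.mem_singleton_iff]
    constructor
    · rintro (h | rfl | rfl)
      · exact Or.inr h
      · exact Or.inr hx
      · exact Or.inl rfl
    · rintro (rfl | h)
      · exact Or.inr (Or.inr rfl)
      · exact Or.inl h
  rwa [this] at h3

theorem LinkedOn.comap_val {S : Set I} (hS : LinkedOn H S) :
    LinkedOn (H.comap (Subtype.val : S → I)) Set.univ := by
  intro T _ hne hcl
  have := hS (Subtype.val '' T) (by rintro _ ⟨x, _, rfl⟩; exact x.2) (hne.image _) (by
    rintro _ ⟨x, hx, rfl⟩ b hb hab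
    exact ⟨⟨b, hb⟩, hcl x hx ⟨b, hb⟩ trivial hab, rfl⟩)
  ext x
  simp only [Set.mem_univ, iff_true]
  have hx : x.val ∈ Subtype.val '' T := by rw [this]; exact x.2
  obtain ⟨y, hy, hxy⟩ := hx
  rwa [← Subtype.ext hxy]

/-- Greedy construction: the vertices chosen so far form a nonempty proper subset, hence are not
closed under adjacency, and some new vertex with a chosen neighbour can be appended. -/
theorem LinkedOn.exists_orderly [Finite I] (hl : LinkedOn H Set.univ) (k : ℕ)
    (hk : k ≤ Nat.card I) : ∃ v : Fin k → I, Function.Injective v ∧ Orderly H v := by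
  induction k with
  | zero => exact ⟨Fin.elim0, fun i => i.elim0, fun i => i.elim0⟩
  | succ k ih =>
    obtain ⟨v, hinj, ho⟩ := ih (by omega)
    have hne : Set.range v ≠ Set.univ := by
      intro h
      have h1 := Nat.card_congr (Equiv.ofInjective v hinj)
      rw [h, Nat.card_univ, Nat.card_fin] at h1
      omega
    have hx : ∃ x ∉ Set.range v, 0 < k → ∃ i, H.Adj (v i) x := by
      by_cases hk0 : 0 < k
      · by_contra! hcon
        refine hne (hl (Set.range v) (Set.subset_univ _) ⟨v ⟨0, hk0⟩, ⟨_, rfl⟩⟩ ?_)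
        rintro _ ⟨i, rfl⟩ b _ hab
        by_contra hb
        exact (hcon b hb).2 i hab
      · obtain ⟨x, hx⟩ := (Set.ne_univ_iff_exists_notMem _).1 hne
        exact ⟨x, hx, fun h => absurd h hk0⟩
    obtain ⟨x, hx, hadj⟩ := hx
    refine ⟨Fin.snoc v x, Fin.snoc_injective_iff.2 ⟨hinj, hx⟩, ?_⟩
    intro j hj
    refine Fin.lastCases (fun hj => ?_) (fun j hj => ?_) j hj
    · obtain ⟨i, hi⟩ := hadj (by simpa using hj)
      exact ⟨i.castSucc, Fin.castSucc_lt_last i, by simpa using hi⟩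
    · obtain ⟨i, hij, hi⟩ := ho j (by simpa using hj)
      exact ⟨i.castSucc, by simpa using hij, by simpa using hi⟩

/-- An orderly tuple factors through an orderly tuple without repetitions. -/
theorem Orderly.exists_injective {k : ℕ} {v : Fin k → I} (h : Orderly H v) :
    ∃ k' ≤ k, ∃ (w : Fin k' → I) (g : Fin k → Fin k'),
      Function.Injective w ∧ Orderly H w ∧ v = w ∘ g := by
  obtain ⟨w, hw, ho⟩ := h.linkedOn.comap_val.exists_orderly (Nat.card (Set.range v)) le_rfl
  have hle : Nat.card (Set.range v) ≤ k := by
    have := Nat.card_le_card_of_surjective _ (Set.rangeFactorization_surjective (f := v))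
    simpa using this
  have hbij : Function.Bijective w :=
    (Nat.bijective_iff_injective_and_card w).2 ⟨hw, Nat.card_fin _⟩
  choose g hg using hbij.2
  refine ⟨_, hle, fun i => (w i).val, fun i => g ⟨v i, ⟨i, rfl⟩⟩,
    Subtype.val_injective.comp hw, ho, ?_⟩
  ext i
  simp only [Function.comp]
  rw [hg]

/-- Each twin class gets one representative, taken from `u` whenever the class meets `u`; the
hypothesis makes that choice unique. With `m = 0` this is the plain reduction to twin classes. -/
theorem exists_twin_rep {m : ℕ} (u : Fin m → I)
    (hu : ∀ i j, (∀ c, H.Adj (u i) c ↔ H.Adj (u j) c) → i = j) :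
    ∃ r : I → I, (∀ a c, H.Adj (r a) c ↔ H.Adj a c) ∧
      (∀ a b, (∀ c, H.Adj a c ↔ H.Adj b c) → r a = r b) ∧ ∀ i, r (u i) = u i := by
  classical
  let s : Setoid I :=
    { r := fun a b => ∀ c, H.Adj a c ↔ H.Adj b c
      iseqv := ⟨fun _ _ => Iff.rfl, fun h c => (h c).symm, fun h h' c => (h c).trans (h' c)⟩ }
  let r0 : Quotient s → I := fun q => if h : ∃ i, (⟦u i⟧ : Quotient s) = q then u h.choose else q.out
  have hr0 : ∀ q, (⟦r0 q⟧ : Quotient s) = q := by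
    intro q
    by_cases h : ∃ i, (⟦u i⟧ : Quotient s) = q
    · simp only [r0, dif_pos h]
      exact h.choose_spec
    · simp only [r0, dif_neg h]
      exact Quotient.out_eq q
  refine ⟨fun a => r0 ⟦a⟧, fun a => ?_, fun a b hab => ?_, fun i => ?_⟩
  · exact Quotient.exact (hr0 ⟦a⟧)
  · have : (⟦a⟧ : Quotient s) = ⟦b⟧ := Quotient.sound hab
    simp only [this]
  · have h : ∃ j, (⟦u j⟧ : Quotient s) = ⟦u i⟧ := ⟨i, rfl⟩
    simp only [r0, dif_pos h]
    exact congrArg u (hu _ _ (Quotient.exact h.choose_spec))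

theorem rep_adj {r : I → I} (h1 : ∀ a c, H.Adj (r a) c ↔ H.Adj a c) (a b : I) :
    H.Adj (r a) (r b) ↔ H.Adj a b := by
  rw [h1, H.adj_comm, h1, H.adj_comm]

theorem linkedOn_rep {r : I → I} (h1 : ∀ a c, H.Adj (r a) c ↔ H.Adj a c)
    (hl : LinkedOn H Set.univ) :
    LinkedOn (H.comap (Subtype.val : Set.range r → I)) Set.univ := by
  intro T _ hne hcl
  obtain ⟨⟨_, ⟨x, rfl⟩⟩, hx⟩ := hne
  have := hl {a | (⟨r a, a, rfl⟩ : Set.range r) ∈ T} (Set.subset_univ _) ⟨x, hx⟩ (by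
    intro a ha b _ hab
    exact hcl _ ha ⟨r b, b, rfl⟩ trivial ((rep_adj h1 a b).2 hab))
  ext ⟨_, ⟨a, rfl⟩⟩
  simp only [Set.mem_univ, iff_true]
  have ha : a ∈ {a | (⟨r a, a, rfl⟩ : Set.range r) ∈ T} := by rw [this]; trivial
  exact ha

theorem twinFree_rep {r : I → I} (h1 : ∀ a c, H.Adj (r a) c ↔ H.Adj a c)
    (h2 : ∀ a b, (∀ c, H.Adj a c ↔ H.Adj b c) → r a = r b) :
    TwinFree (H.comap (Subtype.val : Set.range r → I)) := by
  rintro ⟨_, ⟨a, rfl⟩⟩ ⟨_, ⟨b, rfl⟩⟩ hab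
  apply Subtype.ext
  refine h2 a b fun c => ?_
  have := hab ⟨r c, c, rfl⟩
  simpa [rep_adj h1] using this

end


/-! ### Small obstructions to being a blow-up of a cycle -/

section

variable {I : Type} {H : SimpleGraph I} {t : ℕ}

/-- Three neighbours, together with vertices separating them pairwise, form a connected tuple of
length 7 ≤ t. A map to the cycle must send the three neighbours to the two neighbours of one vertex,
so two of them coincide there, contradicting their separation. -/
theorem no_three_neighbors (ht : 8 ≤ t) (htf : TwinFree H)
    (h : ∀ k ≤ t, ∀ v : Fin k → I, Orderly H v →
      IsBlowUp (SimpleGraph.cycleGraph t) (H.comap v))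
    {v a b c : I} (ha : H.Adj v a) (hb : H.Adj v b) (hc : H.Adj v c)
    (hab : a ≠ b) (hac : a ≠ c) (hbc : b ≠ c) : False := by
  have sep : ∀ {x y : I}, x ≠ y → ∃ d, ¬ (H.Adj x d ↔ H.Adj y d) := by
    intro x y hxy
    by_contra! hcon
    exact hxy (htf x y hcon)
  obtain ⟨d₁, hd₁⟩ := sep hab
  obtain ⟨d₂, hd₂⟩ := sep hac
  obtain ⟨d₃, hd₃⟩ := sep hbc
  have ho : Orderly H ![v, a, b, c, d₁, d₂, d₃] := by
    have adj_or : ∀ {x y d : I}, ¬ (H.Adj x d ↔ H.Adj y d) → H.Adj x d ∨ H.Adj y d := by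
      intro x y d hd
      tauto
    intro j hj
    fin_cases j
    · simp at hj
    · exact ⟨0, by decide, ha⟩
    · exact ⟨0, by decide, hb⟩
    · exact ⟨0, by decide, hc⟩
    · rcases adj_or hd₁ with h | h
      · exact ⟨1, by decide, h⟩
      · exact ⟨2, by decide, h⟩
    · rcases adj_or hd₂ with h | h
      · exact ⟨1, by decide, h⟩
      · exact ⟨3, by decide, h⟩
    · rcases adj_or hd₃ with h | h
      · exact ⟨2, by decide, h⟩
      · exact ⟨3, by decide, h⟩
  obtain ⟨f, hf⟩ := h 7 (by omega) _ ho
  obtain ⟨p, q, -, hpq⟩ := exists_cycle_neighbors (by omega : 3 ≤ t) (f 0)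
  have h1 : f 1 = p ∨ f 1 = q := (hpq _).1 ((hf 0 1).1 ha)
  have h2 : f 2 = p ∨ f 2 = q := (hpq _).1 ((hf 0 2).1 hb)
  have h3 : f 3 = p ∨ f 3 = q := (hpq _).1 ((hf 0 3).1 hc)
  have e12 : f 1 ≠ f 2 := fun e => hd₁ ((hf 1 4).trans (by rw [e]; exact (hf 2 4).symm))
  have e13 : f 1 ≠ f 3 := fun e => hd₂ ((hf 1 5).trans (by rw [e]; exact (hf 3 5).symm))
  have e23 : f 2 ≠ f 3 := fun e => hd₃ ((hf 2 6).trans (by rw [e]; exact (hf 3 6).symm))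
  rcases h1 with h1 | h1 <;> rcases h2 with h2 | h2 <;> rcases h3 with h3 | h3 <;>
    simp_all

/-- If there are at most t vertices, the whole graph is one of the small tuples. Otherwise a
connected tuple of t + 1 vertices always leads to a vertex with three neighbours or to a component
that is too small. -/
theorem isBlowUp_of_twinFree [Finite I] (ht : 8 ≤ t) (htf : TwinFree H)
    (hl : LinkedOn H Set.univ)
    (h : ∀ k ≤ t, ∀ v : Fin k → I, Orderly H v →
      IsBlowUp (SimpleGraph.cycleGraph t) (H.comap v)) :
    IsBlowUp (SimpleGraph.cycleGraph t) H := by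
  classical
  rcases le_or_gt (Nat.card I) t with hcard | hcard
  · obtain ⟨v, hv, ho⟩ := hl.exists_orderly (Nat.card I) le_rfl
    have hbij : Function.Bijective v :=
      (Nat.bijective_iff_injective_and_card v).2 ⟨hv, Nat.card_fin _⟩
    obtain ⟨f, hf⟩ := h _ hcard v ho
    choose g hg using hbij.2
    refine ⟨f ∘ g, fun x y => ?_⟩
    have := hf (g x) (g y)
    simpa [hg] using this
  · exfalso
    obtain ⟨v, hv, ho⟩ := hl.exists_orderly (t + 1) hcard
    set w : Fin t → I := fun i => v i.castSucc with hw
    have hwinj : Function.Injective w := fun i j hij => Fin.castSucc_injective _ (hv hij)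
    have hwo : Orderly H w := by
      intro j hj
      obtain ⟨i, hij, hi⟩ := ho j.castSucc (by simpa using hj)
      refine ⟨⟨i.val, lt_of_lt_of_le hij (Nat.le_of_lt j.isLt)⟩, hij, hi⟩
    obtain ⟨i, hi, hiz⟩ := ho (Fin.last t) (by simp; omega)
    obtain ⟨i, rfl⟩ : ∃ i' : Fin t, i = i'.castSucc := ⟨⟨i.val, hi⟩, rfl⟩
    have hz : ∀ j : Fin t, w j ≠ v (Fin.last t) := fun j hj =>
      (Fin.castSucc_lt_last j).ne (hv hj)
    obtain ⟨f, hf⟩ := h t le_rfl w hwo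
    -- If `f` is injective, the first t vertices form a full t-cycle, so the neighbour of the last
    -- vertex already has two others. If not, two of the t vertices are twins inside the tuple.
    by_cases hinj : Function.Injective f
    · have hsurj := Finite.injective_iff_surjective.1 hinj
      obtain ⟨p, q, hpq, hnb⟩ := exists_cycle_neighbors (by omega : 3 ≤ t) (f i)
      obtain ⟨a, rfl⟩ := hsurj p
      obtain ⟨b, rfl⟩ := hsurj q
      have ha : H.Adj (w i) (w a) := (hf i a).2 ((hnb _).2 (Or.inl rfl))
      have hb : H.Adj (w i) (w b) := (hf i b).2 ((hnb _).2 (Or.inr rfl))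
      exact no_three_neighbors ht htf h ha hb hiz
        (fun e => hpq (congrArg f (hwinj e))) (hz a) (hz b)
    · simp only [Function.Injective] at hinj
      push Not at hinj
      obtain ⟨a, b, hfab, hab⟩ := hinj
      have htw : ∀ x, H.Adj (w a) (w x) ↔ H.Adj (w b) (w x) := fun x =>
        (hf a x).trans (by rw [hfab]; exact (hf b x).symm)
      set X : Finset (Fin t) := Finset.univ.filter fun x => H.Adj (w a) (w x) with hX
      have hXcard : X.card ≤ 2 := by
        by_contra! hcon
        obtain ⟨x, hx, y, hy, z, hz, hxy, hxz, hyz⟩ := Finset.two_lt_card.1 hcon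
        simp only [hX, Finset.mem_filter, Finset.mem_univ, true_and] at hx hy hz
        exact no_three_neighbors ht htf h hx hy hz (hwinj.ne hxy) (hwinj.ne hxz) (hwinj.ne hyz)
      -- The twins `a`, `b` and their common neighbours form a closed set: a further neighbour of
      -- some vertex in `X` would be its third. This set has at most 4 elements but must exhaust all
      -- t.
      have hcl := hwo.linkedOn (w '' ((insert a (insert b X) : Finset (Fin t)) : Set (Fin t)))
        (Set.image_subset_range _ _) ⟨w a, a, by simp, rfl⟩ (by
          rintro _ ⟨x, hx, rfl⟩ _ ⟨y, rfl⟩ hxy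
          refine ⟨y, ?_, rfl⟩
          simp only [Finset.coe_insert, Set.mem_insert_iff, Finset.mem_coe, hX,
            Finset.mem_filter, Finset.mem_univ, true_and] at hx ⊢
          rcases hx with rfl | rfl | hx
          · exact Or.inr (Or.inr hxy)
          · exact Or.inr (Or.inr ((htw y).2 hxy))
          · by_contra! hcon
            exact no_three_neighbors ht htf h hx.symm ((htw x).1 hx).symm hxy (hwinj.ne hab)
              (hwinj.ne (Ne.symm hcon.1)) (hwinj.ne (Ne.symm hcon.2.1)))
      have hall : (Finset.univ : Finset (Fin t)) ⊆ insert a (insert b X) := by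
        intro y _
        have hy : w y ∈ Set.range w := ⟨y, rfl⟩
        rw [← hcl] at hy
        obtain ⟨y', hy', e⟩ := hy
        rw [← hwinj e]
        exact hy'
      have h1 := Finset.card_le_card hall
      have h2 := Finset.card_insert_le a (insert b X)
      have h3 := Finset.card_insert_le b X
      rw [Finset.card_univ, Fintype.card_fin] at h1
      omega

theorem IsBlowUp.of_rep {W : Type} {C : SimpleGraph W} {r : I → I}
    (h1 : ∀ a c, H.Adj (r a) c ↔ H.Adj a c)
    (h : IsBlowUp C (H.comap (Subtype.val : Set.range r → I))) : IsBlowUp C H := by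
  obtain ⟨f, hf⟩ := h
  refine ⟨fun a => f ⟨r a, a, rfl⟩, fun a b => ?_⟩
  rw [← hf, ← rep_adj h1 a b]
  rfl

/-- A connected graph is a blow-up of the `t`-cycle if all its small connected induced subgraphs
are. -/
theorem isBlowUp_of_forall_orderly [Finite I] (ht : 8 ≤ t) (hl : LinkedOn H Set.univ)
    (h : ∀ k ≤ t, ∀ v : Fin k → I, Function.Injective v → Orderly H v →
      IsBlowUp (SimpleGraph.cycleGraph t) (H.comap v)) :
    IsBlowUp (SimpleGraph.cycleGraph t) H := by
  obtain ⟨r, h1, h2, -⟩ := exists_twin_rep (H := H) (m := 0) Fin.elim0 fun i => i.elim0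
  refine IsBlowUp.of_rep h1 (isBlowUp_of_twinFree ht (twinFree_rep h1 h2) (linkedOn_rep h1 hl) ?_)
  intro k hk v hv
  -- This tuple may have repetitions, while the hypothesis covers injective tuples only; hence the
  -- factorization through one without repetitions.
  have hv' : Orderly H fun i => (v i).val := hv
  obtain ⟨k', hk', w, g, hw, ho, hvw⟩ := hv'.exists_injective
  have h3 := (h k' (hk'.trans hk) w hw ho).comap g
  rw [SimpleGraph.comap_comap] at h3 ⊢
  have : (Subtype.val ∘ v : Fin k → I) = w ∘ g := hvw
  rwa [this]

/-- If a twin-free tuple does not represent all twin classes of a connected graph, then the graph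
has a small connected induced subgraph which is not a blow-up of the `t`-cycle or is twin-free and
larger than the tuple. -/
theorem exists_small_witness [Finite I] (ht : 8 ≤ t) (hl : LinkedOn H Set.univ) {m : ℕ}
    (u : Fin m → I) (hu : TwinFree (H.comap u))
    (hfit : ¬ ∀ a, ∃ i, ∀ c, H.Adj a c ↔ H.Adj (u i) c) :
    ∃ k ≤ t, ∃ v : Fin k → I, Function.Injective v ∧ Orderly H v ∧
      (¬ IsBlowUp (SimpleGraph.cycleGraph t) (H.comap v) ∨ (m < k ∧ TwinFree (H.comap v))) := by
  classical
  by_cases hA : ∀ k ≤ t, ∀ v : Fin k → I, Function.Injective v → Orderly H v →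
      IsBlowUp (SimpleGraph.cycleGraph t) (H.comap v)
  -- Without a small obstruction the whole graph is a blow-up and has at most t twin classes.
  -- Representatives of all of them form the larger twin-free tuple: were there at most m classes,
  -- `u` would already represent each.
  · obtain ⟨f, hf⟩ := isBlowUp_of_forall_orderly ht hl hA
    obtain ⟨r, h1, h2, hru⟩ := exists_twin_rep (H := H) u fun i j hij => hu i j fun c => hij (u c)
    have huinj : Function.Injective u := fun i j hij => hu i j fun c => by
      simp only [SimpleGraph.comap_adj, hij]
    have hcard_le : Nat.card (Set.range r) ≤ t := by
      have : Function.Injective fun x : Set.range r => f x.val := by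
        rintro ⟨_, ⟨a, rfl⟩⟩ ⟨_, ⟨b, rfl⟩⟩ hab
        refine Subtype.ext (h2 a b fun c => ?_)
        rw [← h1 a c, ← h1 b c, hf, hf]
        simp only at hab
        rw [hab]
      simpa using Nat.card_le_card_of_injective _ this
    have hcard_lt : m < Nat.card (Set.range r) := by
      by_contra! hcon
      apply hfit
      have hinj : Function.Injective fun i => (⟨u i, u i, hru i⟩ : Set.range r) :=
        fun i j hij => huinj (congrArg Subtype.val hij)
      have hm := Nat.card_le_card_of_injective _ hinj
      rw [Nat.card_fin] at hm
      have hbij := (Nat.bijective_iff_injective_and_card _).2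
        ⟨hinj, by rw [Nat.card_fin]; exact le_antisymm hm hcon⟩
      intro a
      obtain ⟨i, hi⟩ := hbij.2 ⟨r a, a, rfl⟩
      have hi' : u i = r a := congrArg Subtype.val hi
      exact ⟨i, fun c => by rw [hi', h1]⟩
    obtain ⟨v, hv, ho⟩ := (linkedOn_rep h1 hl).exists_orderly _ le_rfl
    have hbij : Function.Bijective v :=
      (Nat.bijective_iff_injective_and_card v).2 ⟨hv, Nat.card_fin _⟩
    refine ⟨_, hcard_le, fun i => (v i).val, Subtype.val_injective.comp hv, ho,
      Or.inr ⟨hcard_lt, ?_⟩⟩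
    intro i j hij
    refine hv (twinFree_rep h1 h2 _ _ fun c => ?_)
    obtain ⟨l, rfl⟩ := hbij.2 c
    exact hij l
  · push Not at hA
    obtain ⟨k, hk, v, hv, ho, hn⟩ := hA
    exact ⟨k, hk, v, hv, ho, Or.inl hn⟩

end


/-! ### Counting connected tuples in graphs of small maximum degree -/

section Linked

variable {V : Type} [Fintype V] [Nonempty V] {H : SimpleGraph V} {ρ : ℝ}
  {I : Type} [Fintype I] [DecidableEq I]

/-- Resample the coordinate `i`: the event `P` ignores it, and a fresh value is adjacent to `v j`
with probability at most ρ. Since the degree bound is only needed on `P`, it can also be applied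
with a bound that holds under `P` alone. -/
theorem pr_and_adj_le {i j : I} (hij : i ≠ j) {P : (I → V) → Prop}
    (hP : ∀ v x, P (Function.update v i x) ↔ P v)
    (hdeg : ∀ v, P v → pr (fun x => H.Adj (v j) x) ≤ ρ) :
    pr (fun v => P v ∧ H.Adj (v j) (v i)) ≤ ρ * pr P := by
  unfold pr
  rw [← avg_resample i, ← avg_mul_left]
  refine avg_mono fun v => ?_
  have : ∀ x, ind (P (Function.update v i x) ∧
      H.Adj (Function.update v i x j) (Function.update v i x i)) =
      ind (P v) * ind (H.Adj (v j) x) := by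
    intro x
    rw [ind_and, ind_congr (hP v x), Function.update_self, Function.update_of_ne hij.symm]
  simp only [this]
  rw [avg_mul_left]
  by_cases h : P v
  · rw [ind_of h, one_mul, mul_one]
    exact hdeg v h
  · rw [ind_of_not h, zero_mul, mul_zero]

/-- The probability that a random tuple satisfies a condition on the coordinates in `K` and is
connected on a larger set `S` of coordinates. -/
theorem pr_linkedOn_le (hρ : 0 ≤ ρ) (hdeg : ∀ v, pr (fun x => H.Adj v x) ≤ ρ) (S : Finset I) :
    ∀ (n : ℕ) (K : Finset I) (P : (I → V) → Prop), K ⊆ S → K.Nonempty → (S \ K).card = n →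
      (∀ v w, (∀ i ∈ K, v i = w i) → P v → P w) →
      pr (fun v => P v ∧ LinkedOn (H.comap v) (S : Set I)) ≤
        ((Fintype.card I : ℝ) ^ 2 * ρ) ^ n * pr P := by
  intro n
  induction n with
  | zero =>
    intro K P _ _ _ _
    rw [pow_zero, one_mul]
    exact pr_mono fun v h => h.1
  | succ n ih =>
    intro K P hKS hK hn hP
    -- Connectivity forces an edge from `K` to the rest of `S`. Exposing its outer endpoint costs a
    -- factor ρ, and there are at most |I|² places for the edge.
    have hsub : ∀ v, (P v ∧ LinkedOn (H.comap v) (S : Set I)) →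
        ∃ e ∈ K ×ˢ (S \ K), (P v ∧ H.Adj (v e.1) (v e.2)) ∧ LinkedOn (H.comap v) (S : Set I) := by
      rintro v ⟨hPv, hl⟩
      by_contra! hcon
      have hKeq := hl K (by exact_mod_cast hKS) (by exact_mod_cast hK) (by
        intro a ha b hb hab
        by_contra hbK
        exact hcon (a, b) (Finset.mem_product.2 ⟨by exact_mod_cast ha,
          Finset.mem_sdiff.2 ⟨by exact_mod_cast hb, by exact_mod_cast hbK⟩⟩) ⟨hPv, hab⟩ hl)
      have : K = S := by exact_mod_cast hKeq
      rw [this, Finset.sdiff_self, Finset.card_empty] at hn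
      omega
    have hterm : ∀ e ∈ K ×ˢ (S \ K),
        pr (fun v => (P v ∧ H.Adj (v e.1) (v e.2)) ∧ LinkedOn (H.comap v) (S : Set I)) ≤
          ((Fintype.card I : ℝ) ^ 2 * ρ) ^ n * (ρ * pr P) := by
      rintro ⟨a, b⟩ he
      obtain ⟨ha, hb⟩ := Finset.mem_product.1 he
      obtain ⟨hbS, hbK⟩ := Finset.mem_sdiff.1 hb
      have hab : b ≠ a := fun h => hbK (h ▸ ha)
      refine (ih (insert b K) (fun v => P v ∧ H.Adj (v a) (v b))
        (Finset.insert_subset hbS hKS) (Finset.insert_nonempty _ _) ?_ ?_).trans ?_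
      · have h1 : S \ insert b K = (S \ K).erase b := by
          ext x; simp only [Finset.mem_sdiff, Finset.mem_insert, Finset.mem_erase]; tauto
        rw [h1, Finset.card_erase_of_mem hb]
        omega
      · rintro v w hvw ⟨h1, h2⟩
        refine ⟨hP v w (fun i hi => hvw i (Finset.mem_insert_of_mem hi)) h1, ?_⟩
        rwa [← hvw a (Finset.mem_insert_of_mem ha), ← hvw b (Finset.mem_insert_self _ _)]
      · gcongr
        refine pr_and_adj_le hab (fun v x => ?_) fun v _ => hdeg _
        have hagree : ∀ i ∈ K, Function.update v b x i = v i := fun i hi =>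
          Function.update_of_ne (by rintro rfl; exact hbK hi) _ _
        exact ⟨hP _ _ hagree, hP _ _ fun i hi => (hagree i hi).symm⟩
    calc pr (fun v => P v ∧ LinkedOn (H.comap v) (S : Set I))
        ≤ ∑ e ∈ K ×ˢ (S \ K),
          pr (fun v => (P v ∧ H.Adj (v e.1) (v e.2)) ∧ LinkedOn (H.comap v) (S : Set I)) :=
          (pr_mono hsub).trans (pr_exists_le _ _)
      _ ≤ ∑ _e ∈ K ×ˢ (S \ K), ((Fintype.card I : ℝ) ^ 2 * ρ) ^ n * (ρ * pr P) :=
          Finset.sum_le_sum hterm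
      _ = ((K ×ˢ (S \ K)).card : ℝ) * (((Fintype.card I : ℝ) ^ 2 * ρ) ^ n * (ρ * pr P)) := by
          rw [Finset.sum_const, nsmul_eq_mul]
      _ ≤ (Fintype.card I : ℝ) ^ 2 * (((Fintype.card I : ℝ) ^ 2 * ρ) ^ n * (ρ * pr P)) := by
          have hp := pr_nonneg P
          have : ((K ×ˢ (S \ K)).card : ℝ) ≤ (Fintype.card I : ℝ) ^ 2 := by
            rw [Finset.card_product, sq]
            push_cast
            gcongr <;> exact Finset.card_le_univ _
          gcongr
      _ = ((Fintype.card I : ℝ) ^ 2 * ρ) ^ (n + 1) * pr P := by ring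

end Linked


/-! ### Extensions of a template tuple by two vertices -/

section Configurations

variable {V : Type} [Fintype V] [Nonempty V] {H : SimpleGraph V} {ρ : ℝ} {t m : ℕ}

/-- Every vertex of the configuration is a twin, within the configuration, of one of the first
`m` vertices. -/
def Fits (H : SimpleGraph V) {m : ℕ} (c : Fin m ⊕ Fin 2 → V) : Prop :=
  ∀ a, ∃ i : Fin m, ∀ e, H.Adj (c a) (c e) ↔ H.Adj (c (Sum.inl i)) (c e)

/-- A connected configuration extending a twin-free tuple in such a way that the new vertices are
not twins of old ones. -/
def BadConfiguration (H : SimpleGraph V) {m : ℕ} (c : Fin m ⊕ Fin 2 → V) : Prop :=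
  TwinFree (H.comap (c ∘ Sum.inl)) ∧ LinkedOn (H.comap c) Set.univ ∧ ¬ Fits H c

/-- The constant in the bound on the probability of bad configurations. -/
noncomputable def configurationConstant (t : ℕ) : ℝ :=
  (t + 1) * (t + 2) ^ t * (2 * ((t + 2 : ℝ) ^ 2) ^ (t + 2))

/-- A bad configuration contains a witness from `exists_small_witness`, which is rarer than a
typical connected tuple by a factor δ. Every vertex outside the witness is attached through an edge
and costs ρ, so m + 2 connected vertices cost δ ρ^(m+1) in total. -/
theorem pr_badConfiguration_le (ht : 8 ≤ t) (hm : 2 ≤ m) (hmt : m ≤ t) (hρ : 0 ≤ ρ)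
    (hdeg : ∀ v, pr (fun x => H.Adj v x) ≤ ρ) {δ : ℝ} (hδ : 0 ≤ δ)
    (hw : ∀ k, 2 ≤ k → k ≤ t → pr (fun v : Fin k → V => Orderly H v ∧
      ¬ IsBlowUp (SimpleGraph.cycleGraph t) (H.comap v)) ≤ δ * ρ ^ (k - 1))
    (hr : ∀ k, m < k → k ≤ t → pr (fun v : Fin k → V => Orderly H v ∧
      TwinFree (H.comap v)) ≤ δ * ρ ^ (k - 1)) :
    pr (fun c : Fin m ⊕ Fin 2 → V => BadConfiguration H c) ≤
      configurationConstant t * (δ * ρ ^ (m + 1)) := by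
  classical
  let W : (k : ℕ) → (Fin k → V) → Prop := fun k v => Orderly H v ∧
    (¬ IsBlowUp (SimpleGraph.cycleGraph t) (H.comap v) ∨ (m < k ∧ TwinFree (H.comap v)))
  have hW : ∀ k, 2 ≤ k → k ≤ t → pr (W k) ≤ 2 * δ * ρ ^ (k - 1) := by
    intro k hk hkt
    have h1 : pr (W k) ≤ pr (fun v : Fin k → V => Orderly H v ∧
        ¬ IsBlowUp (SimpleGraph.cycleGraph t) (H.comap v)) +
        pr (fun v : Fin k → V => m < k ∧ (Orderly H v ∧ TwinFree (H.comap v))) :=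
      (pr_mono fun v hv => by tauto).trans (pr_or_le _ _)
    have h2 : pr (fun v : Fin k → V => m < k ∧ (Orderly H v ∧ TwinFree (H.comap v))) ≤
        δ * ρ ^ (k - 1) := by
      by_cases hmk : m < k
      · exact (pr_mono fun v hv => hv.2).trans (hr k hmk hkt)
      · rw [pr_eq_zero fun v hv => hmk hv.1]
        positivity
    linarith [hw k hk hkt]
  -- Tuples of length below 2 are blow-ups by a constant map, so they could only be witnesses by
  -- being longer than m ≥ 2, which is impossible.
  have hsmall : ∀ k, k < 2 → ∀ v : Fin k → V, W k v → m < k := by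
    intro k hk v hv
    rcases hv.2 with h | h
    · refine absurd ⟨fun _ => ⟨0, by omega⟩, fun a b => ?_⟩ h
      have : a = b := Fin.ext (by omega)
      simp [this]
    · exact h.1
  have hsub : ∀ c : Fin m ⊕ Fin 2 → V, BadConfiguration H c →
      ∃ k ∈ Finset.range (t + 1), ∃ v ∈ (Finset.univ : Finset (Fin k → Fin m ⊕ Fin 2)),
        (Function.Injective v ∧ 2 ≤ k ∧ W k (c ∘ v)) ∧
          LinkedOn (H.comap c) ((Finset.univ : Finset (Fin m ⊕ Fin 2)) : Set (Fin m ⊕ Fin 2)) := by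
    intro c hc
    obtain ⟨k, hk, v, hv, ho, h⟩ := exists_small_witness ht hc.2.1 Sum.inl hc.1 hc.2.2
    refine ⟨k, Finset.mem_range.2 (by omega), v, Finset.mem_univ _, ?_⟩
    have hWk : W k (c ∘ v) := ⟨ho, h⟩
    refine ⟨⟨hv, ?_, hWk⟩, by rw [Finset.coe_univ]; exact hc.2.1⟩
    by_contra hk2
    have := hsmall k (by omega) _ hWk
    omega
  have ht2 : (1 : ℝ) ≤ t + 2 := by
    have : (0 : ℝ) ≤ t := Nat.cast_nonneg t
    linarith
  have hcardI : (Fintype.card (Fin m ⊕ Fin 2) : ℝ) ≤ t + 2 := by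
    have : (m : ℝ) ≤ t := by exact_mod_cast hmt
    simp only [Fintype.card_sum, Fintype.card_fin]
    push_cast
    linarith
  -- Bound for one witness length and one placement of the witness; there are at most t + 1 lengths
  -- and (t + 2)^t placements for each.
  set X : ℝ := 2 * ((t + 2 : ℝ) ^ 2) ^ (t + 2) * (δ * ρ ^ (m + 1)) with hX
  have hX0 : 0 ≤ X := by positivity
  have hterm : ∀ k ∈ Finset.range (t + 1), ∀ v : Fin k → Fin m ⊕ Fin 2,
      pr (fun c : Fin m ⊕ Fin 2 → V => (Function.Injective v ∧ 2 ≤ k ∧ W k (c ∘ v)) ∧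
          LinkedOn (H.comap c) ((Finset.univ : Finset (Fin m ⊕ Fin 2)) : Set (Fin m ⊕ Fin 2)))
        ≤ X := by
    intro k hk v
    by_cases hv : Function.Injective v ∧ 2 ≤ k
    · have hkt : k ≤ t := by have := Finset.mem_range.1 hk; omega
      have hkm : k ≤ m + 2 := by simpa using Fintype.card_le_of_injective v hv.1
      have hcard : (Finset.univ \ Finset.univ.image v : Finset (Fin m ⊕ Fin 2)).card
          = m + 2 - k := by
        rw [Finset.card_sdiff_of_subset (Finset.subset_univ _),
          Finset.card_image_of_injective _ hv.1]
        simp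
      have h1 := pr_linkedOn_le (I := Fin m ⊕ Fin 2) hρ hdeg Finset.univ (m + 2 - k)
        (Finset.univ.image v) (fun c => W k (c ∘ v)) (Finset.subset_univ _)
        (Finset.Nonempty.image ⟨⟨0, by omega⟩, Finset.mem_univ _⟩ _) hcard (by
          intro c c' hcc hc
          have : c ∘ v = c' ∘ v := by
            ext i
            exact hcc _ (Finset.mem_image_of_mem _ (Finset.mem_univ _))
          rwa [← this])
      rw [pr_comp_injective hv.1 (W k)] at h1
      refine (pr_mono fun c hc => ⟨hc.1.2.2, hc.2⟩).trans (h1.trans ?_)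
      calc ((Fintype.card (Fin m ⊕ Fin 2) : ℝ) ^ 2 * ρ) ^ (m + 2 - k) * pr (W k)
          ≤ ((t + 2 : ℝ) ^ 2 * ρ) ^ (m + 2 - k) * (2 * δ * ρ ^ (k - 1)) := by
            gcongr
            · exact pr_nonneg _
            · exact hW k hv.2 hkt
        _ = 2 * ((t + 2 : ℝ) ^ 2) ^ (m + 2 - k) * (δ * ρ ^ (m + 1)) := by
            rw [mul_pow]
            have : m + 1 = (m + 2 - k) + (k - 1) := by omega
            rw [this, pow_add]
            ring
        _ ≤ X := by
            rw [hX]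
            have hone : (1 : ℝ) ≤ (t + 2 : ℝ) ^ 2 := one_le_pow₀ ht2
            gcongr
            omega
    · rw [pr_eq_zero fun c hc => hv ⟨hc.1.1, hc.1.2.1⟩]
      exact hX0
  calc pr (fun c : Fin m ⊕ Fin 2 → V => BadConfiguration H c)
      ≤ ∑ k ∈ Finset.range (t + 1), ∑ v : Fin k → Fin m ⊕ Fin 2,
        pr (fun c : Fin m ⊕ Fin 2 → V => (Function.Injective v ∧ 2 ≤ k ∧ W k (c ∘ v)) ∧
          LinkedOn (H.comap c)
            ((Finset.univ : Finset (Fin m ⊕ Fin 2)) : Set (Fin m ⊕ Fin 2))) := by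
        refine (pr_mono hsub).trans ((pr_exists_le _ _).trans ?_)
        exact Finset.sum_le_sum fun k _ => pr_exists_le _ _
    _ ≤ ∑ k ∈ Finset.range (t + 1), ∑ _v : Fin k → Fin m ⊕ Fin 2, X :=
        Finset.sum_le_sum fun k hk => Finset.sum_le_sum fun v _ => hterm k hk v
    _ ≤ ∑ _k ∈ Finset.range (t + 1), (t + 2 : ℝ) ^ t * X := by
        refine Finset.sum_le_sum fun k hk => ?_
        have hkt : k ≤ t := by have := Finset.mem_range.1 hk; omega
        rw [Finset.sum_const, nsmul_eq_mul, Finset.card_univ, Fintype.card_fun, Fintype.card_fin]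
        push_cast
        gcongr
        calc (Fintype.card (Fin m ⊕ Fin 2) : ℝ) ^ k ≤ (t + 2 : ℝ) ^ k := by gcongr
          _ ≤ (t + 2 : ℝ) ^ t := pow_le_pow_right₀ ht2 hkt
    _ = configurationConstant t * (δ * ρ ^ (m + 1)) := by
        rw [Finset.sum_const, nsmul_eq_mul, Finset.card_range, configurationConstant, hX]
        push_cast
        ring

/-- The extension to a twin-free orderly tuple of an edge whose first endpoint has few
neighbours. -/
theorem pr_orderly_low_degree_le (hm : 2 ≤ m) (hmt : m ≤ t) (hρ : 0 ≤ ρ)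
    (hdeg : ∀ v, pr (fun x => H.Adj v x) ≤ ρ) {τ : ℝ} (hτ : 0 ≤ τ) :
    pr (fun u : Fin m → V => Orderly H u ∧ pr (fun x => H.Adj (u ⟨0, by omega⟩) x) < τ * ρ) ≤
      ((t + 2 : ℝ) ^ 2) ^ t * (τ * ρ ^ (m - 1)) := by
  classical
  set i₀ : Fin m := ⟨0, by omega⟩
  set i₁ : Fin m := ⟨1, by omega⟩
  have hne : i₁ ≠ i₀ := by simp [i₀, i₁]
  -- The edge between the first two entries is counted with the smaller degree bound τρ; the other m
  -- - 2 entries cost ρ each.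
  have hP : pr (fun u : Fin m → V => pr (fun x => H.Adj (u i₀) x) < τ * ρ ∧
      H.Adj (u i₀) (u i₁)) ≤ τ * ρ := by
    refine (pr_and_adj_le (ρ := τ * ρ) hne (fun v x => ?_) fun v hv => hv.le).trans ?_
    · rw [Function.update_of_ne hne.symm]
    · calc τ * ρ * pr _ ≤ τ * ρ * 1 := by
            gcongr
            exact pr_le_one _
        _ = τ * ρ := mul_one _
  have hcard : (Finset.univ \ {i₀, i₁} : Finset (Fin m)).card = m - 2 := by
    rw [Finset.card_sdiff_of_subset (Finset.subset_univ _), Finset.card_pair hne.symm]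
    simp
  have h1 := pr_linkedOn_le (I := Fin m) hρ hdeg Finset.univ (m - 2) {i₀, i₁}
    (fun u => pr (fun x => H.Adj (u i₀) x) < τ * ρ ∧ H.Adj (u i₀) (u i₁))
    (Finset.subset_univ _) ⟨i₀, by simp⟩ hcard (by
      intro c c' hcc hc
      have h0 := hcc i₀ (by simp)
      have h1 := hcc i₁ (by simp)
      rwa [← h0, ← h1])
  have ht2 : (1 : ℝ) ≤ t + 2 := by
    have : (0 : ℝ) ≤ t := Nat.cast_nonneg t
    linarith
  calc pr (fun u : Fin m → V => Orderly H u ∧ pr (fun x => H.Adj (u i₀) x) < τ * ρ)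
      ≤ pr (fun u : Fin m → V => (pr (fun x => H.Adj (u i₀) x) < τ * ρ ∧ H.Adj (u i₀) (u i₁)) ∧
        LinkedOn (H.comap u) ((Finset.univ : Finset (Fin m)) : Set (Fin m))) := by
        refine pr_mono fun u hu => ⟨⟨hu.2, ?_⟩, ?_⟩
        · obtain ⟨i, hi, hadj⟩ := hu.1 i₁ (by simp [i₁])
          have : i = i₀ := by
            apply Fin.ext
            have : i.val < 1 := hi
            simp only [i₀]
            omega
          rwa [this] at hadj
        · have h := Orderly.linkedOn (H := H.comap u) (v := id) hu.1
          rwa [Set.range_id, ← Finset.coe_univ] at h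
    _ ≤ _ := h1
    _ ≤ ((t : ℝ) ^ 2 * ρ) ^ (m - 2) * (τ * ρ) := by
        have hmt' : (m : ℝ) ≤ t := by exact_mod_cast hmt
        rw [Fintype.card_fin]
        gcongr
        exact pr_nonneg _
    _ = ((t : ℝ) ^ 2) ^ (m - 2) * (τ * ρ ^ (m - 1)) := by
        have : m - 1 = (m - 2) + 1 := by omega
        rw [mul_pow, this, pow_succ]
        ring
    _ ≤ ((t + 2 : ℝ) ^ 2) ^ t * (τ * ρ ^ (m - 1)) := by
        gcongr
        calc ((t : ℝ) ^ 2) ^ (m - 2) ≤ ((t + 2 : ℝ) ^ 2) ^ (m - 2) := by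
              gcongr
              linarith
          _ ≤ ((t + 2 : ℝ) ^ 2) ^ t := pow_le_pow_right₀ (one_le_pow₀ ht2) (by omega)

end Configurations


/-! ### From a typical template to a nearly separated part of the graph -/

section Blob

variable {V : Type} {H : SimpleGraph V} {ρ : ℝ} {t m : ℕ}

/-- The vertices whose adjacency to the tuple `u` is that of an entry of `u`. -/
def twinSet (H : SimpleGraph V) (u : Fin m → V) : Set V :=
  {x | ∃ i, ∀ l, H.Adj x (u l) ↔ H.Adj (u i) (u l)}

/-- Only connectivity needs an argument: `x` hangs on the template, and `y` hangs on `x` or on the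
template. -/
theorem badConfiguration_of_not_twin {u : Fin m → V} (ho : Orderly H u)
    (htf : TwinFree (H.comap u)) {x y : V} (hx : ∃ l, H.Adj x (u l))
    (hy : H.Adj x y ∨ ∃ l, H.Adj y (u l))
    (hfit : ¬ Fits H (Sum.elim u ![x, y])) : BadConfiguration H (Sum.elim u ![x, y]) := by
  refine ⟨htf, ?_, hfit⟩
  set c : Fin m ⊕ Fin 2 → V := Sum.elim u ![x, y] with hc
  have ho' : Orderly (H.comap c) Sum.inl := ho
  have h1 := ho'.linkedOn
  obtain ⟨l, hl⟩ := hx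
  have h2 := h1.insert (x := Sum.inl l) (y := Sum.inr 0) ⟨l, rfl⟩ hl.symm
  have h3 : LinkedOn (H.comap c) (insert (Sum.inr 1) (insert (Sum.inr 0)
      (Set.range (Sum.inl : Fin m → Fin m ⊕ Fin 2)))) := by
    rcases hy with hy | ⟨l', hl'⟩
    · exact h2.insert (x := Sum.inr 0) (Set.mem_insert _ _) hy
    · exact h2.insert (x := Sum.inl l') (Set.mem_insert_of_mem _ ⟨l', rfl⟩) hl'.symm
  convert h3
  ext a
  simp only [Set.mem_univ, true_iff, Set.mem_insert_iff, Set.mem_range]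
  rcases a with a | a
  · exact Or.inr (Or.inr ⟨a, rfl⟩)
  · fin_cases a
    · exact Or.inr (Or.inl rfl)
    · exact Or.inl rfl

theorem Orderly.exists_adj {u : Fin m → V} (hm : 2 ≤ m) (ho : Orderly H u) (i : Fin m) :
    ∃ l, H.Adj (u i) (u l) := by
  rcases Nat.eq_zero_or_pos i.val with h | h
  · obtain ⟨l, hl, hadj⟩ := ho ⟨1, by omega⟩ (by simp)
    have : l = i := Fin.ext (by have : l.val < 1 := hl; omega)
    exact ⟨_, this ▸ hadj⟩
  · obtain ⟨l, -, hadj⟩ := ho i h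
    exact ⟨l, hadj.symm⟩

variable [Fintype V]

/-- The graph around a typical template tuple is, up to few errors, a blow-up of the template. -/
theorem exists_blob_of_template (hm : 2 ≤ m) {u : Fin m → V} (ho : Orderly H u)
    (htf : TwinFree (H.comap u)) {C : SimpleGraph (Fin t)}
    (hbu : IsBlowUp C (H.comap u)) {τ η γ : ℝ} (hτ : 0 < τ) (hρ : 0 < ρ)
    (hu0 : τ * ρ ≤ pr (fun x => H.Adj (u ⟨0, by omega⟩) x))
    (hη1 : η ≤ τ ^ 2 / 2) (hη2 : η ≤ γ * τ / 2) (hγ : 0 ≤ γ)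
    (hbad : pr (fun p : Fin 2 → V => BadConfiguration H (Sum.elim u p)) ≤ η * ρ ^ 2) :
    ∃ (B : Set V) (f : V → Fin t), B.Nonempty ∧ (∀ x ∈ B, ∃ y, H.Adj x y) ∧
      pr (fun p : V × V => p.1 ∈ B ∧ ¬ (H.Adj p.1 p.2 ↔ (p.2 ∈ B ∧ C.Adj (f p.1) (f p.2)))) ≤
        γ * ρ * pr (fun x => x ∈ B) := by
  classical
  obtain ⟨g, hg⟩ := hbu
  set B := twinSet H u with hB
  let idx : V → Fin m := fun x => if h : x ∈ B then h.choose else ⟨0, by omega⟩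
  have hidx : ∀ x ∈ B, ∀ l, H.Adj x (u l) ↔ H.Adj (u (idx x)) (u l) := by
    intro x hx
    simp only [idx, dif_pos hx]
    exact hx.choose_spec
  have hBadj : ∀ x ∈ B, ∃ l, H.Adj x (u l) := by
    intro x hx
    obtain ⟨l, hl⟩ := ho.exists_adj hm (idx x)
    exact ⟨l, (hidx x hx l).2 hl⟩
  have hbad2 : pr (fun p : V × V => BadConfiguration H (Sum.elim u ![p.1, p.2])) ≤ η * ρ ^ 2 := by
    rw [← pr_equiv (finTwoArrowEquiv V)]
    refine le_trans (pr_mono fun p hp => ?_) hbad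
    have : ![p 0, p 1] = p := by
      ext i; fin_cases i <;> rfl
    simpa [this] using hp
  set N₀ : V → Prop := fun x => H.Adj (u ⟨0, by omega⟩) x
  -- A neighbour of the first entry that lies outside `B` makes a bad pair with every neighbour of
  -- that entry. So few neighbours are outside, and `B` contains at least half of the τρ that are
  -- guaranteed.
  have hout : pr (fun y => N₀ y ∧ y ∉ B) * (τ * ρ) ≤ η * ρ ^ 2 := by
    calc pr (fun y => N₀ y ∧ y ∉ B) * (τ * ρ) ≤ pr (fun y => N₀ y ∧ y ∉ B) * pr N₀ := by
          gcongr
          exact pr_nonneg _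
      _ = pr (fun p : V × V => (N₀ p.1 ∧ p.1 ∉ B) ∧ N₀ p.2) := by
          unfold pr
          simp only [ind_and, avg_prod, avg_mul_left, avg_mul_right]
      _ ≤ _ := pr_mono fun p hp => by
          refine badConfiguration_of_not_twin ho htf ⟨_, hp.1.1.symm⟩
            (Or.inr ⟨_, SimpleGraph.Adj.symm hp.2⟩) fun hfit => hp.1.2 ?_
          obtain ⟨i, hi⟩ := hfit (Sum.inr 0)
          exact ⟨i, fun l => hi (Sum.inl l)⟩
      _ ≤ η * ρ ^ 2 := hbad2
  have hBpr : τ * ρ / 2 ≤ pr (fun x => x ∈ B) := by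
    have h1 : pr N₀ ≤ pr (fun x => x ∈ B) + pr (fun y => N₀ y ∧ y ∉ B) :=
      (pr_mono fun x hx => by tauto).trans (pr_or_le _ _)
    have h2 : pr (fun y => N₀ y ∧ y ∉ B) ≤ τ * ρ / 2 := by
      have h3 : pr (fun y => N₀ y ∧ y ∉ B) * (τ * ρ) ≤ (τ * ρ / 2) * (τ * ρ) := by
        refine hout.trans ?_
        calc η * ρ ^ 2 ≤ τ ^ 2 / 2 * ρ ^ 2 := by gcongr
          _ = _ := by ring
      exact le_of_mul_le_mul_right h3 (by positivity)
    linarith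
  refine ⟨B, fun x => g (idx x), ?_, fun x hx => ?_, ?_⟩
  · by_contra hne
    rw [Set.not_nonempty_iff_eq_empty] at hne
    rw [hne, pr_eq_zero fun x (hx : x ∈ (∅ : Set V)) => Set.notMem_empty x hx] at hBpr
    have : 0 < τ * ρ / 2 := by positivity
    linarith
  · obtain ⟨l, hl⟩ := hBadj x hx
    exact ⟨_, hl⟩
  -- If the pair extended the template by twins, then `y` would be in `B` and the adjacency of `x`
  -- and `y` would copy that of the corresponding entries, which `g` describes. So each wrongly
  -- adjacent pair is bad.
  · calc _ ≤ pr (fun p : V × V => BadConfiguration H (Sum.elim u ![p.1, p.2])) := by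
          refine pr_mono fun p hp => ?_
          obtain ⟨hx, hne⟩ := hp
          obtain ⟨x, y⟩ := p
          simp only at hx hne ⊢
          refine badConfiguration_of_not_twin ho htf (hBadj x hx) ?_ fun hfit => hne ?_
          · by_cases hxy : H.Adj x y
            · exact Or.inl hxy
            · refine Or.inr (hBadj y ?_)
              by_contra hyB
              exact hne ⟨fun h => absurd h hxy, fun h => absurd h.1 hyB⟩
          · obtain ⟨i, hi⟩ := hfit (Sum.inr 0)
            obtain ⟨j, hj⟩ := hfit (Sum.inr 1)
            have hyB : y ∈ B := ⟨j, fun l => hj (Sum.inl l)⟩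
            have hij : i = idx x := htf _ _ fun l =>
              (hi (Sum.inl l)).symm.trans (hidx x hx l)
            have hjj : j = idx y := htf _ _ fun l =>
              (hj (Sum.inl l)).symm.trans (hidx y hyB l)
            have h1 : H.Adj x y ↔ H.Adj (u (idx x)) y := by rw [← hij]; exact hi (Sum.inr 1)
            have h2 : H.Adj y (u (idx x)) ↔ H.Adj (u (idx y)) (u (idx x)) := hidx y hyB _
            have h3 : H.Adj (u (idx x)) (u (idx y)) ↔ C.Adj (g (idx x)) (g (idx y)) := hg _ _
            rw [h1, H.adj_comm, h2, H.adj_comm, h3]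
            simp [hyB]
    _ ≤ η * ρ ^ 2 := hbad2
    _ ≤ (γ * τ / 2) * ρ ^ 2 := by gcongr
    _ = γ * ρ * (τ * ρ / 2) := by ring
    _ ≤ γ * ρ * pr (fun x => x ∈ B) := by gcongr

/-- A graph of small maximum degree which is not almost empty and contains few small obstructions
to being a blow-up collection of the `t`-cycle has a part which almost is a blow-up of the
`t`-cycle and is almost separated from the rest of the graph. -/
theorem exists_blob (ht : 8 ≤ t) {γ : ℝ} (hγ : 0 < γ) (hγ1 : γ ≤ 1) :
    ∃ δ : ℝ, 0 < δ ∧ ∀ (V : Type) [Fintype V] [Nonempty V] (H : SimpleGraph V) (ρ : ℝ), 0 < ρ →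
      (∀ v, pr (fun x => H.Adj v x) ≤ ρ) →
      γ * ρ ≤ pr (fun p : V × V => H.Adj p.1 p.2) →
      (∀ k, 2 ≤ k → k ≤ t → pr (fun v : Fin k → V => Orderly H v ∧
        ¬ IsBlowUp (SimpleGraph.cycleGraph t) (H.comap v)) ≤ δ * ρ ^ (k - 1)) →
      ∃ (B : Set V) (f : V → Fin t), B.Nonempty ∧ (∀ x ∈ B, ∃ y, H.Adj x y) ∧
        pr (fun p : V × V => p.1 ∈ B ∧ ¬ (H.Adj p.1 p.2 ↔
          (p.2 ∈ B ∧ (SimpleGraph.cycleGraph t).Adj (f p.1) (f p.2)))) ≤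
          γ * ρ * pr (fun x => x ∈ B) := by
  classical
  set C := configurationConstant t with hC
  set D : ℝ := ((t + 2 : ℝ) ^ 2) ^ t with hD
  have ht2 : (1 : ℝ) ≤ t + 2 := by
    have : (0 : ℝ) ≤ t := Nat.cast_nonneg t
    linarith
  have hD1 : 1 ≤ D := one_le_pow₀ (one_le_pow₀ ht2)
  have hC1 : 1 ≤ C := by
    have h1 : (1 : ℝ) ≤ (t + 1) := by
      have : (0 : ℝ) ≤ t := Nat.cast_nonneg t
      linarith
    have h2 : (1 : ℝ) ≤ (t + 2) ^ t := one_le_pow₀ ht2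
    have h3 : (1 : ℝ) ≤ 2 * ((t + 2 : ℝ) ^ 2) ^ (t + 2) := by
      have : (1 : ℝ) ≤ ((t + 2 : ℝ) ^ 2) ^ (t + 2) := one_le_pow₀ (one_le_pow₀ ht2)
      linarith
    rw [hC, configurationConstant]
    exact one_le_mul_of_one_le_of_one_le (one_le_mul_of_one_le_of_one_le h1 h2) h3
  -- Chosen so that the error `η = 8 C a(m - 1) / α` from the averaging below becomes exactly γτ²/4,
  -- which meets both smallness conditions of `exists_blob_of_template`.
  set θ : ℝ := γ / (128 * C * D ^ 2) with hθ
  have hθ0 : 0 < θ := by positivity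
  have hθ1 : θ ≤ 1 / 4 := by
    rw [hθ, div_le_iff₀ (by positivity)]
    have : 1 ≤ C * D ^ 2 := one_le_mul_of_one_le_of_one_le hC1 (one_le_pow₀ hD1)
    nlinarith
  -- A rapidly decreasing scale of densities: each is negligible even against the cube of the
  -- previous one.
  let a : ℕ → ℝ := fun n => Nat.rec γ (fun _ x => θ * x ^ 3) n
  have ha0 : a 0 = γ := rfl
  have hasucc : ∀ n, a (n + 1) = θ * a n ^ 3 := fun n => rfl
  have hapos : ∀ n, 0 < a n ∧ a n ≤ 1 := by
    intro n
    induction n with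
    | zero => exact ⟨hγ, hγ1⟩
    | succ n ih =>
      rw [hasucc]
      have := ih.1
      refine ⟨by positivity, ?_⟩
      calc θ * a n ^ 3 ≤ 1 * 1 := by
            gcongr
            · linarith
            · exact pow_le_one₀ ih.1.le ih.2
        _ = 1 := one_mul 1
  have hdec : ∀ n, a (n + 1) ≤ a n / 4 := by
    intro n
    rw [hasucc]
    have h1 := (hapos n).1
    calc θ * a n ^ 3 ≤ 1 / 4 * a n ^ 1 := by
          gcongr ?_ * ?_
          exact pow_le_pow_of_le_one h1.le (hapos n).2 (by norm_num)
      _ = a n / 4 := by ring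
  have hanti : Antitone a := antitone_nat_of_succ_le fun n => by
    linarith [hdec n, (hapos n).1]
  refine ⟨a (t - 1), (hapos _).1, ?_⟩
  intro V _ _ H ρ hρ hdeg hedge hw
  let R : ℕ → Prop := fun k => 2 ≤ k ∧ a (k - 2) * ρ ^ (k - 1) ≤
    pr (fun v : Fin k → V => Orderly H v ∧ TwinFree (H.comap v))
  have hR2 : R 2 := by
    refine ⟨le_rfl, ?_⟩
    have h1 : pr (fun p : V × V => H.Adj p.1 p.2) ≤
        pr (fun v : Fin 2 → V => Orderly H v ∧ TwinFree (H.comap v)) := by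
      rw [← pr_equiv (finTwoArrowEquiv V)]
      refine pr_mono fun v hv => ?_
      have hv' : H.Adj (v 0) (v 1) := by simpa using hv
      refine ⟨?_, ?_⟩
      · intro j hj
        fin_cases j
        · simp at hj
        · exact ⟨0, by decide, hv'⟩
      · intro i j hij
        fin_cases i <;> fin_cases j
        · rfl
        · exact absurd ((hij 1).1 hv') (H.loopless.irrefl _)
        · exact absurd ((hij 0).1 hv'.symm) (H.loopless.irrefl _)
        · rfl
    refine le_trans ?_ h1
    change a 0 * ρ ^ 1 ≤ _
    rwa [ha0, pow_one]
  -- The largest template size that is frequent at its own scale. Templates of size m have density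
  -- at least `a (m - 2)`, all larger ones at most the much smaller `a (m - 1)`, both relative to
  -- ρ^(k-1).
  set m := Nat.findGreatest R t with hmdef
  have hmt : m ≤ t := Nat.findGreatest_le t
  have hRm : R m := Nat.findGreatest_spec (by omega : 2 ≤ t) hR2
  have hm2 : 2 ≤ m := hRm.1
  have hlarge : ∀ k, m < k → k ≤ t → pr (fun v : Fin k → V => Orderly H v ∧
      TwinFree (H.comap v)) ≤ a (m - 1) * ρ ^ (k - 1) := by
    intro k hmk hkt
    have h1 := Nat.findGreatest_is_greatest hmk hkt
    have h2 : ¬ (a (k - 2) * ρ ^ (k - 1) ≤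
      pr (fun v : Fin k → V => Orderly H v ∧ TwinFree (H.comap v))) := fun h =>
      h1 ⟨by omega, h⟩
    refine (not_le.1 h2).le.trans ?_
    gcongr
    exact hanti (by omega)
  have hwit : ∀ k, 2 ≤ k → k ≤ t → pr (fun v : Fin k → V => Orderly H v ∧
      ¬ IsBlowUp (SimpleGraph.cycleGraph t) (H.comap v)) ≤ a (m - 1) * ρ ^ (k - 1) := by
    intro k hk hkt
    refine (hw k hk hkt).trans ?_
    gcongr
    exact hanti (by omega)
  have hbad := pr_badConfiguration_le ht hm2 hmt hρ.le hdeg (hapos (m - 1)).1.le hwit hlarge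
  set α := a (m - 2) with hα
  have hα0 : 0 < α := (hapos _).1
  have hα1 : α ≤ 1 := (hapos _).2
  have hsucc : a (m - 1) = θ * α ^ 3 := by
    have : m - 1 = (m - 2) + 1 := by omega
    rw [this, hasucc]
  set τ : ℝ := α / (2 * D) with hτ
  have hτ0 : 0 < τ := by positivity
  set η : ℝ := 8 * C * a (m - 1) / α with hη
  have hηval : η = γ * τ ^ 2 / 4 := by
    rw [hη, hsucc, hτ, hθ]
    field_simp
    ring
  have hτ1 : τ ≤ 1 := by
    rw [hτ, div_le_one (by positivity)]
    linarith
  have hlow := pr_orderly_low_degree_le (H := H) hm2 hmt hρ.le hdeg hτ0.le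
  -- Usable templates. Discarding obstructions costs at most a quarter of the density α, discarding
  -- a low-degree first entry at most half, so a quarter remains.
  let E : (Fin m → V) → Prop := fun u => (Orderly H u ∧ TwinFree (H.comap u)) ∧
    IsBlowUp (SimpleGraph.cycleGraph t) (H.comap u) ∧
    τ * ρ ≤ pr (fun x => H.Adj (u ⟨0, by omega⟩) x)
  have hE : α / 4 * ρ ^ (m - 1) ≤ pr E := by
    have h1 : pr (fun v : Fin m → V => Orderly H v ∧ TwinFree (H.comap v)) ≤
        pr E + (pr (fun u : Fin m → V => Orderly H u ∧
          ¬ IsBlowUp (SimpleGraph.cycleGraph t) (H.comap u)) +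
        pr (fun u : Fin m → V => Orderly H u ∧
          pr (fun x => H.Adj (u ⟨0, by omega⟩) x) < τ * ρ)) := by
      refine le_trans (pr_mono fun u hu => ?_) ((pr_or_le _ _).trans
        (add_le_add le_rfl (pr_or_le _ _)))
      by_cases h1 : IsBlowUp (SimpleGraph.cycleGraph t) (H.comap u)
      · rcases le_or_gt (τ * ρ) (pr (fun x => H.Adj (u ⟨0, by omega⟩) x)) with h2 | h2
        · exact Or.inl ⟨hu, h1, h2⟩
        · exact Or.inr (Or.inr ⟨hu.1, h2⟩)
      · exact Or.inr (Or.inl ⟨hu.1, h1⟩)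
    have h2 := hwit m hm2 hmt
    have h3 : a (m - 1) * ρ ^ (m - 1) ≤ α / 4 * ρ ^ (m - 1) := by
      gcongr
      have := hdec (m - 2)
      rwa [show m - 2 + 1 = m - 1 by omega] at this
    have h4 : D * (τ * ρ ^ (m - 1)) = α / 2 * ρ ^ (m - 1) := by
      rw [hτ]
      field_simp
    have h5 := hRm.2
    rw [← hD, h4] at hlow
    rw [← hα] at h5
    linarith
  -- Averaging: if every usable template had more than ηρ² bad extensions, there would be at least
  -- twice as many bad configurations as `hbad` permits.
  obtain ⟨u, hu, hgood⟩ : ∃ u, E u ∧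
      pr (fun p : Fin 2 → V => BadConfiguration H (Sum.elim u p)) ≤ η * ρ ^ 2 := by
    by_contra! hcon
    have h1 : pr E * (η * ρ ^ 2) ≤ C * (a (m - 1) * ρ ^ (m + 1)) := by
      refine le_trans ?_ hbad
      rw [← pr_equiv (Equiv.sumArrowEquivProdArrow (Fin m) (Fin 2) V).symm, pr_prod]
      rw [pr, ← avg_mul_right]
      refine avg_mono fun u => ?_
      by_cases hEu : E u
      · rw [ind_of hEu, one_mul]
        exact (hcon u hEu).le
      · rw [ind_of_not hEu, zero_mul]
        exact pr_nonneg _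
    have hapos' := (hapos (m - 1)).1
    have h2 : α / 4 * ρ ^ (m - 1) * (η * ρ ^ 2) ≤ C * (a (m - 1) * ρ ^ (m + 1)) := by
      refine le_trans ?_ h1
      gcongr
    have h3 : α / 4 * ρ ^ (m - 1) * (η * ρ ^ 2) = 2 * (C * (a (m - 1) * ρ ^ (m + 1))) := by
      have : m + 1 = (m - 1) + 2 := by omega
      rw [hη, this, pow_add]
      field_simp
      ring
    have h4 : 0 < C * (a (m - 1) * ρ ^ (m + 1)) := by positivity
    linarith
  obtain ⟨⟨ho, htf⟩, hbu, hu0⟩ := hu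
  refine exists_blob_of_template hm2 ho htf hbu hτ0 hρ hu0 ?_ ?_ hγ.le hgood
  · rw [hηval]
    nlinarith [sq_nonneg τ]
  · rw [hηval]
    nlinarith [mul_pos hγ hτ0]

end Blob


/-! ### Graphs with few small obstructions are close to blow-up collections -/

/-- The graph whose vertices carry the label `f v` in the part `p v`, and in which vertices of the
same part with adjacent labels are adjacent. -/
def labelGraph {V W : Type} (C : SimpleGraph W) (p : V → ℕ) (f : V → W) : SimpleGraph V where
  Adj u v := p u = p v ∧ C.Adj (f u) (f v)
  symm := ⟨fun _ _ h => ⟨h.1.symm, h.2.symm⟩⟩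
  loopless := ⟨fun _ h => C.loopless.irrefl _ h.2⟩

/-- The graph obtained from `G` by deleting the edges which are not contained in `L`. -/
def restrict {V : Type} (G : SimpleGraph V) (L : Set V) : SimpleGraph V where
  Adj u v := G.Adj u v ∧ u ∈ L ∧ v ∈ L
  symm := ⟨fun _ _ h => ⟨h.1.symm, h.2.2, h.2.1⟩⟩
  loopless := ⟨fun _ h => G.loopless.irrefl _ h.1⟩

/-- The fraction of ordered pairs of vertices on which two graphs differ. -/
noncomputable def gap {V : Type} [Fintype V] (G G' : SimpleGraph V) : ℝ :=
  pr fun p : V × V => ¬ (G.Adj p.1 p.2 ↔ G'.Adj p.1 p.2)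

theorem Orderly.mem_of_restrict {V : Type} {G : SimpleGraph V} {L : Set V} {k : ℕ} (hk : 2 ≤ k)
    {v : Fin k → V} (h : Orderly (restrict G L) v) (i : Fin k) : v i ∈ L := by
  obtain ⟨l, hl⟩ := h.exists_adj hk i
  exact hl.2.1

theorem orderly_restrict_mono {V : Type} {G : SimpleGraph V} {L L' : Set V} (hL : L' ⊆ L) {k : ℕ}
    (hk : 2 ≤ k) {v : Fin k → V} (h : Orderly (restrict G L') v) :
    Orderly (restrict G L) v ∧ (restrict G L).comap v = (restrict G L').comap v := by
  refine ⟨fun j hj => ?_, ?_⟩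
  · obtain ⟨i, hij, ha⟩ := h j hj
    exact ⟨i, hij, ha.1, hL ha.2.1, hL ha.2.2⟩
  · ext a b
    have ha := h.mem_of_restrict hk a
    have hb := h.mem_of_restrict hk b
    exact ⟨fun h => ⟨h.1, ha, hb⟩, fun h => ⟨h.1, hL ha, hL hb⟩⟩

theorem comap_restrict {V : Type} {G : SimpleGraph V} {L : Set V} {k : ℕ}
    {v : Fin k → V} (h : ∀ i, v i ∈ L) : (restrict G L).comap v = G.comap v := by
  ext a b
  exact ⟨fun h => h.1, fun h' => ⟨h', h a, h b⟩⟩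

/-- Blobs are split off until the edge density is below γρ. The error of a blob is γρ times its own
measure, counted for both orders of a pair; the blobs are disjoint, so the total is at most 2γρ,
plus γρ for the edges left at the end. -/
theorem exists_labelGraph {t : ℕ} (ht : 8 ≤ t) {γ : ℝ} (hγ : 0 < γ) (hγ1 : γ ≤ 1) :
    ∃ δ : ℝ, 0 < δ ∧ ∀ (V : Type) [Fintype V] [Nonempty V] (G : SimpleGraph V) (ρ : ℝ), 0 < ρ →
      ∀ L : Set V, (∀ v, pr (fun x => (restrict G L).Adj v x) ≤ ρ) →
      (∀ k, 2 ≤ k → k ≤ t → pr (fun v : Fin k → V => Orderly (restrict G L) v ∧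
        ¬ IsBlowUp (SimpleGraph.cycleGraph t) ((restrict G L).comap v)) ≤ δ * ρ ^ (k - 1)) →
      ∃ (p : V → ℕ) (f : V → Fin t),
        gap (restrict G L) (labelGraph (SimpleGraph.cycleGraph t) p f) ≤ 3 * γ * ρ := by
  classical
  obtain ⟨δ, hδ, hblob⟩ := exists_blob ht hγ hγ1
  refine ⟨δ, hδ, ?_⟩
  intro V _ _ G ρ hρ
  set C := SimpleGraph.cycleGraph t
  suffices h : ∀ (n : ℕ) (L : Set V), L.ncard = n →
      (∀ v, pr (fun x => (restrict G L).Adj v x) ≤ ρ) →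
      (∀ k, 2 ≤ k → k ≤ t → pr (fun v : Fin k → V => Orderly (restrict G L) v ∧
        ¬ IsBlowUp C ((restrict G L).comap v)) ≤ δ * ρ ^ (k - 1)) →
      ∃ (p : V → ℕ) (f : V → Fin t), gap (restrict G L) (labelGraph C p f) ≤
        γ * ρ + 2 * (γ * ρ * pr (fun x => x ∈ L)) by
    intro L hdeg hw
    obtain ⟨p, f, hpf⟩ := h _ L rfl hdeg hw
    refine ⟨p, f, hpf.trans ?_⟩
    have : γ * ρ * pr (fun x => x ∈ L) ≤ γ * ρ * 1 := by
      gcongr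
      exact pr_le_one _
    linarith
  intro n
  induction n using Nat.strong_induction_on with
  | _ n ih =>
    intro L hn hdeg hw
    by_cases hedge : γ * ρ ≤ pr (fun p : V × V => (restrict G L).Adj p.1 p.2)
    · obtain ⟨B, g, hBne, hBadj, hwrong⟩ := hblob V (restrict G L) ρ hρ hdeg hedge hw
      have hBL : B ⊆ L := fun x hx => by
        obtain ⟨y, hy⟩ := hBadj x hx
        exact hy.2.1
      have hlt : (L \ B).ncard < n := by
        rw [← hn]
        refine Set.ncard_lt_ncard ?_ (Set.toFinite _)
        refine ⟨Set.sdiff_subset, fun h => ?_⟩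
        obtain ⟨x, hx⟩ := hBne
        exact (h (hBL hx)).2 hx
      -- Deleting the blob preserves the hypotheses: an orderly tuple of the smaller graph lies in
      -- the remaining set, so it induces the same graph before and after the deletion.
      obtain ⟨p, f, hpf⟩ := ih _ hlt (L \ B) rfl (fun v => (pr_mono fun x hx =>
        ⟨hx.1, hx.2.1.1, hx.2.2.1⟩).trans (hdeg v)) (fun k hk hkt => by
          refine (pr_mono fun v hv => ?_).trans (hw k hk hkt)
          obtain ⟨h1, h2⟩ := orderly_restrict_mono (Set.sdiff_subset : L \ B ⊆ L) hk hv.1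
          exact ⟨h1, by rw [h2]; exact hv.2⟩)
      set wrong : V × V → Prop := fun p => p.1 ∈ B ∧ ¬ ((restrict G L).Adj p.1 p.2 ↔
        (p.2 ∈ B ∧ C.Adj (g p.1) (g p.2))) with hwr
      -- The blob becomes part 0, and the parts found in the rest are shifted by one.
      refine ⟨fun x => if x ∈ B then 0 else p x + 1, fun x => if x ∈ B then g x else f x, ?_⟩
      have h1 : gap (restrict G L) (labelGraph C (fun x => if x ∈ B then 0 else p x + 1)
          (fun x => if x ∈ B then g x else f x)) ≤
          gap (restrict G (L \ B)) (labelGraph C p f) + (pr wrong + pr fun q : V × V => wrong q.swap) := by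
        refine (pr_mono fun q hq => ?_).trans ((pr_or_le _ _).trans
          (add_le_add le_rfl (pr_or_le _ _)))
        obtain ⟨x, y⟩ := q
        by_cases hx : x ∈ B
        · refine Or.inr (Or.inl ⟨hx, fun h => hq (h.trans ?_)⟩)
          by_cases hy : y ∈ B <;> simp [labelGraph, hx, hy]
        · by_cases hy : y ∈ B
          · refine Or.inr (Or.inr ⟨hy, fun h => hq ?_⟩)
            simp only [Prod.swap] at h
            rw [SimpleGraph.adj_comm, h]
            simp [labelGraph, hx, hy]
          · refine Or.inl fun h => hq ?_
            simp only [labelGraph, restrict, Set.mem_sdiff] at h ⊢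
            simpa [hx, hy] using h
      have h2 : pr (fun q : V × V => wrong q.swap) = pr wrong := pr_equiv (Equiv.prodComm V V) wrong
      have h3 : pr (fun x => x ∈ L \ B) + pr (fun x => x ∈ B) ≤ pr (fun x => x ∈ L) := by
        unfold pr
        rw [← avg_add]
        refine avg_mono fun x => ?_
        by_cases hx : x ∈ B
        · rw [ind_of_not (fun h : x ∈ L \ B => h.2 hx), ind_of hx, ind_of (hBL hx), zero_add]
        · rw [ind_of_not hx, add_zero]
          exact ind_mono fun h => h.1
      have h4 : γ * ρ * (pr (fun x => x ∈ L \ B) + pr (fun x => x ∈ B)) ≤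
          γ * ρ * pr (fun x => x ∈ L) := by gcongr
      rw [h2] at h1
      linarith
    -- With few edges left, singleton parts describe the empty graph.
    · refine ⟨fun x => (Fintype.equivFin V x).val, fun _ => ⟨0, by omega⟩, ?_⟩
      have h1 : gap (restrict G L) (labelGraph C (fun x => (Fintype.equivFin V x).val)
          (fun _ => ⟨0, by omega⟩)) ≤ pr (fun p : V × V => (restrict G L).Adj p.1 p.2) := by
        refine pr_mono fun q hq => ?_
        by_contra hcon
        exact hq ⟨fun h => absurd h hcon, fun h => absurd h.2 (C.loopless.irrefl _)⟩
      have h2 : 0 ≤ γ * ρ * pr (fun x => x ∈ L) :=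
        mul_nonneg (by positivity) (pr_nonneg _)
      linarith [not_le.1 hedge]


/-! ### Trimming a blow-up collection to a given maximum degree -/

open Classical in
/-- The neighbours of a vertex. -/
noncomputable def nbhd {V : Type} [Fintype V] (G : SimpleGraph V) (v : V) : Finset V :=
  Finset.univ.filter fun x => G.Adj v x

/-- The degree of a vertex. -/
noncomputable def deg {V : Type} [Fintype V] (G : SimpleGraph V) (v : V) : ℕ := (nbhd G v).card

section

variable {V : Type} [Fintype V]

theorem mem_nbhd {G : SimpleGraph V} {v x : V} : x ∈ nbhd G v ↔ G.Adj v x := by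
  simp [nbhd]

theorem pr_adj (G : SimpleGraph V) (v : V) :
    pr (fun x => G.Adj v x) = (deg G v : ℝ) / Fintype.card V := by
  rw [deg, ← pr_mem]
  exact pr_congr fun x => mem_nbhd.symm

theorem ncard_neighborSet (G : SimpleGraph V) (v : V) : (G.neighborSet v).ncard = deg G v := by
  rw [deg, ← Set.ncard_coe_finset]
  congr 1
  ext x
  simp [mem_nbhd]

theorem deg_mono {G G' : SimpleGraph V} {v : V} (h : ∀ x, G.Adj v x → G'.Adj v x) :
    deg G v ≤ deg G' v :=
  Finset.card_le_card fun x hx => mem_nbhd.2 (h x (mem_nbhd.1 hx))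

theorem gap_eq_avg (G G' : SimpleGraph V) :
    gap G G' = avg fun v => pr fun x => ¬ (G.Adj v x ↔ G'.Adj v x) := pr_prod _

theorem gap_triangle (G₁ G₂ G₃ : SimpleGraph V) : gap G₁ G₃ ≤ gap G₁ G₂ + gap G₂ G₃ :=
  (pr_mono fun p hp => by tauto).trans (pr_or_le _ _)

/-- Isolating the vertices of a set `X` in a label graph yields a label graph. -/
theorem exists_labelGraph_isolate {W : Type} (C : SimpleGraph W) (p : V → ℕ) (f : V → W)
    (X : Set V) : ∃ p' : V → ℕ, ∀ u v, (labelGraph C p' f).Adj u v ↔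
      (u ∉ X ∧ v ∉ X ∧ (labelGraph C p f).Adj u v) := by
  classical
  -- Vertices of `X` get pairwise distinct even part numbers, all others keep their parts under odd
  -- numbers.
  refine ⟨fun v => if v ∈ X then 2 * (Fintype.equivFin V v).val else 2 * p v + 1, fun u v => ?_⟩
  by_cases hu : u ∈ X <;> by_cases hv : v ∈ X <;> simp only [labelGraph, hu, hv, if_true, if_false,
    not_true_eq_false, false_and, and_false, iff_false, not_and, not_false_eq_true, true_and]
  · intro h hC
    have : u = v := (Fintype.equivFin V).injective (Fin.ext (by omega))
    exact C.loopless.irrefl _ (this ▸ hC)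
  · intro h; omega
  · intro h; omega
  · constructor
    · rintro ⟨h, h'⟩; exact ⟨by omega, h'⟩
    · rintro ⟨h, h'⟩; exact ⟨by omega, h'⟩

/-- New disagreements occur only on edges of `H` meeting `X`: at most a fraction ρ for each vertex
of `X`, in both orders of the pair. -/
theorem gap_isolate_le {H G G' : SimpleGraph V} {X : Set V} {ρ : ℝ}
    (hdeg : ∀ v, pr (fun x => H.Adj v x) ≤ ρ)
    (hG : ∀ u v, G'.Adj u v ↔ (u ∉ X ∧ v ∉ X ∧ G.Adj u v)) :
    gap H G' ≤ gap H G + 2 * (pr (fun x => x ∈ X) * ρ) := by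
  have h1 : gap H G' ≤ gap H G + (pr (fun q : V × V => q.1 ∈ X ∧ H.Adj q.1 q.2) +
      pr (fun q : V × V => q.swap.1 ∈ X ∧ H.Adj q.swap.1 q.swap.2)) := by
    refine (pr_mono fun q hq => ?_).trans ((pr_or_le _ _).trans
      (add_le_add le_rfl (pr_or_le _ _)))
    rw [hG] at hq
    simp only [Prod.swap]
    rw [H.adj_comm q.2]
    tauto
  have h2 : pr (fun q : V × V => q.swap.1 ∈ X ∧ H.Adj q.swap.1 q.swap.2) =
      pr (fun q : V × V => q.1 ∈ X ∧ H.Adj q.1 q.2) :=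
    pr_equiv (Equiv.prodComm V V) fun q : V × V => q.1 ∈ X ∧ H.Adj q.1 q.2
  have h3 : pr (fun q : V × V => q.1 ∈ X ∧ H.Adj q.1 q.2) ≤ pr (fun x => x ∈ X) * ρ := by
    rw [pr_prod, pr, ← avg_mul_right]
    refine avg_mono fun v => ?_
    by_cases hv : v ∈ X
    · rw [ind_of hv, one_mul]
      exact (pr_mono fun x hx => hx.2).trans (hdeg v)
    · rw [ind_of_not hv, zero_mul, pr_eq_zero fun x hx => hv hx.1]
  rw [h2] at h1
  linarith

/-- Degrees are reduced by isolating vertices, which keeps a label graph. The vertices of degree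
above d + e are few, by the assumption on `H` and Markov's inequality for the disagreement; for the
others it suffices to remove e vertices from each cluster of more than d/2 vertices. -/
theorem exists_low_degree_labelGraph {t : ℕ} (ht : 3 ≤ t) [Nonempty V] (H : SimpleGraph V)
    (p : V → ℕ) (f : V → Fin t) {d : ℕ} (hd : 1 ≤ d) {γ β lam : ℝ} (hγ : 0 < γ) (hγ1 : γ ≤ 1 / 4)
    (hdeg : ∀ v, deg H v ≤ 4 * d)
    (hβ : pr (fun v => (1 + γ / 2) * d < deg H v) ≤ β)
    (hgap : gap H (labelGraph (SimpleGraph.cycleGraph t) p f) ≤ lam * (d / Fintype.card V)) :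
    ∃ p' : V → ℕ, (∀ v, deg (labelGraph (SimpleGraph.cycleGraph t) p' f) v ≤ d) ∧
      gap H (labelGraph (SimpleGraph.cycleGraph t) p' f) ≤
        (lam + 8 * (β + 2 * lam / γ + 2 * γ)) * (d / Fintype.card V) := by
  classical
  set C := SimpleGraph.cycleGraph t
  set N : ℝ := ((Fintype.card V : ℕ) : ℝ) with hN
  have hN0 : 0 < N := Nat.cast_pos.2 Fintype.card_pos
  have hd0 : (0 : ℝ) < d := by exact_mod_cast hd
  set e : ℕ := ⌊γ * d⌋₊ with he
  have hed : (e : ℝ) ≤ γ * d := Nat.floor_le (by positivity)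
  have hed' : γ * d < e + 1 := Nat.lt_floor_add_one _
  have he4 : 4 * e ≤ d := by
    have : (4 * e : ℝ) ≤ d := by nlinarith
    exact_mod_cast this
  set G' := labelGraph C p f with hG'
  set F : ℕ × Fin t → Finset V := fun l => Finset.univ.filter fun v => (p v, f v) = l with hF
  -- Possible since 4e ≤ d; and as e ≤ γd, this removes at most a fraction 2γ of each large cluster.
  have hT : ∀ l, ∃ T ⊆ F l, T.card = if d < 2 * (F l).card then e else 0 := by
    intro l
    refine Finset.exists_subset_card_eq ?_
    split_ifs <;> omega
  choose T hTF hTcard using hT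
  set X₀ : Set V := {v | d + e < deg G' v} with hX₀
  set X₁ : Finset V := Finset.univ.filter fun v => v ∈ T (p v, f v) with hX₁
  obtain ⟨p', hp'⟩ := exists_labelGraph_isolate C p f (X₀ ∪ X₁)
  have hprX₁ : pr (fun v => v ∈ X₁) ≤ 2 * γ := by
    rw [pr_mem, div_le_iff₀ hN0]
    have h1 : X₁.card = ∑ l ∈ Finset.univ.image fun v => (p v, f v),
        (X₁.filter fun v => (p v, f v) = l).card :=
      Finset.card_eq_sum_card_fiberwise fun v _ => Finset.mem_image_of_mem _ (Finset.mem_univ v)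
    have h2 : (Finset.univ : Finset V).card = ∑ l ∈ Finset.univ.image fun v => (p v, f v),
        (F l).card :=
      Finset.card_eq_sum_card_fiberwise fun v _ => Finset.mem_image_of_mem _ (Finset.mem_univ v)
    rw [h1, hN, ← Finset.card_univ, h2]
    push_cast
    rw [Finset.mul_sum]
    refine Finset.sum_le_sum fun l _ => ?_
    have h3 : (X₁.filter fun v => (p v, f v) = l).card ≤ (T l).card := by
      refine Finset.card_le_card fun v hv => ?_
      simp only [hX₁, Finset.mem_filter, Finset.mem_univ, true_and] at hv
      rw [← hv.2]
      exact hv.1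
    have h3' : ((X₁.filter fun v => (p v, f v) = l).card : ℝ) ≤ (T l).card := by exact_mod_cast h3
    refine h3'.trans ?_
    rw [hTcard]
    split_ifs with h
    · have : (d : ℝ) ≤ 2 * (F l).card := by exact_mod_cast h.le
      nlinarith
    · rw [Nat.cast_zero]
      positivity
  -- A vertex of degree above d + e in the label graph has degree above (1 + γ/2)d in `H`, or the
  -- two graphs differ in at least γd/2 pairs at it.
  have hprX₀ : pr (fun v => v ∈ X₀) ≤ β + 2 * lam / γ := by
    set X : V → ℝ := fun v => pr fun x => ¬ (H.Adj v x ↔ G'.Adj v x) with hX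
    have h1 : pr (fun v => γ * d / (2 * N) ≤ X v) ≤ 2 * lam / γ := by
      refine (pr_le_avg_div (fun v => pr_nonneg _) (by positivity)).trans ?_
      rw [← gap_eq_avg, div_le_iff₀ (by positivity)]
      refine hgap.trans (le_of_eq ?_)
      field_simp
    refine (pr_mono fun v hv => ?_).trans ((pr_or_le _ _).trans (add_le_add hβ h1))
    by_contra! hcon
    obtain ⟨h2, h3⟩ := hcon
    have h4 : pr (fun x => G'.Adj v x) ≤ pr (fun x => H.Adj v x) + X v :=
      (pr_mono fun x hx => by tauto).trans (pr_or_le _ _)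
    rw [pr_adj, pr_adj, ← hN] at h4
    have h5 : (d : ℝ) + e + 1 ≤ deg G' v := by
      have : d + e + 1 ≤ deg G' v := hv
      exact_mod_cast this
    have h6 : (deg G' v : ℝ) ≤ deg H v + X v * N := by
      rw [div_le_iff₀ hN0] at h4
      have : (deg H v / N + X v) * N = deg H v + X v * N := by field_simp
      linarith
    have h7 : X v * N < γ * d / 2 := by
      rw [lt_div_iff₀ (by positivity)] at h3
      linarith
    linarith
  refine ⟨p', fun v => ?_, ?_⟩
  · by_cases hvX : v ∈ X₀ ∪ (X₁ : Set V)
    · have : deg (labelGraph C p' f) v = 0 := by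
        rw [deg, Finset.card_eq_zero, Finset.eq_empty_iff_forall_notMem]
        intro x hx
        exact ((hp' v x).1 (mem_nbhd.1 hx)).1 hvX
      omega
    · obtain ⟨a, b, hab, hnb⟩ := exists_cycle_neighbors ht (f v)
      have hdegG' : deg G' v = (F (p v, a)).card + (F (p v, b)).card := by
        rw [deg, ← Finset.card_union_of_disjoint]
        · congr 1
          ext x
          simp only [mem_nbhd, hG', labelGraph, hF, Finset.mem_union, Finset.mem_filter,
            Finset.mem_univ, true_and, Prod.mk.injEq, C, hnb]
          constructor
          · rintro ⟨h1, h2 | h2⟩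
            · exact Or.inl ⟨h1.symm, h2⟩
            · exact Or.inr ⟨h1.symm, h2⟩
          · rintro (⟨h1, h2⟩ | ⟨h1, h2⟩)
            · exact ⟨h1.symm, Or.inl h2⟩
            · exact ⟨h1.symm, Or.inr h2⟩
        · rw [Finset.disjoint_left]
          intro x hx hx'
          simp only [hF, Finset.mem_filter, Finset.mem_univ, true_and, Prod.mk.injEq] at hx hx'
          exact hab (hx.2.symm.trans hx'.2)
      have hv0 : deg G' v ≤ d + e := by
        by_contra hcon
        exact hvX (Or.inl (not_le.1 hcon))
      have hle : deg (labelGraph C p' f) v ≤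
          (F (p v, a) \ T (p v, a)).card + (F (p v, b) \ T (p v, b)).card := by
        refine (Finset.card_le_card fun x hx => ?_).trans (Finset.card_union_le _ _)
        obtain ⟨-, hxX, h1, h2⟩ := (hp' v x).1 (mem_nbhd.1 hx)
        have hxT : x ∉ T (p x, f x) := fun h =>
          hxX (Or.inr (by simpa [hX₁] using h))
        rcases (hnb _).1 h2 with h | h
        · refine Finset.mem_union_left _ (Finset.mem_sdiff.2 ⟨by simp [hF, h1, h], ?_⟩)
          rwa [h1, ← h]
        · refine Finset.mem_union_right _ (Finset.mem_sdiff.2 ⟨by simp [hF, h1, h], ?_⟩)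
          rwa [h1, ← h]
      rw [Finset.card_sdiff_of_subset (hTF _), Finset.card_sdiff_of_subset (hTF _),
        hTcard, hTcard] at hle
      rw [hdegG'] at hv0
      -- The degree is the sum of two cluster sizes and at most d + e. If it exceeds d, one of the
      -- clusters has more than d/2 vertices and has lost e of them.
      split_ifs at hle <;> omega
  · have hdeg' : ∀ v, pr (fun x => H.Adj v x) ≤ 4 * (d / N) := by
      intro v
      rw [pr_adj, ← hN]
      have : (deg H v : ℝ) ≤ 4 * d := by exact_mod_cast hdeg v
      calc (deg H v : ℝ) / N ≤ 4 * d / N := by gcongr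
        _ = 4 * (d / N) := by ring
    have h1 := gap_isolate_le hdeg' hp'
    have h2 : pr (fun x => x ∈ X₀ ∪ (X₁ : Set V)) ≤ β + 2 * lam / γ + 2 * γ :=
      (pr_mono fun x hx => by simpa using hx).trans ((pr_or_le _ _).trans
        (add_le_add hprX₀ hprX₁))
    have h3 : pr (fun x => x ∈ X₀ ∪ (X₁ : Set V)) * (4 * (d / N)) ≤
        (β + 2 * lam / γ + 2 * γ) * (4 * (d / N)) := by gcongr
    linarith

end


/-! ### Blow-up collections, edit distance, and a criterion for not being far -/

theorem isBlowUpCollection_labelGraph {V W : Type} [Fintype V] (C : SimpleGraph W) (p : V → ℕ)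
    (f : V → W) : IsBlowUpCollection C (labelGraph C p f) := by
  refine ⟨Finset.univ.sup p + 1,
    fun v => ⟨p v, Nat.lt_succ_of_le (Finset.le_sup (Finset.mem_univ v))⟩, fun i => ?_, ?_⟩
  · refine ⟨fun v => f v.1, fun u v => ?_⟩
    have : p u.1 = p v.1 := by
      have h1 := congrArg Fin.val u.2
      have h2 := congrArg Fin.val v.2
      exact h1.trans h2.symm
    exact ⟨fun h => h.2, fun h => ⟨this, h⟩⟩
  · intro u v huv h
    exact huv (Fin.ext h.1)

theorem IsBlowUpCollection.comap {V U W : Type} {C : SimpleGraph W} {G : SimpleGraph V}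
    (h : IsBlowUpCollection C G) (g : U → V) : IsBlowUpCollection C (G.comap g) := by
  obtain ⟨k, p, h1, h2⟩ := h
  refine ⟨k, p ∘ g, fun i => ?_, fun u v huv => h2 _ _ huv⟩
  obtain ⟨f, hf⟩ := h1 i
  exact ⟨fun v => f ⟨g v.1, v.2⟩, fun u v => hf ⟨g u.1, u.2⟩ ⟨g v.1, v.2⟩⟩

/-- No edges run between parts, so a connected tuple lies in a single part. -/
theorem IsBlowUpCollection.isBlowUp_of_orderly {V W : Type} {C : SimpleGraph W}
    {G : SimpleGraph V} (h : IsBlowUpCollection C G) {k : ℕ} (hk : 0 < k) {v : Fin k → V}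
    (ho : Orderly G v) : IsBlowUp C (G.comap v) := by
  obtain ⟨n, p, h1, h2⟩ := h
  set i₀ : Fin k := ⟨0, hk⟩
  have hT := ho.linkedOn {x | x ∈ Set.range v ∧ p x = p (v i₀)} (fun x hx => hx.1)
    ⟨v i₀, ⟨i₀, rfl⟩, rfl⟩ (by
      rintro x ⟨-, hx⟩ y hy hxy
      refine ⟨hy, ?_⟩
      by_contra hne
      exact h2 x y (fun e => hne (e.symm.trans hx)) hxy)
  have hall : ∀ i, p (v i) = p (v i₀) := by
    intro i
    have : v i ∈ Set.range v := ⟨i, rfl⟩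
    rw [← hT] at this
    exact this.2
  obtain ⟨f, hf⟩ := h1 (p (v i₀))
  exact ⟨fun i => f ⟨v i, hall i⟩, fun i j => hf ⟨v i, hall i⟩ ⟨v j, hall j⟩⟩

/-- Every changed edge is counted as two ordered pairs. This factor 2 later gives the strict
inequality that refutes farness once the gap is at most ε. -/
theorem two_mul_editDistance {N : ℕ} (hN : 0 < N) (G G' : SimpleGraph (Fin N)) :
    2 * (editDistance G G' : ℝ) = gap G G' * (N : ℝ) ^ 2 := by
  classical
  let D : SimpleGraph (Fin N) :=
    { Adj := fun u v => ¬ (G.Adj u v ↔ G'.Adj u v)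
      symm := ⟨fun u v h => by rw [G.adj_comm, G'.adj_comm]; exact h⟩
      loopless := ⟨fun u h => h (by simp)⟩ }
  have h1 : symmDiff G.edgeSet G'.edgeSet = D.edgeSet := by
    ext e
    induction e using Sym2.ind with
    | _ u v =>
      simp only [Set.mem_symmDiff, SimpleGraph.mem_edgeSet, D]
      tauto
  have h2 := D.sum_degrees_eq_twice_card_edges
  have h3 : editDistance G G' = D.edgeFinset.card := by
    rw [editDistance, h1, ← Set.ncard_coe_finset]
    simp
  have h4 : ∀ v, D.degree v = deg D v := by
    intro v
    rw [← SimpleGraph.card_neighborFinset_eq_degree, deg]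
    congr 1
    ext x
    simp [mem_nbhd]
  have h5 : gap G G' * (N : ℝ) ^ 2 = ∑ v, (deg D v : ℝ) := by
    have hN' : (N : ℝ) ≠ 0 := by positivity
    have : gap G G' = avg fun v => pr fun x => D.Adj v x := gap_eq_avg G G'
    rw [this]
    simp only [pr_adj, avg, Fintype.card_fin, ← Finset.sum_div]
    field_simp
  rw [h5, h3]
  have h6 : ((∑ v, deg D v : ℕ) : ℝ) = ((2 * D.edgeFinset.card : ℕ) : ℝ) := by
    rw [← h2]
    congr 1
    exact Finset.sum_congr rfl fun v _ => (h4 v).symm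
  push_cast at h6
  exact h6.symm

theorem gap_restrict_le {V : Type} [Fintype V] (G : SimpleGraph V) (L : Set V) :
    gap G (restrict G L) ≤ 2 * pr (fun q : V × V => G.Adj q.1 q.2 ∧ q.1 ∉ L) := by
  have h2 : pr (fun q : V × V => G.Adj q.swap.1 q.swap.2 ∧ q.swap.1 ∉ L) =
      pr (fun q : V × V => G.Adj q.1 q.2 ∧ q.1 ∉ L) :=
    pr_equiv (Equiv.prodComm V V) fun q : V × V => G.Adj q.1 q.2 ∧ q.1 ∉ L
  have h1 : gap G (restrict G L) ≤ pr (fun q : V × V => G.Adj q.1 q.2 ∧ q.1 ∉ L) +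
      pr (fun q : V × V => G.Adj q.swap.1 q.swap.2 ∧ q.swap.1 ∉ L) := by
    refine (pr_mono fun q hq => ?_).trans (pr_or_le _ _)
    simp only [restrict] at hq
    simp only [Prod.swap]
    rw [G.adj_comm q.2]
    tauto
  linarith

theorem deg_restrict_le {V : Type} [Fintype V] (G : SimpleGraph V) (L : Set V) (v : V) :
    deg (restrict G L) v ≤ deg G v := by
  refine deg_mono fun x hx => ?_
  exact hx.1

/-- A graph is not far from the low-degree blow-up collections of the `t`-cycle if it has few
vertices of large degree and few small obstructions. -/
theorem exists_not_isFar {t : ℕ} (ht : 8 ≤ t) {c : ℝ} (hc : 1 ≤ c) :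
    ∃ γ β δ : ℝ, 0 < γ ∧ γ ≤ 1 / 4 ∧ 0 < β ∧ 0 < δ ∧ ∀ (ε : ℝ), 0 < ε → ∀ (N d : ℕ), 0 < N →
      1 ≤ d → (d : ℝ) ≤ c * ε * N → ∀ (G : SimpleGraph (Fin N)),
      pr (fun q : Fin N × Fin N => G.Adj q.1 q.2 ∧ q.1 ∉ {v | deg G v ≤ 4 * d}) ≤ β * (d / N) →
      pr (fun v => (1 + γ / 2) * d < deg G v) ≤ β →
      (∀ k, 2 ≤ k → k ≤ t → pr (fun v : Fin k → Fin N =>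
        Orderly (restrict G {v | deg G v ≤ 4 * d}) v ∧ ¬ IsBlowUp (SimpleGraph.cycleGraph t)
          ((restrict G {v | deg G v ≤ 4 * d}).comap v)) ≤ δ * (4 * (d / N)) ^ (k - 1)) →
      ¬ IsFar (lowDegreeBlowUpCollection (SimpleGraph.cycleGraph t) (c * ε)) ε G := by
  have hc0 : 0 < c := by linarith
  set γ : ℝ := 1 / (64 * c) with hγ
  have hγ0 : 0 < γ := by positivity
  have hγ1 : γ ≤ 1 / 4 := by
    rw [hγ, div_le_div_iff₀ (by positivity) (by norm_num)]
    linarith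
  set γ₀ : ℝ := γ / (816 * c) with hγ₀
  have hγ₀0 : 0 < γ₀ := by positivity
  have hγ₀1 : γ₀ ≤ 1 := by
    rw [hγ₀, div_le_one (by positivity)]
    linarith
  obtain ⟨δ, hδ, hlab⟩ := exists_labelGraph ht hγ₀0 hγ₀1
  refine ⟨γ, 1 / (40 * c), δ, hγ0, hγ1, by positivity, hδ, ?_⟩
  intro ε hε N d hN hd hdN G h1 h2 h3 hfar
  have : Nonempty (Fin N) := ⟨⟨0, hN⟩⟩
  set L : Set (Fin N) := {v | deg G v ≤ 4 * d} with hL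
  have hN0 : (0 : ℝ) < N := by exact_mod_cast hN
  have hd0 : (0 : ℝ) < d := by exact_mod_cast hd
  have hdeg : ∀ v, deg (restrict G L) v ≤ 4 * d := by
    intro v
    by_cases hv : v ∈ L
    · exact (deg_restrict_le G L v).trans hv
    · have : deg (restrict G L) v = 0 := by
        rw [deg, Finset.card_eq_zero, Finset.eq_empty_iff_forall_notMem]
        intro x hx
        exact hv (mem_nbhd.1 hx).2.1
      omega
  have hdeg' : ∀ v, pr (fun x => (restrict G L).Adj v x) ≤ 4 * (d / N) := by
    intro v
    rw [pr_adj, Fintype.card_fin]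
    have : (deg (restrict G L) v : ℝ) ≤ 4 * d := by exact_mod_cast hdeg v
    calc (deg (restrict G L) v : ℝ) / N ≤ 4 * d / N := by gcongr
      _ = 4 * (d / N) := by ring
  -- Degrees after restriction are at most 4d, so ρ = 4d/N here, and the error 3γ₀ρ becomes the `lam
  -- = 12 γ₀` of the trimming step.
  obtain ⟨p, f, hgap⟩ := hlab (Fin N) G (4 * (d / N)) (by positivity) L hdeg' h3
  obtain ⟨p', hdeg₂, hgap₂⟩ := exists_low_degree_labelGraph (by omega) (restrict G L) p f hd hγ0 hγ1
    hdeg (β := 1 / (40 * c)) (lam := 12 * γ₀) ((pr_mono fun v hv => lt_of_lt_of_le hv (by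
      exact_mod_cast deg_restrict_le G L v)).trans h2) (by
      rw [Fintype.card_fin]
      linarith)
  rw [Fintype.card_fin] at hgap₂
  have hmem : (lowDegreeBlowUpCollection (SimpleGraph.cycleGraph t) (c * ε)).Mem
      (labelGraph (SimpleGraph.cycleGraph t) p' f) := by
    refine ⟨fun v => ?_, isBlowUpCollection_labelGraph _ _ _⟩
    rw [ncard_neighborSet]
    have : (deg (labelGraph (SimpleGraph.cycleGraph t) p' f) v : ℝ) ≤ d := by
      exact_mod_cast hdeg₂ v
    linarith
  have h4 := hfar _ hmem
  have h5 := two_mul_editDistance hN G (labelGraph (SimpleGraph.cycleGraph t) p' f)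
  have h6 := gap_triangle G (restrict G L) (labelGraph (SimpleGraph.cycleGraph t) p' f)
  have h7 := gap_restrict_le G L
  have h8 : gap G (labelGraph (SimpleGraph.cycleGraph t) p' f) ≤ 1 / c * (d / N) := by
    -- The whole budget in units of d/N: deleted edges at high-degree vertices, error of the label
    -- graph, and trimming. Since d/N ≤ cε, a total of 1/c is affordable; γ, β and γ₀ were chosen
    -- for this.
    have h9 : 2 * (1 / (40 * c)) + (12 * γ₀ + 8 * (1 / (40 * c) + 2 * (12 * γ₀) / γ + 2 * γ)) ≤
        1 / c := by
      have e1 : 2 * (12 * γ₀) / γ = 24 / (816 * c) := by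
        rw [hγ₀]
        field_simp
        norm_num
      have e2 : 12 * γ₀ ≤ 12 / (816 * c) := by
        rw [hγ₀]
        have : γ ≤ 1 := by linarith
        calc 12 * (γ / (816 * c)) = γ * (12 / (816 * c)) := by ring
          _ ≤ 1 * (12 / (816 * c)) := by gcongr
          _ = _ := one_mul _
      have e3 : 2 * (1 / (40 * c)) + (12 / (816 * c) + 8 * (1 / (40 * c) + 24 / (816 * c) +
          2 * (1 / (64 * c)))) = (1 / 4 + 12 / 816 + 192 / 816 + 1 / 4) * (1 / c) := by
        field_simp
        norm_num
      have e4 : (1 / 4 + 12 / 816 + 192 / 816 + 1 / 4) * (1 / c) ≤ 1 * (1 / c) := by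
        gcongr
        norm_num
      rw [e1, ← hγ] at *
      linarith
    have h10 : (0 : ℝ) ≤ d / N := by positivity
    calc _ ≤ _ := h6
      _ ≤ 2 * (1 / (40 * c) * (d / N)) + (12 * γ₀ + 8 * (1 / (40 * c) + 2 * (12 * γ₀) / γ +
          2 * γ)) * (d / N) := by linarith
      _ = (2 * (1 / (40 * c)) + (12 * γ₀ + 8 * (1 / (40 * c) + 2 * (12 * γ₀) / γ + 2 * γ))) *
          (d / N) := by ring
      _ ≤ _ := by gcongr
  have h11 : (d : ℝ) / N ≤ c * ε := by
    rw [div_le_iff₀ hN0]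
    exact hdN
  have h12 : gap G (labelGraph (SimpleGraph.cycleGraph t) p' f) ≤ ε := by
    calc _ ≤ _ := h8
      _ ≤ 1 / c * (c * ε) := by gcongr
      _ = ε := by field_simp
  have h13 : 0 < ε * (N : ℝ) ^ 2 := by positivity
  have h14 : gap G (labelGraph (SimpleGraph.cycleGraph t) p' f) * (N : ℝ) ^ 2 ≤
      ε * (N : ℝ) ^ 2 := by gcongr
  linarith


/-! ### Randomized tests -/

section

variable {N : ℕ}

/-- `F` depends only on the adjacency of the given pairs. -/
def DeterminedBy {α : Type} (qs : List (Fin N × Fin N)) (F : SimpleGraph (Fin N) → α) : Prop :=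
  ∀ G G' : SimpleGraph (Fin N), (∀ p ∈ qs, G.Adj p.1 p.2 ↔ G'.Adj p.1 p.2) → F G = F G'

/-- `F` can be computed by `q` non-adaptive queries. -/
def NonAdaptive {α : Type} (q : ℕ) (F : SimpleGraph (Fin N) → α) : Prop :=
  ∃ qs : List (Fin N × Fin N), qs.length ≤ q ∧ DeterminedBy qs F

open Classical in
/-- `F` can be computed by `q` adaptive queries. -/
inductive Adaptive {N : ℕ} {α : Type} : ℕ → (SimpleGraph (Fin N) → α) → Prop
  | const (q : ℕ) (a : α) : Adaptive q fun _ => a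
  | query {q : ℕ} (u v : Fin N) {F₁ F₀ : SimpleGraph (Fin N) → α} (h₁ : Adaptive q F₁)
      (h₀ : Adaptive q F₀) : Adaptive (q + 1) fun G => if G.Adj u v then F₁ G else F₀ G

theorem Adaptive.mono {α : Type} {q r : ℕ} {F : SimpleGraph (Fin N) → α} (h : Adaptive q F)
    (hqr : q ≤ r) : Adaptive r F := by
  induction h generalizing r with
  | const q a => exact Adaptive.const r a
  | query u v _ _ ih₁ ih₀ =>
    obtain ⟨r, rfl⟩ : ∃ r', r = r' + 1 := ⟨r - 1, by omega⟩
    exact Adaptive.query u v (ih₁ (by omega)) (ih₀ (by omega))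

theorem Adaptive.bind {α β : Type} {q r : ℕ} {F : SimpleGraph (Fin N) → α}
    {K : α → SimpleGraph (Fin N) → β} (h : Adaptive q F) (hK : ∀ a, Adaptive r (K a)) :
    Adaptive (q + r) fun G => K (F G) G := by
  classical
  induction h with
  | const q a => exact (hK a).mono (by omega)
  | query u v _ _ ih₁ ih₀ =>
    have := Adaptive.query u v ih₁ ih₀
    convert this using 1
    · omega
    · funext G
      by_cases h : G.Adj u v <;> simp [h]

theorem Adaptive.map {α β : Type} {q : ℕ} {F : SimpleGraph (Fin N) → α} (h : Adaptive q F)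
    (g : α → β) : Adaptive q fun G => g (F G) :=
  h.bind (r := 0) (K := fun a _ => g a) fun a => Adaptive.const 0 (g a)

open Classical in
theorem adaptive_answers (qs : List (Fin N × Fin N)) :
    Adaptive qs.length fun G : SimpleGraph (Fin N) => qs.map fun p => decide (G.Adj p.1 p.2) := by
  induction qs with
  | nil => exact Adaptive.const 0 []
  | cons p qs ih =>
    have := Adaptive.query p.1 p.2 (ih.map fun l => true :: l) (ih.map fun l => false :: l)
    convert this using 1
    · exact List.length_cons
    · funext G
      by_cases h : G.Adj p.1 p.2 <;> simp [h]

-- Given a list of answers, evaluate `F` on any graph that would produce it; lists that no graph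
-- produces get an arbitrary value.
open Classical in
theorem DeterminedBy.exists_verdict {α : Type} [Nonempty α] {qs : List (Fin N × Fin N)}
    {F : SimpleGraph (Fin N) → α} (h : DeterminedBy qs F) :
    ∃ g : List Bool → α, ∀ G, g (qs.map fun p => decide (G.Adj p.1 p.2)) = F G := by
  refine ⟨fun l => if h : ∃ G : SimpleGraph (Fin N), (qs.map fun p => decide (G.Adj p.1 p.2)) = l
    then F h.choose else Classical.arbitrary α, fun G => ?_⟩
  have hex : ∃ G' : SimpleGraph (Fin N), (qs.map fun p => decide (G'.Adj p.1 p.2)) =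
      qs.map fun p => decide (G.Adj p.1 p.2) := ⟨G, rfl⟩
  beta_reduce
  rw [dif_pos hex]
  refine h _ _ fun p hp => ?_
  have := List.map_inj_left.1 hex.choose_spec p hp
  simpa using this

theorem NonAdaptive.adaptive {α : Type} [Nonempty α] {q : ℕ} {F : SimpleGraph (Fin N) → α}
    (h : NonAdaptive q F) : Adaptive q F := by
  obtain ⟨qs, hq, hd⟩ := h
  obtain ⟨g, hg⟩ := hd.exists_verdict
  have := ((adaptive_answers qs).map g).mono hq
  convert this using 2 with G
  exact (hg G).symm

theorem NonAdaptive.exists_algorithm {q : ℕ} {F : SimpleGraph (Fin N) → Bool}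
    (h : NonAdaptive q F) :
    ∃ A : NonAdaptiveAlgorithm N, A.queryCount ≤ q ∧ ∀ G, A.run G = F G := by
  obtain ⟨qs, hq, hd⟩ := h
  obtain ⟨g, hg⟩ := hd.exists_verdict
  exact ⟨⟨qs, g⟩, hq, hg⟩

theorem Adaptive.exists_tree {q : ℕ} {F : SimpleGraph (Fin N) → Bool} (h : Adaptive q F) :
    ∃ T : DecisionTree N, T.queryCount ≤ q ∧ ∀ G, T.run G = F G := by
  classical
  induction h with
  | const q a => exact ⟨.answer a, Nat.zero_le _, fun _ => rfl⟩
  | query u v _ _ ih₁ ih₀ =>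
    obtain ⟨T₁, h₁, h₁'⟩ := ih₁
    obtain ⟨T₀, h₀, h₀'⟩ := ih₀
    refine ⟨.query u v T₁ T₀, Nat.succ_le_succ (max_le h₁ h₀), fun G => ?_⟩
    simp only [DecisionTree.run, h₁', h₀']

/-- The conjunction of two tests. -/
def bothAccept (F F' : SimpleGraph (Fin N) → Bool) : SimpleGraph (Fin N) → Bool :=
  fun G => F G && F' G

theorem NonAdaptive.both {q q' : ℕ} {F F' : SimpleGraph (Fin N) → Bool} (h : NonAdaptive q F)
    (h' : NonAdaptive q' F') : NonAdaptive (q + q') (bothAccept F F') := by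
  obtain ⟨l, hl, hd⟩ := h
  obtain ⟨l', hl', hd'⟩ := h'
  refine ⟨l ++ l', by rw [List.length_append]; omega, fun G G' hG => ?_⟩
  rw [bothAccept, bothAccept, hd G G' fun p hp => hG p (List.mem_append_left _ hp),
    hd' G G' fun p hp => hG p (List.mem_append_right _ hp)]

theorem Adaptive.both {q q' : ℕ} {F F' : SimpleGraph (Fin N) → Bool} (h : Adaptive q F)
    (h' : Adaptive q' F') : Adaptive (q + q') (bothAccept F F') :=
  h.bind (K := fun a G => a && F' G) fun a => h'.map fun b => a && b

/-- There is a random element of the class `𝒞` which rejects every graph satisfying `Acc` with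
probability at most `a` and accepts every graph satisfying `Rej` with probability at most `b`. -/
def HasTest (𝒞 : (SimpleGraph (Fin N) → Bool) → Prop) (Acc Rej : SimpleGraph (Fin N) → Prop)
    (a b : ℝ) : Prop :=
  ∃ (Ω : Type) (_ : Fintype Ω) (_ : Nonempty Ω) (F : Ω → SimpleGraph (Fin N) → Bool),
    (∀ ω, 𝒞 (F ω)) ∧ (∀ G, Acc G → pr (fun ω => F ω G = false) ≤ a) ∧
      ∀ G, Rej G → pr (fun ω => F ω G = true) ≤ b

variable {𝒞 𝒞' 𝒞'' : (SimpleGraph (Fin N) → Bool) → Prop}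
  {Acc Rej Rej' : SimpleGraph (Fin N) → Prop} {a a' b b' : ℝ}

theorem HasTest.mono (h : HasTest 𝒞 Acc Rej a b) (h𝒞 : ∀ F, 𝒞 F → 𝒞' F)
    (hR : ∀ G, Rej' G → Rej G) (ha : a ≤ a') (hb : b ≤ b') : HasTest 𝒞' Acc Rej' a' b' := by
  obtain ⟨Ω, i1, i2, F, h1, h2, h3⟩ := h
  exact ⟨Ω, i1, i2, F, fun ω => h𝒞 _ (h1 ω), fun G hG => (h2 G hG).trans ha,
    fun G hG => (h3 G (hR G hG)).trans hb⟩

/-- With independent randomness the rejection probabilities obey a union bound and the acceptance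
probabilities multiply. -/
theorem HasTest.both_aux (h𝒞 : ∀ F F', 𝒞 F → 𝒞' F' → 𝒞'' (bothAccept F F'))
    {Ω Ω' : Type} [Fintype Ω] [Nonempty Ω] [Fintype Ω'] [Nonempty Ω']
    {F : Ω → SimpleGraph (Fin N) → Bool} {F' : Ω' → SimpleGraph (Fin N) → Bool}
    (h1 : ∀ ω, 𝒞 (F ω)) (h1' : ∀ ω, 𝒞' (F' ω)) :
    (∀ ω : Ω × Ω', 𝒞'' (bothAccept (F ω.1) (F' ω.2))) ∧
    (∀ G, pr (fun ω : Ω × Ω' => bothAccept (F ω.1) (F' ω.2) G = false) ≤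
      pr (fun ω => F ω G = false) + pr (fun ω => F' ω G = false)) ∧
    ∀ G, pr (fun ω : Ω × Ω' => bothAccept (F ω.1) (F' ω.2) G = true) =
      pr (fun ω => F ω G = true) * pr (fun ω => F' ω G = true) := by
  refine ⟨fun ω => h𝒞 _ _ (h1 _) (h1' _), fun G => ?_, fun G => ?_⟩
  · have e1 : pr (fun ω : Ω × Ω' => F ω.1 G = false) = pr (fun ω => F ω G = false) := by
      rw [pr_prod]
      unfold pr
      simp only [avg_const]
    have e2 : pr (fun ω : Ω × Ω' => F' ω.2 G = false) = pr (fun ω => F' ω G = false) := by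
      rw [pr_prod]
      exact avg_const (α := Ω) (pr fun ω => F' ω G = false)
    rw [← e1, ← e2]
    refine (pr_mono fun ω hω => ?_).trans (pr_or_le _ _)
    cases h : F ω.1 G <;> simp_all [bothAccept]
  · unfold pr
    simp only [bothAccept, Bool.and_eq_true, ind_and]
    rw [avg_prod]
    simp only [avg_mul_left, avg_mul_right]

/-- The acceptance probability of the conjunction is at most that of either test, so the error `b`
on graphs to be rejected does not accumulate; only the false rejections add up. -/
theorem HasTest.or (h : HasTest 𝒞 Acc Rej a b) (h' : HasTest 𝒞' Acc Rej' a' b)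
    (h𝒞 : ∀ F F', 𝒞 F → 𝒞' F' → 𝒞'' (bothAccept F F')) :
    HasTest 𝒞'' Acc (fun G => Rej G ∨ Rej' G) (a + a') b := by
  obtain ⟨Ω, i1, i2, F, h1, h2, h3⟩ := h
  obtain ⟨Ω', i1', i2', F', h1', h2', h3'⟩ := h'
  obtain ⟨g1, g2, g3⟩ := HasTest.both_aux h𝒞 h1 h1'
  refine ⟨Ω × Ω', inferInstance, inferInstance, _, g1,
    fun G hG => (g2 G).trans (add_le_add (h2 G hG) (h2' G hG)), fun G hG => ?_⟩
  rw [g3]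
  rcases hG with hG | hG
  · exact (mul_le_of_le_one_right (pr_nonneg _) (pr_le_one _)).trans (h3 G hG)
  · exact (mul_le_of_le_one_left (pr_nonneg _) (pr_le_one _)).trans (h3' G hG)

/-- Independent repetitions of a test. -/
theorem HasTest.pow {𝒟 : ℕ → (SimpleGraph (Fin N) → Bool) → Prop} {q : ℕ}
    (h0 : 𝒟 0 fun _ => true)
    (h𝒟 : ∀ q q' F F', 𝒟 q F → 𝒟 q' F' → 𝒟 (q + q') (bothAccept F F'))
    (h : HasTest (𝒟 q) Acc Rej a b) (R : ℕ) : HasTest (𝒟 (R * q)) Acc Rej (R * a) (b ^ R) := by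
  induction R with
  | zero =>
    refine ⟨Unit, inferInstance, inferInstance, fun _ _ => true, fun _ => by simpa using h0,
      fun G _ => ?_, fun G _ => ?_⟩
    · rw [pr_eq_zero fun ω hω => by simp at hω]
      simp
    · rw [pow_zero]; exact pr_le_one _
  | succ R ih =>
    obtain ⟨Ω, i1, i2, F, h1, h2, h3⟩ := ih
    obtain ⟨Ω', i1', i2', F', h1', h2', h3'⟩ := h
    obtain ⟨g1, g2, g3⟩ := HasTest.both_aux (h𝒟 (R * q) q) h1 h1'
    refine ⟨Ω × Ω', inferInstance, inferInstance, fun ω => bothAccept (F ω.1) (F' ω.2),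
      fun ω => ?_, fun G hG => ?_, fun G hG => ?_⟩
    · rw [Nat.succ_mul]; exact g1 ω
    · refine (g2 G).trans ((add_le_add (h2 G hG) (h2' G hG)).trans (le_of_eq ?_))
      push_cast
      ring
    · rw [g3, pow_succ]
      exact mul_le_mul (h3 G hG) (h3' G hG) (pr_nonneg _) ((pr_nonneg _).trans (h3 G hG))

theorem nonAdaptive_true : NonAdaptive 0 fun _ : SimpleGraph (Fin N) => true :=
  ⟨[], le_rfl, fun _ _ _ => rfl⟩

theorem uniform_map_apply {Ω : Type} [Fintype Ω] [Nonempty Ω] (g : Ω → Bool) (b : Bool) :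
    ((PMF.uniformOfFintype Ω).map g) b = ENNReal.ofReal (pr fun ω => g ω = b) := by
  classical
  rw [PMF.map_apply, tsum_fintype]
  simp only [PMF.uniformOfFintype_apply]
  have hc : (0 : ℝ) < Fintype.card Ω := Nat.cast_pos.2 Fintype.card_pos
  rw [pr, avg, div_eq_mul_inv, Finset.sum_mul, ENNReal.ofReal_sum_of_nonneg fun ω _ =>
    mul_nonneg (ind_nonneg _) (inv_nonneg.2 hc.le)]
  refine Finset.sum_congr rfl fun ω _ => ?_
  by_cases h : g ω = b
  · rw [if_pos h.symm, ind_of h, one_mul, ENNReal.ofReal_inv_of_pos hc, ENNReal.ofReal_natCast]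
  · rw [if_neg (fun e => h e.symm), ind_of_not h, zero_mul, ENNReal.ofReal_zero]

theorem two_thirds_lt_of_pr_le {Ω : Type} [Fintype Ω] [Nonempty Ω] (g : Ω → Bool) {b b' : Bool}
    (hb : b ≠ b') (h : pr (fun ω => g ω = b') ≤ 1 / 4) :
    2 / 3 < ((PMF.uniformOfFintype Ω).map g) b := by
  rw [uniform_map_apply]
  have h1 : pr (fun ω => g ω = b) = 1 - pr (fun ω => g ω = b') := by
    rw [← pr_not]
    refine pr_congr fun ω => ?_
    cases h1 : g ω <;> cases b <;> cases b' <;> simp_all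
  have h2 : (2 / 3 : ENNReal) = ENNReal.ofReal (2 / 3) := by
    rw [ENNReal.ofReal_div_of_pos (by norm_num)]
    norm_num
  rw [h2, ENNReal.ofReal_lt_ofReal_iff (by linarith)]
  linarith

/-- A test with small error probabilities, whose members are realized by algorithms, yields a
tester. -/
theorem HasTest.exists_isTester {P : GraphProperty} {ε : ℝ} {A : Type}
    {run : SimpleGraph (Fin N) → A → Bool} {S : A → Prop}
    (h : HasTest 𝒞 P.Mem (IsFar P ε) (1 / 4) (1 / 4))
    (hA : ∀ F, 𝒞 F → ∃ x, S x ∧ ∀ G, run G x = F G) :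
    ∃ μ : PMF A, (∀ x ∈ μ.support, S x) ∧ IsTester P ε run μ := by
  obtain ⟨Ω, i1, i2, F, h1, h2, h3⟩ := h
  choose alg halg hrun using fun ω => hA (F ω) (h1 ω)
  refine ⟨(PMF.uniformOfFintype Ω).map alg, ?_, fun G hG => ?_, fun G hG => ?_⟩
  · intro x hx
    rw [PMF.support_map] at hx
    obtain ⟨ω, -, rfl⟩ := hx
    exact halg ω
  · rw [PMF.map_comp]
    refine two_thirds_lt_of_pr_le (b' := false) _ (by simp) ?_
    simpa [Function.comp, hrun] using h2 G hG
  · rw [PMF.map_comp]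
    refine two_thirds_lt_of_pr_le (b' := true) _ (by simp) ?_
    simpa [Function.comp, hrun] using h3 G hG

theorem nonAdaptivelyTestable_of_hasTest {P : GraphProperty} {ε : ℝ} {q : ℕ}
    (h : ∀ N : ℕ, 1 ≤ N → HasTest (N := N) (NonAdaptive q) P.Mem (IsFar P ε) (1 / 4) (1 / 4)) :
    NonAdaptivelyTestable P ε q := fun N hN =>
  (h N hN).exists_isTester fun _ hF => hF.exists_algorithm

theorem adaptivelyTestable_of_hasTest {P : GraphProperty} {ε : ℝ} {q : ℕ}
    (h : ∀ N : ℕ, 1 ≤ N → HasTest (N := N) (Adaptive q) P.Mem (IsFar P ε) (1 / 4) (1 / 4)) :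
    AdaptivelyTestable P ε q := fun N hN =>
  (h N hN).exists_isTester fun _ hF => hF.exists_tree

end


/-! ### Chernoff bounds -/

section Chernoff

variable {V : Type} [Fintype V] [Nonempty V] {A : V → Prop} {r : ℕ} {a γ : ℝ}

/-- The number of entries of a tuple which satisfy `A`. -/
noncomputable def hits (A : V → Prop) (x : Fin r → V) : ℝ := ∑ j, ind (A (x j))

/-- The exponential moment factorizes over the independent entries, and each factor is bounded by 1
+ x ≤ eˣ. -/
theorem avg_exp_hits_le (A : V → Prop) (r : ℕ) (s : ℝ) :
    avg (fun x : Fin r → V => Real.exp (s * hits A x)) ≤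
      Real.exp ((Real.exp s - 1) * pr A * r) := by
  have h1 : (fun x : Fin r → V => Real.exp (s * hits A x)) =
      fun x => ∏ j, Real.exp (s * ind (A (x j))) := by
    ext x
    rw [hits, Finset.mul_sum, Real.exp_sum]
  have h2 : avg (fun v => Real.exp (s * ind (A v))) = 1 + (Real.exp s - 1) * pr A := by
    have : (fun v => Real.exp (s * ind (A v))) = fun v => 1 + (Real.exp s - 1) * ind (A v) := by
      ext v
      by_cases h : A v
      · rw [ind_of h]; ring_nf
      · rw [ind_of_not h]; simp
    rw [this, avg_add, avg_mul_left, avg_const, pr]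
  rw [h1, avg_pi (fun _ v => Real.exp (s * ind (A v))), Finset.prod_const, h2, Finset.card_univ,
    Fintype.card_fin, mul_comm _ (r : ℝ), Real.exp_nat_mul]
  refine pow_le_pow_left₀ ?_ ?_ r
  · rw [← h2]
    exact avg_nonneg fun v => (Real.exp_pos _).le
  · rw [add_comm]
    exact Real.add_one_le_exp _

/-- Markov's inequality for the exponential moment; the sign of `s` selects the upper or the lower
tail. -/
theorem pr_hits_le (s θ : ℝ) {P : (Fin r → V) → Prop} (hP : ∀ x, P x → s * θ ≤ s * hits A x) :
    pr P ≤ Real.exp ((Real.exp s - 1) * pr A * r - s * θ) := by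
  have h1 := pr_le_avg_div (X := fun x : Fin r → V => Real.exp (s * hits A x))
    (fun x => (Real.exp_pos _).le) (Real.exp_pos (s * θ))
  refine (pr_mono fun x hx => Real.exp_le_exp.2 (hP x hx)).trans (h1.trans ?_)
  rw [Real.exp_sub]
  gcongr
  exact avg_exp_hits_le A r s

theorem pr_many_hits_le (ha : 0 ≤ a) (hγ : 0 < γ) (hγ1 : γ ≤ 1 / 4) (hA : pr A ≤ a) :
    pr (fun x : Fin r → V => (1 + γ / 2) * (r * a) ≤ hits A x) ≤
      Real.exp (-(γ ^ 2 / 32 * (r * a))) := by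
  -- With this tilt the linear terms in γ cancel and the exponent is at most -γ²ra/16.
  refine (pr_hits_le (A := A) (γ / 4) ((1 + γ / 2) * (r * a)) fun x hx => ?_).trans ?_
  · gcongr
  · have h1 := abs_le.1 (Real.abs_exp_sub_one_sub_id_le (x := γ / 4)
      (by rw [abs_of_pos (by positivity)]; linarith))
    have h0 : 0 ≤ Real.exp (γ / 4) - 1 := by
      have := Real.add_one_le_exp (γ / 4)
      linarith
    have hra : 0 ≤ (r : ℝ) * a := by positivity
    have h2 : (Real.exp (γ / 4) - 1) * pr A * r ≤ (γ / 4 + (γ / 4) ^ 2) * (r * a) := by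
      calc (Real.exp (γ / 4) - 1) * pr A * r ≤ (Real.exp (γ / 4) - 1) * a * r := by gcongr
        _ = (Real.exp (γ / 4) - 1) * (r * a) := by ring
        _ ≤ (γ / 4 + (γ / 4) ^ 2) * (r * a) := by
          gcongr
          linarith [h1.2]
    refine Real.exp_le_exp.2 ?_
    nlinarith [mul_nonneg (sq_nonneg γ) hra]

theorem pr_few_hits_le (ha : 0 ≤ a) (hγ : 0 < γ) (hγ1 : γ ≤ 1 / 4) (hA : (1 + γ) * a ≤ pr A) :
    pr (fun x : Fin r → V => hits A x < (1 + γ / 2) * (r * a)) ≤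
      Real.exp (-(γ ^ 2 / 32 * (r * a))) := by
  refine (pr_hits_le (A := A) (-(γ / 8)) ((1 + γ / 2) * (r * a)) fun x hx => ?_).trans ?_
  · nlinarith
  · have h1 := abs_le.1 (Real.abs_exp_sub_one_sub_id_le (x := -(γ / 8))
      (by rw [abs_neg, abs_of_pos (by positivity)]; linarith))
    have h0 : Real.exp (-(γ / 8)) - 1 ≤ -(γ / 8) + (γ / 8) ^ 2 := by
      have := h1.2
      rw [neg_sq] at this
      linarith
    have h0' : -(γ / 8) + (γ / 8) ^ 2 ≤ 0 := by nlinarith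
    have hra : 0 ≤ (r : ℝ) * a := by positivity
    have h2 : (Real.exp (-(γ / 8)) - 1) * pr A * r ≤
        (-(γ / 8) + (γ / 8) ^ 2) * ((1 + γ) * (r * a)) := by
      calc (Real.exp (-(γ / 8)) - 1) * pr A * r
          ≤ (-(γ / 8) + (γ / 8) ^ 2) * pr A * r := by
            gcongr
            exact pr_nonneg _
        _ = (-(γ / 8) + (γ / 8) ^ 2) * (pr A * r) := by ring
        _ ≤ (-(γ / 8) + (γ / 8) ^ 2) * ((1 + γ) * a * r) :=
            mul_le_mul_of_nonpos_left (by gcongr) h0'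
        _ = _ := by ring
    refine Real.exp_le_exp.2 (h2 |> fun h => ?_)
    have h3 : 0 ≤ γ ^ 2 * (r * a) * (1 / 4 - γ) :=
      mul_nonneg (mul_nonneg (sq_nonneg γ) hra) (by linarith)
    nlinarith [mul_nonneg (sq_nonneg γ) hra]

end Chernoff

/-! ### Testing the degrees -/

theorem HasTest.levels {N : ℕ} {𝒟 : ℕ → (SimpleGraph (Fin N) → Bool) → Prop}
    {Acc : SimpleGraph (Fin N) → Prop} {Rej : ℕ → SimpleGraph (Fin N) → Prop} {q : ℕ → ℕ}
    {a : ℕ → ℝ} {b : ℝ} (h0 : 𝒟 0 fun _ => true)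
    (h𝒟 : ∀ q q' F F', 𝒟 q F → 𝒟 q' F' → 𝒟 (q + q') (bothAccept F F')) (n : ℕ)
    (h : ∀ i < n, HasTest (𝒟 (q i)) Acc (Rej i) (a i) b) :
    HasTest (𝒟 (∑ i ∈ Finset.range n, q i)) Acc (fun G => ∃ i < n, Rej i G)
      (∑ i ∈ Finset.range n, a i) b := by
  induction n with
  | zero =>
    refine ⟨Unit, inferInstance, inferInstance, fun _ _ => true, fun _ => h0,
      fun G _ => ?_, fun G hG => ?_⟩
    · rw [pr_eq_zero fun ω hω => by simp at hω]
      simp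
    · obtain ⟨i, hi, -⟩ := hG
      omega
  | succ n ih =>
    have h1 := (ih fun i hi => h i (by omega)).or (h n (by omega)) (h𝒟 _ _)
    rw [Finset.sum_range_succ, Finset.sum_range_succ]
    refine h1.mono (fun F hF => hF) (fun G hG => ?_) le_rfl le_rfl
    obtain ⟨i, hi, hG⟩ := hG
    rcases Nat.lt_succ_iff_lt_or_eq.1 hi with h | rfl
    · exact Or.inl ⟨i, h, hG⟩
    · exact Or.inr hG

open Classical in
/-- Estimating the degree of a single random vertex. -/
theorem hasTest_degree {N : ℕ} (hN : 0 < N) (r : ℕ) {a γ p : ℝ} (ha : 0 ≤ a) (hγ : 0 < γ)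
    (hγ1 : γ ≤ 1 / 4) :
    HasTest (N := N) (NonAdaptive r) (fun G => ∀ v, pr (fun x => G.Adj v x) ≤ a)
      (fun G => p ≤ pr (fun v => (1 + γ) * a ≤ pr (fun x => G.Adj v x)))
      (Real.exp (-(γ ^ 2 / 32 * (r * a)))) (1 - p * (1 - Real.exp (-(γ ^ 2 / 32 * (r * a))))) := by
  have : Nonempty (Fin N) := ⟨⟨0, hN⟩⟩
  set E := Real.exp (-(γ ^ 2 / 32 * (r * a))) with hE
  have hE1 : E ≤ 1 := Real.exp_le_one_iff.2 (by
    have : 0 ≤ γ ^ 2 / 32 * (r * a) := by positivity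
    linarith)
  refine ⟨Fin N × (Fin r → Fin N), inferInstance, inferInstance,
    fun ω G => decide (hits (fun x => G.Adj ω.1 x) ω.2 < (1 + γ / 2) * (r * a)),
    fun ω => ⟨List.ofFn fun j => (ω.1, ω.2 j), by simp, fun G G' hG => ?_⟩,
    fun G hG => ?_, fun G hG => ?_⟩
  · have : hits (fun x => G.Adj ω.1 x) ω.2 = hits (fun x => G'.Adj ω.1 x) ω.2 := by
      unfold hits
      refine Finset.sum_congr rfl fun j _ => ind_congr (hG (ω.1, ω.2 j) ?_)
      rw [List.mem_ofFn]
      exact ⟨j, rfl⟩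
    simp only [this]
  · simp only [decide_eq_false_iff_not, not_lt]
    rw [pr_prod]
    calc _ ≤ avg fun _ : Fin N => E := avg_mono fun v => pr_many_hits_le ha hγ hγ1 (hG v)
      _ = E := avg_const _
  · simp only [decide_eq_true_eq]
    rw [pr_prod]
    set H : Fin N → Prop := fun v => (1 + γ) * a ≤ pr (fun x => G.Adj v x)
    calc _ ≤ avg fun v : Fin N => 1 - ind (H v) * (1 - E) := by
          refine avg_mono fun v => ?_
          by_cases hv : H v
          · rw [ind_of hv]
            have := pr_few_hits_le (r := r) ha hγ hγ1 hv
            simpa using this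
          · rw [ind_of_not hv]
            simpa using pr_le_one _
      _ = 1 - pr H * (1 - E) := by rw [avg_sub, avg_const, avg_mul_right, pr]
      _ ≤ 1 - p * (1 - E) := by
          have : p * (1 - E) ≤ pr H * (1 - E) := mul_le_mul_of_nonneg_right hG (by linarith)
          linarith


theorem NonAdaptive.mono {N : ℕ} {α : Type} {q r : ℕ} {F : SimpleGraph (Fin N) → α}
    (h : NonAdaptive q F) (hqr : q ≤ r) : NonAdaptive r F := by
  obtain ⟨qs, hq, hd⟩ := h
  exact ⟨qs, hq.trans hqr, hd⟩

theorem exp_neg_two_le : Real.exp (-2) ≤ 1 / 4 := by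
  rw [Real.exp_neg, inv_le_comm₀ (Real.exp_pos _) (by norm_num)]
  have h1 := Real.add_one_le_exp 1
  have h2 : Real.exp 2 = Real.exp 1 * Real.exp 1 := by
    rw [← Real.exp_add]
    norm_num
  rw [h2]
  nlinarith

/-- If all dyadic classes of vertices of large degree are small, then these vertices are incident
to few edges. -/
theorem pr_high_degree_le {N d J : ℕ} (hN : 0 < N) (hd : 1 ≤ d) (hJ : N < 2 ^ (J + 1) * d)
    {γ β : ℝ} (hγ : 0 < γ) (hγ1 : γ ≤ 1 / 4) (G : SimpleGraph (Fin N))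
    (h : ∀ j < J + 1, pr (fun v => (1 + γ) * (2 ^ j * (d / N : ℝ)) ≤ pr (fun x => G.Adj v x)) ≤
      β / 4 / (2 ^ j * (J + 1))) :
    pr (fun q : Fin N × Fin N => G.Adj q.1 q.2 ∧ q.1 ∉ {v | deg G v ≤ 4 * d}) ≤ β * (d / N) := by
  have hN0 : (0 : ℝ) < N := by exact_mod_cast hN
  have hd0 : (0 : ℝ) < d := by exact_mod_cast hd
  have hJN : (N : ℝ) < 2 ^ (J + 1) * d := by exact_mod_cast hJ
  set T : ℕ → Fin N → Prop := fun j v => (1 + γ) * (2 ^ j * (d / N : ℝ)) ≤ pr (fun x => G.Adj v x)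
    with hT
  have hTiff : ∀ j v, T j v ↔ (1 + γ) * (2 ^ j * d) ≤ deg G v := by
    intro j v
    simp only [hT, pr_adj, Fintype.card_fin]
    rw [le_div_iff₀ hN0]
    have : (1 + γ) * (2 ^ j * (d / N : ℝ)) * N = (1 + γ) * (2 ^ j * d) := by field_simp
    rw [this]
  -- Each high-degree vertex is charged to the highest dyadic level k that it reaches; its degree is
  -- then at most 4·2^k d.
  have hpt : ∀ v, ind (v ∉ {v | deg G v ≤ 4 * d}) * pr (fun x => G.Adj v x) ≤
      ∑ j ∈ Finset.range (J + 1), 4 * (2 ^ j * (d / N : ℝ)) * ind (T j v) := by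
    intro v
    have hnn : ∀ j ∈ Finset.range (J + 1), 0 ≤ 4 * (2 ^ j * (d / N : ℝ)) * ind (T j v) :=
      fun j _ => mul_nonneg (by positivity) (ind_nonneg _)
    by_cases hv : deg G v ≤ 4 * d
    · rw [ind_of_not (by simpa using hv), zero_mul]
      exact Finset.sum_nonneg hnn
    · rw [ind_of (by simpa using hv), one_mul]
      have hv' : (4 * d : ℝ) < deg G v := by exact_mod_cast not_le.1 hv
      have hT0 : T 0 v := by
        rw [hTiff]
        nlinarith
      classical
      obtain ⟨hTk, hkJ, hmax⟩ : T (Nat.findGreatest (fun j => T j v) J) v ∧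
          Nat.findGreatest (fun j => T j v) J ≤ J ∧
          ∀ j, Nat.findGreatest (fun j => T j v) J < j → j ≤ J → ¬ T j v :=
        ⟨Nat.findGreatest_spec (P := fun j => T j v) (Nat.zero_le J) hT0,
          Nat.findGreatest_le _, fun j h1 h2 => Nat.findGreatest_is_greatest h1 h2⟩
      set k := Nat.findGreatest (fun j => T j v) J
      have hle : (deg G v : ℝ) ≤ 4 * (2 ^ k * d) := by
        -- Below the top level the bound holds because level k + 1 is missed and 2(1 + γ) ≤ 4; at
        -- the top level it is the trivial bound N < 2^(J+1) d.
        rcases Nat.lt_or_ge k J with h1 | h1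
        · have h2 := hmax (k + 1) (by omega) (by omega)
          rw [hTiff, not_le, pow_succ] at h2
          have h3 : (0 : ℝ) ≤ 2 ^ k * d := by positivity
          nlinarith
        · have h2 : k = J := le_antisymm hkJ h1
          have h3 : (deg G v : ℝ) ≤ N := by
            have := Finset.card_le_univ (nbhd G v)
            rw [Fintype.card_fin] at this
            exact_mod_cast this
          rw [h2]
          rw [pow_succ] at hJN
          have h4 : (0 : ℝ) ≤ 2 ^ J * d := by positivity
          nlinarith
      calc pr (fun x => G.Adj v x) ≤ 4 * (2 ^ k * (d / N : ℝ)) * ind (T k v) := by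
            rw [ind_of hTk, pr_adj, Fintype.card_fin, mul_one]
            calc (deg G v : ℝ) / N ≤ 4 * (2 ^ k * d) / N := by gcongr
              _ = _ := by ring
        _ ≤ _ := Finset.single_le_sum (f := fun j => 4 * (2 ^ j * (d / N : ℝ)) * ind (T j v)) hnn
            (Finset.mem_range.2 (by omega))
  calc pr (fun q : Fin N × Fin N => G.Adj q.1 q.2 ∧ q.1 ∉ {v | deg G v ≤ 4 * d})
      = avg fun v => ind (v ∉ {v | deg G v ≤ 4 * d}) * pr (fun x => G.Adj v x) := by
        unfold pr
        simp only [ind_and, avg_prod, avg_mul_right]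
        simp only [mul_comm]
    _ ≤ avg fun v => ∑ j ∈ Finset.range (J + 1), 4 * (2 ^ j * (d / N : ℝ)) * ind (T j v) :=
        avg_mono hpt
    _ = ∑ j ∈ Finset.range (J + 1), 4 * (2 ^ j * (d / N : ℝ)) * pr (T j) := by
        rw [avg_sum]
        simp only [avg_mul_left, pr]
    _ ≤ ∑ j ∈ Finset.range (J + 1), 4 * (2 ^ j * (d / N : ℝ)) * (β / 4 / (2 ^ j * (J + 1))) := by
        refine Finset.sum_le_sum fun j hj => ?_
        gcongr
        exact h j (Finset.mem_range.1 hj)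
    _ = β * (d / N) := by
        have : ∀ j ∈ Finset.range (J + 1), 4 * (2 ^ j * (d / N : ℝ)) *
            (β / 4 / (2 ^ j * (J + 1))) = β * (d / N) / (J + 1) := by
          intro j _
          field_simp
        rw [Finset.sum_congr rfl this, Finset.sum_const, Finset.card_range, nsmul_eq_mul]
        push_cast
        field_simp

/-- One repeated single-vertex test per dyadic level. The threshold β/(4·2^j(J+1)) for level j is
such that, if all levels stay below it, the high-degree vertices carry few edges by
`pr_high_degree_le`, while level 0 alone controls the slightly too large degrees. The number `m j`
of repetitions makes the expected number of sampled offenders a constant. -/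
theorem hasTest_degrees {N d J : ℕ} (hN : 0 < N) (hd : 1 ≤ d) (hJ : N < 2 ^ (J + 1) * d)
    {γ β E : ℝ} (hγ : 0 < γ) (hγ1 : γ ≤ 1 / 4) (hβ : 0 < β) (hβ1 : β ≤ 1) (hE : E ≤ 1 / 2)
    (r m : ℕ → ℕ)
    (hr : ∀ j < J + 1, Real.exp (-(γ ^ 2 / 32 * (r j * (2 ^ j * (d / N : ℝ))))) ≤ E)
    (hm : ∀ j < J + 1, 16 * (2 ^ j * (J + 1)) / β ≤ m j) :
    HasTest (N := N) (NonAdaptive (∑ j ∈ Finset.range (J + 1), m j * r j))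
      (fun G => ∀ v, deg G v ≤ d)
      (fun G => ¬ (pr (fun q : Fin N × Fin N => G.Adj q.1 q.2 ∧ q.1 ∉ {v | deg G v ≤ 4 * d}) ≤
        β * (d / N)) ∨ ¬ (pr (fun v => (1 + γ) * d < deg G v) ≤ β))
      (∑ j ∈ Finset.range (J + 1), m j * E) (1 / 4) := by
  have hN0 : (0 : ℝ) < N := by exact_mod_cast hN
  have hd0 : (0 : ℝ) < d := by exact_mod_cast hd
  have hlevel : ∀ j < J + 1, HasTest (N := N) (NonAdaptive (m j * r j))
      (fun G => ∀ v, deg G v ≤ d)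
      (fun G => β / 4 / (2 ^ j * (J + 1)) ≤
        pr (fun v => (1 + γ) * (2 ^ j * (d / N : ℝ)) ≤ pr (fun x => G.Adj v x)))
      (m j * E) (1 / 4) := by
    intro j hj
    set p : ℝ := β / 4 / (2 ^ j * (J + 1)) with hp
    set E' := Real.exp (-(γ ^ 2 / 32 * (r j * (2 ^ j * (d / N : ℝ))))) with hE'
    have hE'0 : 0 < E' := Real.exp_pos _
    have hE'1 : E' ≤ 1 / 2 := (hr j hj).trans hE
    have h1 := (hasTest_degree hN (r j) (a := 2 ^ j * (d / N : ℝ)) (p := p) (by positivity)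
      hγ hγ1).pow (𝒟 := NonAdaptive) nonAdaptive_true (fun _ _ _ _ => NonAdaptive.both) (m j)
    obtain ⟨Ω, i1, i2, F, g1, g2, g3⟩ := h1
    have hp0 : 0 < p := by positivity
    have hp1 : p ≤ 1 := by
      rw [hp, div_div, div_le_one (by positivity)]
      have : (1 : ℝ) ≤ 2 ^ j * (J + 1) := by
        have e1 : (1 : ℝ) ≤ 2 ^ j := one_le_pow₀ (by norm_num)
        have e2 : (1 : ℝ) ≤ J + 1 := by
          have := Nat.cast_nonneg (α := ℝ) J
          linarith
        nlinarith
      linarith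
    refine ⟨Ω, i1, i2, F, g1, fun G hG => (g2 G fun v => ?_).trans ?_, fun G hG =>
      (g3 G hG).trans ?_⟩
    · rw [pr_adj, Fintype.card_fin]
      have e1 : (1 : ℝ) ≤ 2 ^ j := one_le_pow₀ (by norm_num)
      have e2 : (deg G v : ℝ) ≤ d := by exact_mod_cast hG v
      calc (deg G v : ℝ) / N ≤ 1 * (d / N) := by rw [one_mul]; gcongr
        _ ≤ 2 ^ j * (d / N) := by gcongr
    · gcongr
      exact hr j hj
    · have e1 : 1 - p * (1 - E') ≤ Real.exp (-(p / 2)) := by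
        have := Real.add_one_le_exp (-(p / 2))
        nlinarith
      calc (1 - p * (1 - E')) ^ m j ≤ Real.exp (-(p / 2)) ^ m j := by
            refine pow_le_pow_left₀ ?_ e1 _
            nlinarith
        _ = Real.exp (m j * (-(p / 2))) := (Real.exp_nat_mul _ _).symm
        _ ≤ Real.exp (-2) := by
            refine Real.exp_le_exp.2 ?_
            have e2 : 16 * (2 ^ j * (J + 1)) / β * (p / 2) ≤ m j * (p / 2) := by
              gcongr
              exact hm j hj
            have e3 : 16 * (2 ^ j * (J + 1)) / β * (p / 2) = 2 := by
              rw [hp]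
              field_simp
              norm_num
            linarith
        _ ≤ 1 / 4 := exp_neg_two_le
  refine (HasTest.levels (q := fun j => m j * r j) (a := fun j => m j * E) nonAdaptive_true
    (fun _ _ _ _ => NonAdaptive.both) (J + 1) hlevel).mono (fun F hF => hF) (fun G hG => ?_)
    le_rfl le_rfl
  by_contra! hcon
  refine hG.elim (fun h => h (pr_high_degree_le hN hd hJ hγ hγ1 G fun j hj => (hcon j hj).le))
    fun h => h ?_
  refine (pr_mono fun v hv => ?_).trans ((hcon 0 (by omega)).le.trans ?_)
  · rw [pr_adj, Fintype.card_fin, pow_zero, one_mul]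
    calc (1 + γ) * (d / N : ℝ) = (1 + γ) * d / N := by ring
      _ ≤ deg G v / N := by gcongr
  · rw [pow_zero, one_mul, div_div]
    apply div_le_self hβ.le
    have := Nat.cast_nonneg (α := ℝ) J
    linarith

/-- The degree test makes `O(ε⁻¹ log³ ε⁻¹)` non-adaptive queries. -/
theorem eventually_hasTest_degrees {c γ β : ℝ} (hc : 1 ≤ c) (hγ : 0 < γ) (hγ1 : γ ≤ 1 / 4)
    (hβ : 0 < β) (hβ1 : β ≤ 1) :
    ∃ K : ℝ, 0 < K ∧ ∀ᶠ ε in 𝓝[>] (0 : ℝ), ∃ q : ℕ,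
      (q : ℝ) ≤ K * (ε⁻¹ * Real.log ε⁻¹ ^ 3) ∧ ∀ N d : ℕ, 0 < N → d = ⌊c * ε * N⌋₊ → 1 ≤ d →
        HasTest (N := N) (NonAdaptive q) (fun G => ∀ v, deg G v ≤ d)
          (fun G => ¬ (pr (fun q : Fin N × Fin N => G.Adj q.1 q.2 ∧
            q.1 ∉ {v | deg G v ≤ 4 * d}) ≤ β * (d / N)) ∨
            ¬ (pr (fun v => (1 + γ) * d < deg G v) ≤ β)) (1 / 8) (1 / 4) := by
  -- Then γ²R₀/32 = 4, so one degree estimate errs with probability at most ε⁴; this beats the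
  -- number of estimates, which is O(ε⁻¹) up to logarithms.
  set R₀ : ℝ := 128 / γ ^ 2 with hR₀
  have hR₀1 : 1 ≤ R₀ := by
    rw [hR₀, le_div_iff₀ (by positivity)]
    nlinarith
  set B : ℝ := 16 / β with hB
  have hB1 : 1 ≤ B := by
    rw [hB, le_div_iff₀ hβ]
    linarith
  refine ⟨128 * B * R₀, by positivity, ?_⟩
  have hev : ∀ᶠ ε in 𝓝[>] (0 : ℝ), 0 < ε ∧ ε < Real.exp (-1) ∧ ε < 1 / (512 * B) ∧ ε < 1 / c := by
    have h1 : ∀ᶠ ε in 𝓝[>] (0 : ℝ), ε ∈ Set.Ioo 0 (min (Real.exp (-1)) (min (1 / (512 * B)) (1 / c))) :=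
      Ioo_mem_nhdsGT (lt_min (Real.exp_pos _) (lt_min (by positivity) (by positivity)))
    filter_upwards [h1] with ε hε
    exact ⟨hε.1, hε.2.trans_le (min_le_left _ _),
      hε.2.trans_le ((min_le_right _ _).trans (min_le_left _ _)),
      hε.2.trans_le ((min_le_right _ _).trans (min_le_right _ _))⟩
  filter_upwards [hev] with ε ⟨hε, hε1, hε2, hεc⟩
  set l := Real.log ε⁻¹ with hl
  have hl1 : 1 ≤ l := by
    rw [hl, Real.log_inv]
    have := Real.log_lt_log hε hε1
    rw [Real.log_exp] at this
    linarith
  have hlε : l ≤ ε⁻¹ := Real.log_le_self (by positivity)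
  have hεlt1 : ε < 1 := hε1.trans (by rw [Real.exp_lt_one_iff]; norm_num)
  refine ⟨⌊128 * B * R₀ * (ε⁻¹ * l ^ 3)⌋₊, Nat.floor_le (by positivity), ?_⟩
  intro N d hN hd hd1
  have hN0 : (0 : ℝ) < N := by exact_mod_cast hN
  have hd0 : (0 : ℝ) < d := by exact_mod_cast hd1
  have hdle : (d : ℝ) ≤ c * ε * N := by rw [hd]; exact Nat.floor_le (by positivity)
  have hdge : c * ε * N < 2 * d := by
    have h1 : c * ε * N < d + 1 := by rw [hd]; exact Nat.lt_floor_add_one _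
    have h2 : (1 : ℝ) ≤ d := by exact_mod_cast hd1
    linarith
  have hratio : (N : ℝ) / d ≤ 2 * ε⁻¹ := by
    rw [div_le_iff₀ hd0]
    have : ε * N ≤ 2 * d := by
      have : ε * N ≤ c * (ε * N) := by
        apply le_mul_of_one_le_left (by positivity) hc
      linarith
    calc (N : ℝ) = ε⁻¹ * (ε * N) := by field_simp
      _ ≤ ε⁻¹ * (2 * d) := by gcongr
      _ = _ := by ring
  have hdN : d ≤ N := by
    have : c * ε ≤ 1 := by
      rw [lt_div_iff₀ (by positivity)] at hεc
      linarith
    have : (d : ℝ) ≤ N := hdle.trans (mul_le_of_le_one_left hN0.le this)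
    exact_mod_cast this
  set J := Nat.log 2 (N / d) with hJ
  have hNd : N / d ≠ 0 := (Nat.div_pos hdN hd1).ne'
  have hJ1 : 2 ^ J * d ≤ N :=
    (Nat.mul_le_mul_right d (Nat.pow_log_le_self 2 hNd)).trans (Nat.div_mul_le_self N d)
  have hJ2 : N < 2 ^ (J + 1) * d :=
    (Nat.div_lt_iff_lt_mul hd1).1 (Nat.lt_pow_succ_log_self one_lt_two _)
  have hJ1' : (2 : ℝ) ^ J * (d / N) ≤ 1 := by
    rw [← mul_div_assoc, div_le_one hN0]
    exact_mod_cast hJ1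
  have h2J : (2 : ℝ) ^ J ≤ N / d := by
    rw [le_div_iff₀ hd0]
    exact_mod_cast hJ1
  have hJl : (J : ℝ) + 1 ≤ 4 * l := by
    have h1 : (2 : ℝ) ^ J ≤ 2 * ε⁻¹ := h2J.trans hratio
    have h2 := Real.log_le_log (by positivity) h1
    rw [Real.log_pow, Real.log_mul (by norm_num) (by positivity), ← hl] at h2
    have h3 := Real.log_two_gt_d9
    have h4 := Real.log_two_lt_d9
    have h5 : (J : ℝ) * 0.69 ≤ J * Real.log 2 := by gcongr; linarith
    linarith
  set r : ℕ → ℕ := fun j => ⌈R₀ * l / (2 ^ j * (d / N))⌉₊ with hr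
  set m : ℕ → ℕ := fun j => ⌈B * (2 ^ j * (J + 1))⌉₊ with hm
  have hpow : ∀ j ∈ Finset.range (J + 1), (2 : ℝ) ^ j ≤ 2 ^ J := fun j hj =>
    pow_le_pow_right₀ one_le_two (by simpa [Nat.lt_succ_iff] using hj)
  have hm_le : ∀ j, (m j : ℝ) ≤ 2 * B * (2 ^ j * (J + 1)) := by
    intro j
    have h1 : (1 : ℝ) ≤ 2 ^ j := one_le_pow₀ one_le_two
    have h2 : (0 : ℝ) ≤ J := by positivity
    have h3 : 1 ≤ B * (2 ^ j * ((J : ℝ) + 1)) :=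
      one_le_mul_of_one_le_of_one_le hB1 (one_le_mul_of_one_le_of_one_le h1 (by linarith))
    have := (Nat.ceil_lt_add_one (zero_le_one.trans h3)).le
    simp only [hm]
    linarith
  have hr_le : ∀ j ∈ Finset.range (J + 1), (r j : ℝ) ≤ 2 * (R₀ * l) / (2 ^ j * (d / N)) := by
    intro j hj
    have h0 : (0 : ℝ) < 2 ^ j * (d / N) := by positivity
    have h1 : (2 : ℝ) ^ j * (d / N) ≤ 1 :=
      (mul_le_mul_of_nonneg_right (hpow j hj) (by positivity)).trans hJ1'
    have h3 : 1 ≤ R₀ * l / (2 ^ j * (d / N)) := by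
      rw [le_div_iff₀ h0, one_mul]
      exact h1.trans (one_le_mul_of_one_le_of_one_le hR₀1 hl1)
    have := (Nat.ceil_lt_add_one (zero_le_one.trans h3)).le
    simp only [hr]
    have h5 : 2 * (R₀ * l) / (2 ^ j * ((d : ℝ) / N)) = 2 * (R₀ * l / (2 ^ j * (d / N))) :=
      mul_div_assoc _ _ _
    rw [h5]
    linarith
  set E := Real.exp (-(4 * l)) with hE
  have hE4 : E = ε ^ 4 := by
    rw [hE, hl, Real.log_inv, show -(4 * -Real.log ε) = ((4 : ℕ) : ℝ) * Real.log ε by push_cast; ring,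
      Real.exp_nat_mul, Real.exp_log hε]
  have hE2 : E ≤ 1 / 2 := by
    have h1 : E ≤ Real.exp (-2) := Real.exp_le_exp.2 (by linarith)
    linarith [exp_neg_two_le]
  refine (hasTest_degrees (J := J) (E := E) hN hd1 hJ2 hγ hγ1 hβ hβ1 hE2 r m ?_ ?_).mono
    ?_ ?_ ?_ ?_
  · intro j hj
    rw [hE]
    refine Real.exp_le_exp.2 (neg_le_neg ?_)
    have h1 : R₀ * l ≤ r j * (2 ^ j * (d / N)) := by
      rw [← div_le_iff₀ (by positivity)]
      exact Nat.le_ceil _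
    calc 4 * l = γ ^ 2 / 32 * (R₀ * l) := by rw [hR₀]; field_simp; norm_num
      _ ≤ _ := by gcongr
  · intro j hj
    refine le_trans (le_of_eq ?_) (Nat.le_ceil _)
    rw [hB]
    ring
  · intro F hF
    refine hF.mono (Nat.le_floor ?_)
    push_cast
    -- The sample grows like 2^j while the queries per sampled vertex shrink like 2^(-j). So each
    -- level costs O(l²/ε), and there are O(l) levels.
    have hterm : ∀ j ∈ Finset.range (J + 1), (m j : ℝ) * r j ≤ 4 * B * R₀ * l * (4 * l) * (2 * ε⁻¹) := by
      intro j hj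
      calc (m j : ℝ) * r j ≤ 2 * B * (2 ^ j * (J + 1)) * (2 * (R₀ * l) / (2 ^ j * (d / N))) := by
            gcongr
            · exact hm_le j
            · exact hr_le j hj
        _ = 4 * B * R₀ * l * (J + 1) * (N / d) := by field_simp; ring
        _ ≤ 4 * B * R₀ * l * (4 * l) * (2 * ε⁻¹) := by gcongr
    refine (Finset.sum_le_sum hterm).trans ?_
    rw [Finset.sum_const, Finset.card_range, nsmul_eq_mul]
    push_cast
    calc ((J : ℝ) + 1) * (4 * B * R₀ * l * (4 * l) * (2 * ε⁻¹))
        ≤ (4 * l) * (4 * B * R₀ * l * (4 * l) * (2 * ε⁻¹)) := by gcongr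
      _ = _ := by ring
  · exact fun G hG => hG
  · have hterm : ∀ j ∈ Finset.range (J + 1), (m j : ℝ) * E ≤ 2 * B * (2 * ε⁻¹ * (4 * l)) * E := by
      intro j hj
      have := hpow j hj
      gcongr
      refine (hm_le j).trans ?_
      gcongr
      exact this.trans (h2J.trans hratio)
    refine (Finset.sum_le_sum hterm).trans ?_
    rw [Finset.sum_const, Finset.card_range, nsmul_eq_mul, hE4]
    push_cast
    calc ((J : ℝ) + 1) * (2 * B * (2 * ε⁻¹ * (4 * l)) * ε ^ 4)
        ≤ (4 * ε⁻¹) * (2 * B * (2 * ε⁻¹ * (4 * ε⁻¹)) * ε ^ 4) := by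
          gcongr
          linarith
      _ = 64 * B * ε := by field_simp; ring
      _ ≤ 1 / 8 := by
          rw [lt_div_iff₀ (by positivity)] at hε2
          linarith
  · exact le_rfl


/-! ### Finding a small obstruction in a random sample -/

section

variable {V : Type} [Fintype V] [Nonempty V] {H : SimpleGraph V} {ρ : ℝ}

/-- The two tuples share a coordinate, so their union is connected. It has one vertex for each of
the k positions and one more for each position where `a` and `b` differ; all but one of these
vertices cost a factor ρ. -/
theorem pr_orderly_and_orderly_le (hρ : 0 ≤ ρ) (hdeg : ∀ v, pr (fun x => H.Adj v x) ≤ ρ)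
    {k M : ℕ} (a b : Fin k → Fin M) (hab : ∃ i, a i = b i) :
    pr (fun S : Fin k × Fin M → V => Orderly H (fun i => S (i, a i)) ∧
      Orderly H (fun i => S (i, b i))) ≤
      ((2 * k : ℕ) ^ 2 : ℝ) ^ (2 * k) * (ρ ^ (k - 1) * ∏ i, if b i = a i then 1 else ρ) := by
  classical
  obtain ⟨i₀, hi₀⟩ := hab
  have hk : 1 ≤ k := i₀.pos
  set D : Finset (Fin k) := Finset.univ.filter fun i => b i ≠ a i with hD
  set A : Finset (Fin k × Fin M) := Finset.univ.image fun i => (i, a i) with hA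
  set B : Finset (Fin k × Fin M) := D.image fun i => (i, b i) with hB
  have hcard : (A ∪ B).card = k + D.card := by
    rw [Finset.card_union_of_disjoint, Finset.card_image_of_injective,
      Finset.card_image_of_injective, Finset.card_univ, Fintype.card_fin]
    · exact fun i j h => (Prod.ext_iff.1 h).1
    · exact fun i j h => (Prod.ext_iff.1 h).1
    · rw [Finset.disjoint_left]
      rintro x hx hx'
      obtain ⟨i, -, rfl⟩ := Finset.mem_image.1 hx
      obtain ⟨j, hj, hji⟩ := Finset.mem_image.1 hx'
      obtain ⟨rfl, h⟩ := Prod.ext_iff.1 hji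
      exact (Finset.mem_filter.1 hj).2 h
  have hDk : D.card ≤ k := (Finset.card_le_univ D).trans_eq (Fintype.card_fin k)
  have hU : ((A ∪ B : Finset _) : Set (Fin k × Fin M)) =
      Set.range (fun i => (i, a i)) ∪ Set.range fun i => (i, b i) := by
    ext x
    simp only [hA, hB, hD, Finset.coe_union, Finset.coe_image, Finset.coe_univ, Set.image_univ,
      Set.mem_union, Set.mem_range, Finset.coe_filter, Set.mem_image, Set.mem_ofPred_eq,
      Finset.mem_univ, true_and]
    constructor
    · rintro (h | ⟨i, -, h⟩)
      · exact Or.inl h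
      · exact Or.inr ⟨i, h⟩
    · rintro (h | ⟨i, h⟩)
      · exact Or.inl h
      · by_cases hi : b i = a i
        · exact Or.inl ⟨i, by rw [← h, hi]⟩
        · exact Or.inr ⟨i, hi, h⟩
  let I : Type := {x // x ∈ A ∪ B}
  have hIc : Fintype.card I = k + D.card := (Fintype.card_coe _).trans hcard
  have h1 : pr (fun S : Fin k × Fin M → V => Orderly H (fun i => S (i, a i)) ∧
      Orderly H (fun i => S (i, b i))) ≤
      pr (fun S : Fin k × Fin M → V =>
        LinkedOn (H.comap (S ∘ (Subtype.val : I → _))) Set.univ) := by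
    refine pr_mono fun S hS => ?_
    have ha : Orderly (H.comap S) (fun i => (i, a i)) := hS.1
    have hb : Orderly (H.comap S) (fun i => (i, b i)) := hS.2
    have hl : LinkedOn (H.comap S) ((A ∪ B : Finset _) : Set (Fin k × Fin M)) := by
      rw [hU]
      exact ha.linkedOn.union hb.linkedOn
        ⟨(i₀, a i₀), ⟨i₀, rfl⟩, ⟨i₀, by rw [hi₀]⟩⟩
    exact hl.comap_val
  refine h1.trans ?_
  rw [pr_comp_injective (V := V) Subtype.val_injective
    fun T : I → V => LinkedOn (H.comap T) Set.univ]
  have hne : (A ∪ B).Nonempty := Finset.card_pos.1 (by omega)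
  set x₀ : I := ⟨hne.choose, hne.choose_spec⟩
  have h2 := pr_linkedOn_le (I := I) hρ hdeg Finset.univ (k - 1 + D.card) {x₀} (fun _ => True)
    (Finset.subset_univ _) (Finset.singleton_nonempty _)
    (by
      rw [Finset.card_sdiff_of_subset (Finset.subset_univ _), Finset.card_univ, hIc,
        Finset.card_singleton]
      omega) (fun _ _ _ h => h)
  rw [pr_eq_one fun _ => trivial, mul_one, Finset.coe_univ] at h2
  simp only [true_and] at h2
  refine h2.trans ?_
  rw [hIc, mul_pow]
  have h3 : (∏ i, if b i = a i then (1 : ℝ) else ρ) = ρ ^ D.card := by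
    rw [Finset.prod_ite, Finset.prod_const_one, one_mul, Finset.prod_const]
  rw [h3, ← pow_add]
  refine mul_le_mul_of_nonneg_right ?_ (by positivity)
  have h4 : ((k + D.card : ℕ) : ℝ) ≤ (2 * k : ℕ) := by exact_mod_cast (by omega)
  have h5 : (1 : ℝ) ≤ ((2 * k : ℕ) : ℝ) ^ 2 := by
    refine one_le_pow₀ ?_
    exact_mod_cast (by omega : 1 ≤ 2 * k)
  calc (((k + D.card : ℕ) : ℝ) ^ 2) ^ (k - 1 + D.card)
      ≤ (((2 * k : ℕ) : ℝ) ^ 2) ^ (k - 1 + D.card) := by gcongr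
    _ ≤ _ := pow_le_pow_right₀ h5 (by omega)

/-- The sum factorizes over positions, and each factor is at most 1 + Mρ ≤ 2. -/
theorem sum_prod_agree_le {k M : ℕ} (hρ : 0 ≤ ρ) (hM : M * ρ ≤ 1) (a : Fin k → Fin M) :
    ∑ b : Fin k → Fin M, ∏ i, (if b i = a i then (1 : ℝ) else ρ) ≤ 2 ^ k := by
  classical
  rw [← Fintype.prod_sum fun i x => if x = a i then (1 : ℝ) else ρ]
  calc ∏ i, ∑ x, (if x = a i then (1 : ℝ) else ρ) ≤ ∏ i : Fin k, (2 : ℝ) := by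
        refine Finset.prod_le_prod (fun i _ => Finset.sum_nonneg fun x _ => ?_) fun i _ => ?_
        · split_ifs <;> linarith
        · calc ∑ x, (if x = a i then (1 : ℝ) else ρ)
              ≤ ∑ x, ((if x = a i then (1 : ℝ) else 0) + ρ) := by
                refine Finset.sum_le_sum fun x _ => ?_
                split_ifs <;> linarith
            _ = 1 + M * ρ := by
                rw [Finset.sum_add_distrib]
                simp
            _ ≤ 2 := by linarith
    _ = 2 ^ k := by simp

/-- A second moment bound for the number of tuples with a property that forces connectivity. -/
theorem pr_not_exists_transversal_le (hρ : 0 ≤ ρ) (hdeg : ∀ v, pr (fun x => H.Adj v x) ≤ ρ)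
    {k M : ℕ} (hM : M * ρ ≤ 1) (hM0 : 0 < M) (W : (Fin k → V) → Prop)
    (hW : ∀ v, W v → Orderly H v) (hw : 0 < pr W) :
    pr (fun S : Fin k × Fin M → V => ¬ ∃ a : Fin k → Fin M, W fun i => S (i, a i)) ≤
      ((2 * k : ℕ) ^ 2 : ℝ) ^ (2 * k) * 2 ^ k * ρ ^ (k - 1) / (M ^ k * pr W ^ 2) := by
  classical
  have hM0' : (0 : ℝ) < M := by exact_mod_cast hM0
  set X : (Fin k × Fin M → V) → ℝ := fun S => ∑ a : Fin k → Fin M, ind (W fun i => S (i, a i))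
    with hX
  have hinj : ∀ a : Fin k → Fin M, Function.Injective fun i => (i, a i) :=
    fun a i j h => (Prod.ext_iff.1 h).1
  have hEX : avg X = M ^ k * pr W := by
    rw [hX, avg_sum]
    have : ∀ a : Fin k → Fin M, avg (fun S : Fin k × Fin M → V => ind (W fun i => S (i, a i))) =
        pr W := fun a => pr_comp_injective (V := V) (hinj a) W
    simp only [this]
    simp
  -- Transversals that share no vertex are independent and contribute the square of the mean; only
  -- those that share a vertex contribute to the variance.
  have hE2 : avg (fun S => X S ^ 2) ≤ (M ^ k * pr W) ^ 2 +
      M ^ k * (((2 * k : ℕ) ^ 2 : ℝ) ^ (2 * k) * ρ ^ (k - 1) * 2 ^ k) := by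
    have h1 : (fun S => X S ^ 2) = fun S => ∑ a : Fin k → Fin M, ∑ b : Fin k → Fin M,
        ind ((W fun i => S (i, a i)) ∧ W fun i => S (i, b i)) := by
      funext S
      rw [sq, hX, Finset.sum_mul_sum]
      simp only [ind_and]
    rw [h1, avg_sum]
    simp only [avg_sum]
    have h2 : ∀ a b : Fin k → Fin M, avg (fun S : Fin k × Fin M → V =>
        ind ((W fun i => S (i, a i)) ∧ W fun i => S (i, b i))) ≤ pr W ^ 2 +
        ((2 * k : ℕ) ^ 2 : ℝ) ^ (2 * k) * (ρ ^ (k - 1) * ∏ i, if b i = a i then 1 else ρ) := by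
      intro a b
      have hpos : 0 ≤ ((2 * k : ℕ) ^ 2 : ℝ) ^ (2 * k) *
          (ρ ^ (k - 1) * ∏ i, if b i = a i then 1 else ρ) := by
        refine mul_nonneg (by positivity) (mul_nonneg (by positivity)
          (Finset.prod_nonneg fun i _ => ?_))
        split_ifs <;> linarith
      by_cases hab : ∃ i, a i = b i
      · have := pr_orderly_and_orderly_le hρ hdeg a b hab
        have h3 : avg (fun S : Fin k × Fin M → V =>
            ind ((W fun i => S (i, a i)) ∧ W fun i => S (i, b i))) ≤ _ :=
          (pr_mono fun S hS => ⟨hW _ hS.1, hW _ hS.2⟩).trans this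
        have := sq_nonneg (pr W)
        linarith
      · push Not at hab
        have h3 := avg_mul_of_disjoint (V := V) (hinj a) (hinj b)
          (fun i j h => by
            obtain ⟨rfl, h⟩ := Prod.ext_iff.1 h
            exact hab _ h) (fun v => ind (W v)) fun v => ind (W v)
        simp only [ind_and]
        refine le_trans (le_of_eq h3) ?_
        rw [← pr, ← sq]
        linarith
    calc _ ≤ ∑ a : Fin k → Fin M, ∑ b : Fin k → Fin M, (pr W ^ 2 +
        ((2 * k : ℕ) ^ 2 : ℝ) ^ (2 * k) * (ρ ^ (k - 1) * ∏ i, if b i = a i then 1 else ρ)) :=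
          Finset.sum_le_sum fun a _ => Finset.sum_le_sum fun b _ => h2 a b
      _ ≤ ∑ a : Fin k → Fin M, (M ^ k * pr W ^ 2 +
          ((2 * k : ℕ) ^ 2 : ℝ) ^ (2 * k) * (ρ ^ (k - 1) * 2 ^ k)) := by
          refine Finset.sum_le_sum fun a _ => ?_
          rw [Finset.sum_add_distrib, ← Finset.mul_sum, ← Finset.mul_sum]
          have := sum_prod_agree_le (k := k) hρ hM a
          gcongr
          simp
      _ = _ := by
          rw [Finset.sum_const]
          simp
          ring
  have h0 : 0 < avg X := by rw [hEX]; positivity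
  refine le_trans (pr_mono fun S hS => ?_) ((pr_eq_zero_le X h0).trans ?_)
  · refine Finset.sum_eq_zero fun a _ => ind_of_not fun h => hS ⟨a, h⟩
  · rw [hEX, div_le_div_iff₀ (by positivity) (by positivity)]
    rw [← sub_le_iff_le_add'] at hE2
    calc (avg (fun S => X S ^ 2) - (M ^ k * pr W) ^ 2) * (M ^ k * pr W ^ 2)
        ≤ (M ^ k * (((2 * k : ℕ) ^ 2 : ℝ) ^ (2 * k) * ρ ^ (k - 1) * 2 ^ k)) *
          (M ^ k * pr W ^ 2) := by gcongr
      _ = _ := by ring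

end


/-- Every entry of an orderly tuple of length at least 2 has a neighbour in the restricted graph and
so lies in `L`. The obstruction is therefore an induced subgraph of `G` itself, visible in any
sample containing it. -/
theorem not_isBlowUpCollection_of_obstruction {V W U : Type} {C : SimpleGraph W}
    {G : SimpleGraph V} {L : Set V} {k : ℕ} (hk : 2 ≤ k) {v : Fin k → V}
    (h : Orderly (restrict G L) v ∧ ¬ IsBlowUp C ((restrict G L).comap v)) {S : U → V}
    {a : Fin k → U} (ha : S ∘ a = v) : ¬ IsBlowUpCollection C (G.comap S) := by
  subst ha
  intro hc
  have hm := h.1.mem_of_restrict hk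
  rw [comap_restrict hm] at h
  have ho : Orderly (G.comap S) a := fun j hj => by
    obtain ⟨i, hi, ha⟩ := h.1 j hj
    exact ⟨i, hi, ha.1⟩
  exact h.2 (hc.isBlowUp_of_orderly (by omega) ho)

theorem nonAdaptive_comap {N : ℕ} {U α : Type} [Fintype U] (S : U → Fin N)
    (F : SimpleGraph U → α) :
    NonAdaptive (Fintype.card U * Fintype.card U) fun G => F (G.comap S) := by
  classical
  refine ⟨(Finset.univ : Finset (U × U)).toList.map fun p => (S p.1, S p.2), ?_, fun G G' h => ?_⟩
  · rw [List.length_map, Finset.length_toList, Finset.card_univ, Fintype.card_prod]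
  · have : G.comap S = G'.comap S := by
      ext a b
      exact h (S a, S b) (List.mem_map.2 ⟨(a, b), Finset.mem_toList.2 (Finset.mem_univ _), rfl⟩)
    simp only [this]

theorem pr_restrict_adj_le {N d : ℕ} (G : SimpleGraph (Fin N)) (v : Fin N) :
    pr (fun x => (restrict G {v | deg G v ≤ 4 * d}).Adj v x) ≤ 4 * (d / N : ℝ) := by
  rw [pr_adj, Fintype.card_fin, ← mul_div_assoc]
  gcongr
  by_cases hv : deg G v ≤ 4 * d
  · exact_mod_cast (deg_restrict_le G _ v).trans hv
  · have : deg (restrict G {v | deg G v ≤ 4 * d}) v = 0 := by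
      rw [deg, Finset.card_eq_zero, Finset.eq_empty_iff_forall_notMem]
      intro x hx
      exact hv (mem_nbhd.1 hx).2.1
    rw [this]
    push_cast
    positivity

-- Query all pairs among k groups of M random vertices and reject if the sample is not a blow-up
-- collection. The property is hereditary, so rejections are never false; the sample contains an
-- obstruction with probability 3/4 by the second moment bound.
open Classical in
theorem hasTest_obstruction_nonAdaptive {N d k M t : ℕ} (hN : 0 < N) (hd : 1 ≤ d) (hk : 2 ≤ k)
    (hM0 : 0 < M) (hM : M * (4 * (d / N : ℝ)) ≤ 1) {δ : ℝ} (hδ : 0 < δ)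
    (hA : 4 * (((2 * k : ℕ) ^ 2 : ℝ) ^ (2 * k) * 2 ^ k) ≤
      δ ^ 2 * (M ^ k * (4 * (d / N : ℝ)) ^ (k - 1))) :
    HasTest (N := N) (NonAdaptive ((k * M) * (k * M)))
      (fun G => IsBlowUpCollection (SimpleGraph.cycleGraph t) G)
      (fun G => ¬ pr (fun v : Fin k → Fin N =>
        Orderly (restrict G {v | deg G v ≤ 4 * d}) v ∧ ¬ IsBlowUp (SimpleGraph.cycleGraph t)
          ((restrict G {v | deg G v ≤ 4 * d}).comap v)) ≤ δ * (4 * (d / N)) ^ (k - 1))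
      0 (1 / 4) := by
  have : Nonempty (Fin N) := ⟨⟨0, hN⟩⟩
  have hN0 : (0 : ℝ) < N := by exact_mod_cast hN
  have hd0 : (0 : ℝ) < d := by exact_mod_cast hd
  have hM0' : (0 : ℝ) < M := by exact_mod_cast hM0
  refine ⟨Fin k × Fin M → Fin N, inferInstance, inferInstance,
    fun S G => decide (IsBlowUpCollection (SimpleGraph.cycleGraph t) (G.comap S)),
    fun S => ?_, fun G hG => ?_, fun G hG => ?_⟩
  · have := nonAdaptive_comap S fun H =>
      decide (IsBlowUpCollection (SimpleGraph.cycleGraph t) H)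
    simpa using this
  · rw [pr_eq_zero fun S hS => ?_]
    exact of_decide_eq_false hS (hG.comap S)
  · set W : (Fin k → Fin N) → Prop := fun v =>
      Orderly (restrict G {v | deg G v ≤ 4 * d}) v ∧ ¬ IsBlowUp (SimpleGraph.cycleGraph t)
          ((restrict G {v | deg G v ≤ 4 * d}).comap v) with hW
    set ρ : ℝ := 4 * (d / N : ℝ) with hρ
    have hρ0 : 0 < ρ := by positivity
    have hw : δ * ρ ^ (k - 1) < pr W := not_le.1 hG
    have hw0 : 0 < pr W := lt_trans (by positivity) hw
    have h1 := pr_not_exists_transversal_le hρ0.le (pr_restrict_adj_le (d := d) G) hM hM0 W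
      (fun v hv => hv.1) hw0
    refine (pr_mono fun S hS => ?_).trans (h1.trans ?_)
    · rintro ⟨a, ha⟩
      exact not_isBlowUpCollection_of_obstruction hk ha
        (a := fun i => (i, a i)) rfl (of_decide_eq_true hS)
    · rw [div_le_div_iff₀ (by positivity) (by norm_num), one_mul]
      calc ((2 * k : ℕ) ^ 2 : ℝ) ^ (2 * k) * 2 ^ k * ρ ^ (k - 1) * 4
          = 4 * (((2 * k : ℕ) ^ 2 : ℝ) ^ (2 * k) * 2 ^ k) * ρ ^ (k - 1) := by ring
        _ ≤ δ ^ 2 * (M ^ k * ρ ^ (k - 1)) * ρ ^ (k - 1) := by gcongr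
        _ = M ^ k * (δ * ρ ^ (k - 1)) ^ 2 := by ring
        _ ≤ M ^ k * pr W ^ 2 := by gcongr

/-- With ρ of order ε the condition that M^k ρ^(k-1) be large is strongest at k = t. It demands M of
order ε^(-(1-1/t)), and querying all pairs of the sample squares this. -/
theorem eventually_hasTest_obstructions_nonAdaptive {t : ℕ} (ht : 8 ≤ t) {c δ : ℝ} (hc : 1 ≤ c)
    (hδ : 0 < δ) :
    ∃ K : ℝ, 0 < K ∧ ∀ᶠ ε in 𝓝[>] (0 : ℝ), ∃ q : ℕ,
      (q : ℝ) ≤ K * ε⁻¹ ^ (2 - 2 / (t : ℝ)) ∧ ∀ N d : ℕ, 0 < N → d = ⌊c * ε * N⌋₊ → 1 ≤ d →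
        HasTest (N := N) (NonAdaptive q)
          (fun G => IsBlowUpCollection (SimpleGraph.cycleGraph t) G)
          (fun G => ¬ ∀ k, 2 ≤ k → k ≤ t → pr (fun v : Fin k → Fin N =>
            Orderly (restrict G {v | deg G v ≤ 4 * d}) v ∧ ¬ IsBlowUp (SimpleGraph.cycleGraph t)
              ((restrict G {v | deg G v ≤ 4 * d}).comap v)) ≤ δ * (4 * (d / N)) ^ (k - 1))
          0 (1 / 4) := by
  have ht0 : (0 : ℝ) < t := by exact_mod_cast (by omega : 0 < t)
  set A : ℝ := 1 + 4 * (((2 * t : ℕ) ^ 2 : ℝ) ^ (2 * t) * 2 ^ t) / δ ^ 2 with hA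
  have hA1 : 1 ≤ A := by
    rw [hA]
    linarith [show 0 ≤ 4 * (((2 * t : ℕ) ^ 2 : ℝ) ^ (2 * t) * 2 ^ t) / δ ^ 2 by positivity]
  have hAδ : 4 * (((2 * t : ℕ) ^ 2 : ℝ) ^ (2 * t) * 2 ^ t) ≤ δ ^ 2 * A := by
    rw [hA, mul_add, mul_div_cancel₀ _ (by positivity)]
    linarith [sq_nonneg δ]
  refine ⟨t * (t * (2 * A)) ^ 2, by positivity, ?_⟩
  have hev : ∀ᶠ ε in 𝓝[>] (0 : ℝ), 0 < ε ∧ ε < 1 ∧ ε ^ (1 / (t : ℝ)) * (8 * A * c) < 1 := by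
    have h1 : ∀ᶠ ε in 𝓝[>] (0 : ℝ), ε ∈ Set.Ioo (0 : ℝ) 1 := Ioo_mem_nhdsGT one_pos
    have h2 : Tendsto (fun ε : ℝ => ε ^ (1 / (t : ℝ)) * (8 * A * c)) (𝓝[>] 0)
        (𝓝 ((0 : ℝ) ^ (1 / (t : ℝ)) * (8 * A * c))) :=
      (((Real.continuous_rpow_const (by positivity)).tendsto 0).mul_const _).mono_left
        nhdsWithin_le_nhds
    rw [Real.zero_rpow (by positivity), zero_mul] at h2
    filter_upwards [h1, h2.eventually_lt_const one_pos] with ε h1 h2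
    exact ⟨h1.1, h1.2, h2⟩
  filter_upwards [hev] with ε ⟨hε, hε1, hεA⟩
  set x : ℝ := ε⁻¹ ^ (1 - 1 / (t : ℝ)) with hx
  have hinv1 : 1 ≤ ε⁻¹ := (one_le_inv₀ hε).2 hε1.le
  have hexp : (0 : ℝ) ≤ 1 - 1 / t := by
    rw [sub_nonneg, div_le_one ht0]
    exact_mod_cast (by omega : 1 ≤ t)
  have hx1 : 1 ≤ x := Real.one_le_rpow hinv1 hexp
  have hx2 : x ^ 2 = ε⁻¹ ^ (2 - 2 / (t : ℝ)) := by
    rw [hx, ← Real.rpow_natCast, ← Real.rpow_mul (by positivity)]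
    congr 1
    push_cast
    ring
  have hxε : x * ε = ε ^ (1 / (t : ℝ)) := by
    rw [hx, Real.inv_rpow hε.le, ← Real.rpow_neg hε.le]
    nth_rewrite 2 [← Real.rpow_one ε]
    rw [← Real.rpow_add hε]
    congr 1
    ring
  set M : ℕ := ⌈A * x⌉₊ with hM
  have hAx : 1 ≤ A * x := one_le_mul_of_one_le_of_one_le hA1 hx1
  have hM1 : A * x ≤ M := Nat.le_ceil _
  have hM2 : (M : ℝ) ≤ 2 * (A * x) := by
    have := (Nat.ceil_lt_add_one (zero_le_one.trans hAx)).le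
    linarith
  have hM0 : 0 < M := Nat.ceil_pos.2 (by linarith)
  refine ⟨t * ((t * M) * (t * M)), ?_, fun N d hN hd hd1 => ?_⟩
  · rw [← hx2]
    push_cast
    calc (t : ℝ) * (t * M * (t * M)) ≤ t * (t * (2 * (A * x)) * (t * (2 * (A * x)))) := by gcongr
      _ = _ := by ring
  have hN0 : (0 : ℝ) < N := by exact_mod_cast hN
  have hd0 : (0 : ℝ) < d := by exact_mod_cast hd1
  have hdle : (d : ℝ) ≤ c * ε * N := by rw [hd]; exact Nat.floor_le (by positivity)
  have hdge : c * ε * N < 2 * d := by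
    have h1 : c * ε * N < d + 1 := by rw [hd]; exact Nat.lt_floor_add_one _
    have h2 : (1 : ℝ) ≤ d := by exact_mod_cast hd1
    linarith
  have hρ1 : ε ≤ 4 * (d / N : ℝ) := by
    rw [← mul_div_assoc, le_div_iff₀ hN0]
    have : ε * N ≤ c * (ε * N) := le_mul_of_one_le_left (by positivity) hc
    linarith
  have hρ2 : 4 * (d / N : ℝ) ≤ 4 * (c * ε) := by
    gcongr
    rw [div_le_iff₀ hN0]
    exact hdle
  have hMρ : M * (4 * (d / N : ℝ)) ≤ 1 := by
    calc M * (4 * (d / N : ℝ)) ≤ 2 * (A * x) * (4 * (c * ε)) := by gcongr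
      _ = x * ε * (8 * A * c) := by ring
      _ ≤ 1 := by rw [hxε]; exact hεA.le
  have htest := HasTest.levels (N := N) (𝒟 := NonAdaptive)
    (Acc := fun G => IsBlowUpCollection (SimpleGraph.cycleGraph t) G)
    (Rej := fun i G => ¬ pr (fun v : Fin (i + 2) → Fin N =>
        Orderly (restrict G {v | deg G v ≤ 4 * d}) v ∧ ¬ IsBlowUp (SimpleGraph.cycleGraph t)
          ((restrict G {v | deg G v ≤ 4 * d}).comap v)) ≤ δ * (4 * (d / N)) ^ (i + 2 - 1))
    (q := fun i => ((i + 2) * M) * ((i + 2) * M)) (a := fun _ => 0) (b := 1 / 4) nonAdaptive_true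
    (fun q q' F F' h h' => h.both h') (t - 1) (fun i hi => by
      refine hasTest_obstruction_nonAdaptive hN hd1 (by omega) hM0 hMρ hδ ?_
      refine le_trans ?_ (hAδ.trans ?_)
      · have h1 : ((2 * (i + 2) : ℕ) : ℝ) ≤ (2 * t : ℕ) := by exact_mod_cast (by omega)
        have h2 : (1 : ℝ) ≤ ((2 * t : ℕ) : ℝ) ^ 2 := by
          refine one_le_pow₀ ?_
          exact_mod_cast (by omega : 1 ≤ 2 * t)
        have h3 : (((2 * (i + 2) : ℕ) : ℝ) ^ 2) ^ (2 * (i + 2)) ≤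
            (((2 * t : ℕ) : ℝ) ^ 2) ^ (2 * t) :=
          (pow_le_pow_left₀ (by positivity) (by gcongr) _).trans
            (pow_le_pow_right₀ h2 (by omega))
        have h4 : (2 : ℝ) ^ (i + 2) ≤ 2 ^ t := pow_le_pow_right₀ one_le_two (by omega)
        gcongr
      · gcongr
        -- With k = i + 2 this product is ε^(k/t - 1), which is at least 1 exactly because k ≤ t.
        have hxt : 1 ≤ x ^ (i + 2) * ε ^ (i + 1) := by
          rw [hx, Real.inv_rpow hε.le, ← Real.rpow_neg hε.le, ← Real.rpow_natCast,
            ← Real.rpow_natCast, ← Real.rpow_mul hε.le, ← Real.rpow_add hε]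
          refine Real.one_le_rpow_of_pos_of_le_one_of_nonpos hε hε1.le ?_
          push_cast
          have hi' : (i : ℝ) + 2 ≤ t := by exact_mod_cast (by omega : i + 2 ≤ t)
          have : ((i : ℝ) + 2) / t ≤ 1 := (div_le_one ht0).2 hi'
          calc -(1 - 1 / (t : ℝ)) * (i + 2) + (i + 1) = (i + 2) / t - 1 := by ring
            _ ≤ 0 := by linarith
        calc A ≤ A * (x ^ (i + 2) * ε ^ (i + 1)) := le_mul_of_one_le_right (by linarith) hxt
          _ ≤ A ^ (i + 2) * (x ^ (i + 2) * ε ^ (i + 1)) := by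
            gcongr
            exact le_self_pow₀ hA1 (by omega)
          _ = (A * x) ^ (i + 2) * ε ^ (i + 1) := by rw [mul_pow, mul_assoc]
          _ ≤ M ^ (i + 2) * (4 * (d / N : ℝ)) ^ (i + 2 - 1) := by
            rw [show i + 2 - 1 = i + 1 by omega]
            gcongr)
  refine htest.mono ?_ ?_ ?_ le_rfl
  · intro F hF
    refine hF.mono ?_
    calc ∑ i ∈ Finset.range (t - 1), (i + 2) * M * ((i + 2) * M)
        ≤ ∑ i ∈ Finset.range (t - 1), t * M * (t * M) := by
          refine Finset.sum_le_sum fun i hi => ?_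
          have : i + 2 ≤ t := by have := Finset.mem_range.1 hi; omega
          gcongr
      _ = (t - 1) * (t * M * (t * M)) := by rw [Finset.sum_const, Finset.card_range, smul_eq_mul]
      _ ≤ _ := Nat.mul_le_mul_right _ (Nat.sub_le _ _)
  · intro G hG
    push Not at hG
    obtain ⟨k, hk, hkt, hG⟩ := hG
    obtain ⟨i, rfl⟩ : ∃ i, k = i + 2 := ⟨k - 2, by omega⟩
    exact ⟨i, by omega, not_le.2 hG⟩
  · simp


/-! ### Growing an obstruction by adaptive queries -/

section

variable {N : ℕ}

open Classical in
theorem adaptive_find (u : Fin N) (l : List (Fin N)) :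
    Adaptive l.length fun G : SimpleGraph (Fin N) => l.find? fun x => decide (G.Adj u x) := by
  induction l with
  | nil => exact Adaptive.const 0 none
  | cons x l ih =>
    have := Adaptive.query u x (Adaptive.const l.length (some x)) ih
    convert this using 1
    · exact List.length_cons
    · funext G
      by_cases h : G.Adj u x <;> simp [h]

open Classical in
/-- The first neighbour of `u` among `s` random vertices is a given neighbour with probability at
least `s / (2 N)`. -/
theorem le_pr_find_eq {G : SimpleGraph (Fin N)} {u x : Fin N} (hux : G.Adj u x) {s : ℕ}
    (hs : s * (deg G u : ℝ) ≤ N) :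
    (s : ℝ) / (2 * N) ≤ pr fun y : Fin s → Fin N =>
      (List.ofFn y).find? (fun z => decide (G.Adj u z)) = some x := by
  have hN : (0 : ℝ) < N := by exact_mod_cast u.pos
  induction s with
  | zero => simpa using pr_nonneg _
  | succ s ih =>
    push_cast at hs
    have hs' : s * (deg G u : ℝ) ≤ N := by
      have : (0 : ℝ) ≤ deg G u := by positivity
      linarith
    have ih := ih hs'
    set f := pr fun y : Fin s → Fin N =>
      (List.ofFn y).find? (fun z => decide (G.Adj u z)) = some x with hf
    rw [pr, avg_finCons]
    -- Condition on the first candidate `z`: it is `x`, or it is another neighbour and the search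
    -- fails, or it is no neighbour and the search continues. This is the recursion f(s+1) = 1/N +
    -- (1 - deg/N) f(s).
    have h1 : ∀ z : Fin N, (avg fun v : Fin s → Fin N =>
        ind ((List.ofFn (Fin.cons z v : Fin (s + 1) → Fin N)).find?
          (fun z => decide (G.Adj u z)) = some x)) = ind (z = x) + (1 - ind (G.Adj u z)) * f := by
      intro z
      simp only [List.ofFn_cons, List.find?_cons]
      by_cases hz : G.Adj u z
      · rw [ind_of hz]
        simp only [hz, decide_true, Option.some.injEq]
        have : Nonempty (Fin s → Fin N) := ⟨fun _ => u⟩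
        rw [avg_const]
        ring
      · have hzx : z ≠ x := by rintro rfl; exact hz hux
        rw [ind_of_not hz, ind_of_not hzx, sub_zero, one_mul, zero_add, hf]
        simp only [hz, decide_false]
        rfl
    simp only [h1]
    have : Nonempty (Fin N) := ⟨u⟩
    rw [avg_add, avg_mul_right, avg_sub, avg_const]
    have h2 : avg (fun z => ind (z = x)) = 1 / N := by
      have := pr_mem ({x} : Finset (Fin N))
      simpa [pr] using this
    have h3 : avg (fun z => ind (G.Adj u z)) = (deg G u : ℝ) / N := by
      have := pr_adj G u
      rwa [Fintype.card_fin] at this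
    rw [h2, h3]
    have h4 : (deg G u : ℝ) / N ≤ 1 := by
      rw [← h3]
      exact pr_le_one _
    have h5 : (1 - (deg G u : ℝ) / N) * (s / (2 * N)) ≤ (1 - (deg G u : ℝ) / N) * f :=
      mul_le_mul_of_nonneg_left ih (by linarith)
    refine le_trans ?_ (add_le_add le_rfl h5)
    rw [← sub_nonneg]
    have h6 : 1 / (N : ℝ) + (1 - deg G u / N) * (s / (2 * N)) - ((s + 1 : ℕ) : ℝ) / (2 * N) =
        (N - s * deg G u) / (2 * N * N) := by
      push_cast
      field_simp
      ring
    rw [h6]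
    exact div_nonneg (by linarith) (by positivity)

/-- A random connected tuple of vertices, grown by adaptive queries, takes every value with a
probability that is not much smaller than under the uniform distribution on connected tuples. -/
theorem exists_adaptive_growth (hN : 0 < N) (s d t : ℕ) (hs : (s * (4 * d) : ℝ) ≤ N) :
    ∀ n : ℕ, n < t → ∃ (Ω : Type) (_ : Fintype Ω) (_ : Nonempty Ω)
      (F : Ω → SimpleGraph (Fin N) → Fin (n + 1) → Fin N), (∀ ω, Adaptive (n * s) (F ω)) ∧
      ∀ (G : SimpleGraph (Fin N)) (w : Fin (n + 1) → Fin N),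
        Orderly (restrict G {v | deg G v ≤ 4 * d}) w →
        1 / N * ((s : ℝ) / (2 * N * t)) ^ n ≤ pr fun ω => F ω G = w := by
  classical
  have hN0 : (0 : ℝ) < N := by exact_mod_cast hN
  have : Nonempty (Fin N) := ⟨⟨0, hN⟩⟩
  intro n
  induction n with
  | zero =>
    intro _
    refine ⟨Fin N, inferInstance, inferInstance, fun x _ _ => x,
      fun x => Adaptive.const _ _, fun G w _ => ?_⟩
    have h := pr_mem ({w 0} : Finset (Fin N))
    have h2 : pr (fun x : Fin N => (fun _ : Fin (0 + 1) => x) = w) =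
        pr (fun x => x ∈ ({w 0} : Finset (Fin N))) := by
      refine pr_congr fun x => ?_
      rw [Finset.mem_singleton]
      refine ⟨fun h => by rw [← h], fun h => ?_⟩
      funext i
      rw [h, Fin.fin_one_eq_zero i]
    rw [h2, h]
    simp
  | succ n ih =>
    intro hnt
    obtain ⟨Ω, i1, i2, F, hF, hp⟩ := ih (by omega)
    -- Pick a random earlier position and s random candidates, and append the first candidate
    -- adjacent to the vertex there. The default vertex in `getD` is arbitrary, since only
    -- successful searches are counted.
    refine ⟨Ω × (Fin (n + 1) × (Fin s → Fin N)), inferInstance, inferInstance,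
      fun ω G => Fin.snoc (α := fun _ => Fin N) (F ω.1 G) (((List.ofFn ω.2.2).find?
        fun x => decide (G.Adj (F ω.1 G ω.2.1) x)).getD ⟨0, hN⟩), fun ω => ?_, fun G w hw => ?_⟩
    · have := (hF ω.1).bind (r := s) (K := fun v G => Fin.snoc (α := fun _ => Fin N) v
        (((List.ofFn ω.2.2).find? fun x => decide (G.Adj (v ω.2.1) x)).getD ⟨0, hN⟩))
        fun v => by
          have h := (adaptive_find (v ω.2.1) (List.ofFn ω.2.2)).map fun o =>
            Fin.snoc (α := fun _ => Fin N) v (o.getD ⟨0, hN⟩)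
          rwa [List.length_ofFn] at h
      rw [Nat.succ_mul]
      exact this
    · obtain ⟨i, hi, ha⟩ := hw (Fin.last _) (Nat.succ_pos n)
      have hinit : Orderly (restrict G {v | deg G v ≤ 4 * d}) (Fin.init w) := fun j hj => by
        obtain ⟨l, hl, ha⟩ := hw j.castSucc hj
        have hl' : l.val < n + 1 := lt_trans (Fin.lt_def.1 hl) j.2
        exact ⟨⟨l, hl'⟩, hl, ha⟩
      set p : Fin (n + 1) := ⟨i, hi⟩ with hpdef
      have hwp : Fin.init w p = w i := rfl
      have hdegi : deg G (w i) ≤ 4 * d := ha.2.1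
      have hfind := le_pr_find_eq (s := s) ha.1 (by
        refine le_trans ?_ hs
        gcongr
        exact_mod_cast hdegi)
      have h1 := hp G _ hinit
      have h2 : pr (fun q : Fin (n + 1) => q = p) = 1 / (n + 1) := by
        have := pr_mem ({p} : Finset (Fin (n + 1)))
        simpa using this
      have key : pr (fun ω => F ω G = Fin.init w) * (pr (fun q : Fin (n + 1) => q = p) *
          pr (fun y : Fin s → Fin N => (List.ofFn y).find?
            (fun z => decide (G.Adj (w i) z)) = some (w (Fin.last _)))) ≤
          pr fun ω : Ω × (Fin (n + 1) × (Fin s → Fin N)) =>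
            Fin.snoc (α := fun _ => Fin N) (F ω.1 G) (((List.ofFn ω.2.2).find?
            fun x => decide (G.Adj (F ω.1 G ω.2.1) x)).getD ⟨0, hN⟩) = w := by
        have e : pr (fun ω => F ω G = Fin.init w) * (pr (fun q : Fin (n + 1) => q = p) *
            pr (fun y : Fin s → Fin N => (List.ofFn y).find?
              (fun z => decide (G.Adj (w i) z)) = some (w (Fin.last _)))) =
            pr fun ω : Ω × (Fin (n + 1) × (Fin s → Fin N)) => F ω.1 G = Fin.init w ∧
              ω.2.1 = p ∧ (List.ofFn ω.2.2).find?
              (fun z => decide (G.Adj (w i) z)) = some (w (Fin.last _)) := by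
          unfold pr
          simp only [ind_and]
          rw [avg_prod]
          simp only [avg_mul_left, avg_mul_right, avg_prod]
        rw [e]
        refine pr_mono fun ω hω => ?_
        obtain ⟨e1, e2, e3⟩ := hω
        rw [e1, e2, hwp, e3]
        exact Fin.snoc_init_self w
      refine le_trans ?_ key
      rw [h2]
      have hnt' : (n : ℝ) + 1 ≤ t := by exact_mod_cast (by omega : n + 1 ≤ t)
      calc 1 / (N : ℝ) * (s / (2 * N * t)) ^ (n + 1)
          = (1 / N * (s / (2 * N * t)) ^ n) * (1 / t * (s / (2 * N))) := by
            rw [pow_succ]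
            field_simp
        _ ≤ _ := by
          gcongr
          exact pr_nonneg _

-- There are N^k · pr W obstructions, and each is grown with probability at least N⁻¹
-- (s/(2Nt))^(k-1). With pr W above δρ^(k-1) the powers of N cancel and δ(sρ/(2t))^(k-1) remains.
open Classical in
theorem hasTest_obstruction_adaptive {d k s t : ℕ} (hN : 0 < N) (hd : 1 ≤ d) (hk : 2 ≤ k)
    (hkt : k ≤ t) (hs : s * (4 * (d / N : ℝ)) ≤ 1) {δ p : ℝ}
    (hp : p ≤ δ * (s * (4 * (d / N : ℝ)) / (2 * t)) ^ (k - 1)) :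
    HasTest (N := N) (Adaptive (t * s + t * t))
      (fun G => IsBlowUpCollection (SimpleGraph.cycleGraph t) G)
      (fun G => ¬ pr (fun v : Fin k → Fin N =>
        Orderly (restrict G {v | deg G v ≤ 4 * d}) v ∧ ¬ IsBlowUp (SimpleGraph.cycleGraph t)
          ((restrict G {v | deg G v ≤ 4 * d}).comap v)) ≤ δ * (4 * (d / N)) ^ (k - 1))
      0 (1 - p) := by
  have hN0 : (0 : ℝ) < N := by exact_mod_cast hN
  have hd0 : (0 : ℝ) < d := by exact_mod_cast hd
  have : Nonempty (Fin N) := ⟨⟨0, hN⟩⟩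
  obtain ⟨n, rfl⟩ : ∃ n, k = n + 1 := ⟨k - 1, by omega⟩
  rw [Nat.add_sub_cancel] at hp ⊢
  obtain ⟨Ω, i1, i2, F, hF, hpr⟩ := exists_adaptive_growth hN s d t (by
    rwa [← mul_div_assoc, ← mul_div_assoc, div_le_one hN0] at hs) n (by omega)
  refine ⟨Ω, i1, i2, fun ω G =>
    decide (IsBlowUpCollection (SimpleGraph.cycleGraph t) (G.comap (F ω G))),
    fun ω => ?_, fun G hG => ?_, fun G hG => ?_⟩
  · have h := (hF ω).bind (r := (n + 1) * (n + 1)) (K := fun v G =>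
      decide (IsBlowUpCollection (SimpleGraph.cycleGraph t) (G.comap v))) fun v => by
        have := (nonAdaptive_comap v fun H =>
          decide (IsBlowUpCollection (SimpleGraph.cycleGraph t) H)).adaptive
        rwa [Fintype.card_fin] at this
    refine h.mono ?_
    have h1 : n * s ≤ t * s := Nat.mul_le_mul_right _ (by omega)
    have h2 : (n + 1) * (n + 1) ≤ t * t := Nat.mul_le_mul hkt hkt
    omega
  · rw [pr_eq_zero fun ω hω => ?_]
    exact of_decide_eq_false hω (hG.comap _)
  · set W : (Fin (n + 1) → Fin N) → Prop := fun v =>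
      Orderly (restrict G {v | deg G v ≤ 4 * d}) v ∧ ¬ IsBlowUp (SimpleGraph.cycleGraph t)
          ((restrict G {v | deg G v ≤ 4 * d}).comap v) with hW
    have hw : δ * (4 * (d / N : ℝ)) ^ n < pr W := not_le.1 hG
    have hsum : (∑ w, ind (W w)) * (1 / N * ((s : ℝ) / (2 * N * t)) ^ n) ≤
        pr fun ω => W (F ω G) := by
      have h1 : (pr fun ω => W (F ω G)) = ∑ w, ind (W w) * pr fun ω => F ω G = w := by
        unfold pr
        simp only [← avg_mul_left, ← avg_sum]
        congr 1
        funext ω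
        rw [Finset.sum_eq_single (F ω G)]
        · rw [ind_of (rfl : F ω G = F ω G), mul_one]
        · intro w _ hw
          rw [ind_of_not (fun h : F ω G = w => hw h.symm), mul_zero]
        · exact fun h => absurd (Finset.mem_univ _) h
      rw [h1, Finset.sum_mul]
      refine Finset.sum_le_sum fun w _ => ?_
      by_cases hw : W w
      · rw [ind_of hw, one_mul, one_mul]
        exact hpr G w hw.1
      · rw [ind_of_not hw, zero_mul, zero_mul]
    rw [sum_eq_card_mul_avg, ← pr, Fintype.card_fun, Fintype.card_fin, Fintype.card_fin] at hsum
    have hrej : (pr fun ω => W (F ω G)) ≤ 1 - pr fun ω =>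
        decide (IsBlowUpCollection (SimpleGraph.cycleGraph t) (G.comap (F ω G))) = true := by
      rw [← pr_not]
      refine pr_mono fun ω hω hacc => ?_
      exact not_isBlowUpCollection_of_obstruction hk hω (a := id) rfl (of_decide_eq_true hacc)
    have hle : p ≤ pr fun ω => W (F ω G) := by
      refine hp.trans (le_trans ?_ hsum)
      have ht0 : (0 : ℝ) < t := by exact_mod_cast (by omega : 0 < t)
      push_cast
      calc δ * (s * (4 * (d / N : ℝ)) / (2 * t)) ^ n
          = (δ * (4 * (d / N : ℝ)) ^ n) * ((s : ℝ) / (2 * t)) ^ n := by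
            rw [mul_assoc, ← mul_pow]
            congr 2
            ring
        _ ≤ pr W * ((s : ℝ) / (2 * t)) ^ n := by gcongr
        _ = (N : ℝ) ^ (n + 1) * pr W * (1 / N * (s / (2 * N * t)) ^ n) := by
            have : (s : ℝ) / (2 * t) = N * (s / (2 * N * t)) := by field_simp
            rw [this, mul_pow]
            field_simp
            ring
    linarith

end

/-- Choosing s of order 1/ε keeps sρ between a positive constant and 1. One growth then succeeds
with constant probability, and a constant number of repetitions suffices. -/
theorem eventually_hasTest_obstructions_adaptive {t : ℕ} (ht : 8 ≤ t) {c δ : ℝ} (hc : 1 ≤ c)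
    (hδ : 0 < δ) :
    ∃ K : ℝ, 0 < K ∧ ∀ᶠ ε in 𝓝[>] (0 : ℝ), ∃ q : ℕ,
      (q : ℝ) ≤ K * ε⁻¹ ∧ ∀ N d : ℕ, 0 < N → d = ⌊c * ε * N⌋₊ → 1 ≤ d →
        HasTest (N := N) (Adaptive q)
          (fun G => IsBlowUpCollection (SimpleGraph.cycleGraph t) G)
          (fun G => ¬ ∀ k, 2 ≤ k → k ≤ t → pr (fun v : Fin k → Fin N =>
            Orderly (restrict G {v | deg G v ≤ 4 * d}) v ∧ ¬ IsBlowUp (SimpleGraph.cycleGraph t)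
              ((restrict G {v | deg G v ≤ 4 * d}).comap v)) ≤ δ * (4 * (d / N)) ^ (k - 1))
          0 (1 / 4) := by
  have ht0 : (0 : ℝ) < t := by exact_mod_cast (by omega : 0 < t)
  have ht1 : (1 : ℝ) ≤ t := by exact_mod_cast (by omega : 1 ≤ t)
  set y : ℝ := 1 / (16 * c * t) with hy
  have hy0 : 0 < y := by positivity
  have hy1 : y ≤ 1 := by
    rw [hy, div_le_one (by positivity)]
    nlinarith
  set p : ℝ := min (δ * y ^ t) (1 / 2) with hp
  have hp0 : 0 < p := lt_min (by positivity) (by norm_num)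
  have hp1 : p ≤ 1 / 2 := min_le_right _ _
  obtain ⟨R, hR⟩ := exists_pow_lt_of_lt_one (show (0 : ℝ) < 1 / 4 by norm_num)
    (show 1 - p < 1 by linarith)
  refine ⟨t * (R * (t + t * t)) + 1, by positivity, ?_⟩
  have hev : ∀ᶠ ε in 𝓝[>] (0 : ℝ), ε ∈ Set.Ioo (0 : ℝ) (1 / (8 * c)) :=
    Ioo_mem_nhdsGT (by positivity)
  filter_upwards [hev] with ε ⟨hε, hε1⟩
  have hε1' : ε * (8 * c) < 1 := by rwa [lt_div_iff₀ (by positivity)] at hε1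
  have hεlt : ε < 1 := by nlinarith
  have hinv1 : 1 ≤ ε⁻¹ := (one_le_inv₀ hε).2 hεlt.le
  set s : ℕ := ⌊1 / (4 * (c * ε))⌋₊ with hs
  have hs1 : (s : ℝ) ≤ 1 / (4 * (c * ε)) := Nat.floor_le (by positivity)
  have hs2 : 1 / (8 * (c * ε)) ≤ s := by
    have h1 : 1 / (4 * (c * ε)) < s + 1 := Nat.lt_floor_add_one _
    have h2 : 1 ≤ 1 / (8 * (c * ε)) := by
      rw [le_div_iff₀ (by positivity)]
      linarith
    have h3 : 1 / (4 * (c * ε)) = 2 * (1 / (8 * (c * ε))) := by field_simp; norm_num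
    linarith
  have hs3 : (s : ℝ) ≤ ε⁻¹ := by
    refine hs1.trans ?_
    rw [← one_div]
    refine one_div_le_one_div_of_le hε ?_
    nlinarith
  refine ⟨t * (R * (t * s + t * t)), ?_, fun N d hN hd hd1 => ?_⟩
  · push_cast
    have htt : (t : ℝ) * t ≤ t * t * ε⁻¹ := le_mul_of_one_le_right (by positivity) hinv1
    calc (t : ℝ) * (R * (t * s + t * t)) ≤ t * (R * (t * ε⁻¹ + t * t * ε⁻¹)) := by
          refine mul_le_mul_of_nonneg_left (mul_le_mul_of_nonneg_left (add_le_add ?_ htt)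
            (by positivity)) (by positivity)
          gcongr
      _ = t * (R * (t + t * t)) * ε⁻¹ := by ring
      _ ≤ _ := by
          gcongr
          linarith
  have hN0 : (0 : ℝ) < N := by exact_mod_cast hN
  have hd0 : (0 : ℝ) < d := by exact_mod_cast hd1
  have hdle : (d : ℝ) ≤ c * ε * N := by rw [hd]; exact Nat.floor_le (by positivity)
  have hdge : c * ε * N < 2 * d := by
    have h1 : c * ε * N < d + 1 := by rw [hd]; exact Nat.lt_floor_add_one _
    have h2 : (1 : ℝ) ≤ d := by exact_mod_cast hd1
    linarith
  have hρ1 : ε ≤ 4 * (d / N : ℝ) := by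
    rw [← mul_div_assoc, le_div_iff₀ hN0]
    have : ε * N ≤ c * (ε * N) := le_mul_of_one_le_left (by positivity) hc
    linarith
  have hρ2 : 4 * (d / N : ℝ) ≤ 4 * (c * ε) := by
    gcongr
    rw [div_le_iff₀ hN0]
    exact hdle
  have hsρ : s * (4 * (d / N : ℝ)) ≤ 1 := by
    calc s * (4 * (d / N : ℝ)) ≤ 1 / (4 * (c * ε)) * (4 * (c * ε)) := by gcongr
      _ = 1 := by field_simp
  have hyρ : y ≤ s * (4 * (d / N : ℝ)) / (2 * t) := by
    calc y = 1 / (8 * (c * ε)) * ε / (2 * t) := by rw [hy]; field_simp; norm_num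
      _ ≤ _ := by gcongr
  have h0 : Adaptive (N := N) 0 fun _ => true := Adaptive.const 0 true
  have hboth : ∀ (q q' : ℕ) (F F' : SimpleGraph (Fin N) → Bool), Adaptive q F → Adaptive q' F' →
    Adaptive (q + q') (bothAccept F F') := fun q q' F F' h h' => h.both h'
  have htest := HasTest.levels (N := N) (𝒟 := Adaptive)
    (Acc := fun G => IsBlowUpCollection (SimpleGraph.cycleGraph t) G)
    (Rej := fun i G => ¬ pr (fun v : Fin (i + 2) → Fin N =>
        Orderly (restrict G {v | deg G v ≤ 4 * d}) v ∧ ¬ IsBlowUp (SimpleGraph.cycleGraph t)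
          ((restrict G {v | deg G v ≤ 4 * d}).comap v)) ≤ δ * (4 * (d / N)) ^ (i + 2 - 1))
    (q := fun i => R * (t * s + t * t)) (a := fun _ => R * 0) (b := (1 - p) ^ R) h0 hboth (t - 1)
    (fun i hi => by
      refine HasTest.pow (𝒟 := Adaptive) h0 hboth ?_ R
      refine hasTest_obstruction_adaptive hN hd1 (by omega) (by omega) hsρ ?_
      refine (min_le_left _ _).trans ?_
      gcongr
      calc y ^ t ≤ y ^ (i + 2 - 1) := pow_le_pow_of_le_one hy0.le hy1 (by omega)
        _ ≤ _ := by gcongr)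
  refine htest.mono ?_ ?_ (by simp) hR.le
  · intro F hF
    refine hF.mono ?_
    rw [Finset.sum_const, Finset.card_range, smul_eq_mul]
    exact Nat.mul_le_mul_right _ (Nat.sub_le _ _)
  · intro G hG
    push Not at hG
    obtain ⟨k, hk, hkt, hG⟩ := hG
    obtain ⟨i, rfl⟩ : ∃ i, k = i + 2 := ⟨k - 2, by omega⟩
    exact ⟨i, by omega, not_le.2 hG⟩


/-! ### The upper bounds -/

theorem HasTest.acc_mono {N : ℕ} {𝒞 : (SimpleGraph (Fin N) → Bool) → Prop}
    {Acc Acc' Rej : SimpleGraph (Fin N) → Prop} {a b : ℝ} (h : HasTest 𝒞 Acc Rej a b)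
    (hA : ∀ G, Acc' G → Acc G) : HasTest 𝒞 Acc' Rej a b := by
  obtain ⟨Ω, i1, i2, F, h1, h2, h3⟩ := h
  exact ⟨Ω, i1, i2, F, h1, fun G hG => h2 G (hA G hG), h3⟩

open Classical in
theorem hasTest_bot {N : ℕ} (hN : 0 < N) {ε : ℝ} (r : ℕ) (hr : 1 ≤ r * ε) (hε : ε ≤ 1 / 2) :
    HasTest (N := N) (NonAdaptive r) (fun G => G = ⊥)
      (fun G => 2 * ε ≤ pr fun q : Fin N × Fin N => G.Adj q.1 q.2) 0 (1 / 4) := by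
  have : Nonempty (Fin N) := ⟨⟨0, hN⟩⟩
  have h1 : HasTest (N := N) (NonAdaptive 1) (fun G => G = ⊥)
      (fun G => 2 * ε ≤ pr fun q : Fin N × Fin N => G.Adj q.1 q.2) 0 (1 - 2 * ε) := by
    refine ⟨Fin N × Fin N, inferInstance, inferInstance, fun q G => decide (¬ G.Adj q.1 q.2),
      fun q => ⟨[q], le_rfl, fun G G' h => ?_⟩, fun G hG => ?_, fun G hG => ?_⟩
    · have := h q (List.mem_singleton_self q)
      simp only [this]
    · subst hG
      rw [pr_eq_zero fun q hq => by simp at hq]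
    · have e : (pr fun q : Fin N × Fin N => decide (¬ G.Adj q.1 q.2) = true) =
          1 - pr fun q : Fin N × Fin N => G.Adj q.1 q.2 := by
        rw [← pr_not]
        exact pr_congr fun q => by simp
      rw [e]
      linarith
  have h2 := h1.pow (𝒟 := NonAdaptive) nonAdaptive_true (fun q q' F F' h h' => h.both h') r
  refine h2.mono (fun F hF => by rwa [mul_one] at hF) (fun G hG => hG) (by simp) ?_
  calc (1 - 2 * ε) ^ r ≤ (Real.exp (-(2 * ε))) ^ r := by
        refine pow_le_pow_left₀ (by linarith) ?_ r
        linarith [Real.add_one_le_exp (-(2 * ε))]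
    _ = Real.exp (r * (-(2 * ε))) := (Real.exp_nat_mul _ _).symm
    _ ≤ Real.exp (-2) := Real.exp_le_exp.2 (by linarith)
    _ ≤ 1 / 4 := exp_neg_two_le

theorem isBlowUpCollection_bot {V W : Type} (C : SimpleGraph W) (w : W) :
    IsBlowUpCollection C (⊥ : SimpleGraph V) := by
  refine ⟨1, fun _ => 0, fun i => ⟨fun _ => w, fun u v => ?_⟩, fun u v h => (h rfl).elim⟩
  simp

/-- If the degree bound is smaller than one, then only the empty graph has the property. -/
theorem hasTest_of_degree_bound_lt_one {t : ℕ} (ht : 8 ≤ t) {N : ℕ} (hN : 0 < N) {c ε : ℝ}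
    (hc : 1 ≤ c) (hε : 0 < ε) (hε1 : ε ≤ 1 / 2) (hlt : c * ε * N < 1) {r : ℕ} (hr : 1 ≤ r * ε) :
    HasTest (N := N) (NonAdaptive r)
      (lowDegreeBlowUpCollection (SimpleGraph.cycleGraph t) (c * ε)).Mem
      (IsFar (lowDegreeBlowUpCollection (SimpleGraph.cycleGraph t) (c * ε)) ε) 0 (1 / 4) := by
  have hN0 : (0 : ℝ) < N := by exact_mod_cast hN
  refine ((hasTest_bot hN r hr hε1).mono (fun F hF => hF) (fun G hG => ?_) le_rfl le_rfl).acc_mono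
    fun G hG => ?_
  · have h1 : ε * (N : ℝ) ^ 2 ≤ editDistance G ⊥ := by
      refine hG ⊥ ⟨fun v => ?_, isBlowUpCollection_bot _ ⟨0, by omega⟩⟩
      have : ((⊥ : SimpleGraph (Fin N)).neighborSet v) = ∅ := by
        ext x; simp
      rw [this, Set.ncard_empty]
      push_cast
      positivity
    have h2 := two_mul_editDistance hN G (⊥ : SimpleGraph (Fin N))
    have h3 : gap G (⊥ : SimpleGraph (Fin N)) = pr fun q : Fin N × Fin N => G.Adj q.1 q.2 := by
      refine pr_congr fun q => ?_
      simp
    rw [h3] at h2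
    have h4 : (2 * ε) * (N : ℝ) ^ 2 ≤ (pr fun q : Fin N × Fin N => G.Adj q.1 q.2) * (N : ℝ) ^ 2 := by
      linarith
    exact le_of_mul_le_mul_right h4 (by positivity)
  · ext u v
    have h1 := hG.1 u
    rw [ncard_neighborSet] at h1
    have h2 : deg G u = 0 := by
      have : (deg G u : ℝ) < 1 := h1.trans_lt hlt
      exact_mod_cast Nat.lt_one_iff.1 (by exact_mod_cast this)
    simp only [SimpleGraph.bot_adj, iff_false]
    intro ha
    rw [deg, Finset.card_eq_zero] at h2
    have := mem_nbhd.2 ha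
    rw [h2] at this
    simp at this

/-- Combining tests for large degrees and for small obstructions. -/
theorem eventually_hasTest_of_obstructions {t : ℕ} (ht : 8 ≤ t) {c : ℝ} (hc : 1 ≤ c)
    (𝒟 : ∀ {N : ℕ}, ℕ → (SimpleGraph (Fin N) → Bool) → Prop)
    (hna : ∀ {N : ℕ} q (F : SimpleGraph (Fin N) → Bool), NonAdaptive q F → 𝒟 q F)
    (hmono : ∀ {N : ℕ} q r (F : SimpleGraph (Fin N) → Bool), 𝒟 q F → q ≤ r → 𝒟 r F)
    (hboth : ∀ {N : ℕ} q q' (F F' : SimpleGraph (Fin N) → Bool), 𝒟 q F → 𝒟 q' F' →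
      𝒟 (q + q') (bothAccept F F')) (g : ℝ → ℝ)
    (hg : ∀ δ : ℝ, 0 < δ → ∃ K : ℝ, 0 < K ∧ ∀ᶠ ε in 𝓝[>] (0 : ℝ), ∃ q : ℕ,
      (q : ℝ) ≤ K * g ε ∧ ∀ N d : ℕ, 0 < N → d = ⌊c * ε * N⌋₊ → 1 ≤ d →
        HasTest (N := N) (𝒟 q)
          (fun G => IsBlowUpCollection (SimpleGraph.cycleGraph t) G)
          (fun G => ¬ ∀ k, 2 ≤ k → k ≤ t → pr (fun v : Fin k → Fin N =>
            Orderly (restrict G {v | deg G v ≤ 4 * d}) v ∧ ¬ IsBlowUp (SimpleGraph.cycleGraph t)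
              ((restrict G {v | deg G v ≤ 4 * d}).comap v)) ≤ δ * (4 * (d / N)) ^ (k - 1))
          0 (1 / 4)) :
    ∃ K : ℝ, 0 < K ∧ ∀ᶠ ε in 𝓝[>] (0 : ℝ), ∃ q : ℕ,
      (q : ℝ) ≤ K * (g ε + ε⁻¹ * Real.log ε⁻¹ ^ 3) ∧ ∀ N : ℕ, 1 ≤ N →
        HasTest (N := N) (𝒟 q)
          (lowDegreeBlowUpCollection (SimpleGraph.cycleGraph t) (c * ε)).Mem
          (IsFar (lowDegreeBlowUpCollection (SimpleGraph.cycleGraph t) (c * ε)) ε)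
          (1 / 4) (1 / 4) := by
  obtain ⟨γ, β, δ, hγ, hγ1, hβ, hδ, hfar⟩ := exists_not_isFar ht hc
  obtain ⟨K₁, hK₁, hev₁⟩ := hg δ hδ
  -- `exists_not_isFar` uses the degree threshold (1 + γ/2)d, so the degree test runs with γ/2;
  -- capping β at 1 meets the hypothesis of that test.
  obtain ⟨K₂, hK₂, hev₂⟩ := eventually_hasTest_degrees (β := min β 1) hc (half_pos hγ)
    (by linarith) (lt_min hβ one_pos) (min_le_right _ _)
  refine ⟨K₁ + K₂ + 2, by positivity, ?_⟩
  have hev : ∀ᶠ ε in 𝓝[>] (0 : ℝ), ε ∈ Set.Ioo (0 : ℝ) (min (Real.exp (-1)) (1 / 2)) :=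
    Ioo_mem_nhdsGT (lt_min (Real.exp_pos _) (by norm_num))
  filter_upwards [hev, hev₁, hev₂] with ε ⟨hε, hεlt⟩ ⟨q₁, hq₁, ht₁⟩ ⟨q₂, hq₂, ht₂⟩
  have hε1 : ε < Real.exp (-1) := hεlt.trans_le (min_le_left _ _)
  have hε2 : ε < 1 / 2 := hεlt.trans_le (min_le_right _ _)
  have hl1 : 1 ≤ Real.log ε⁻¹ := by
    rw [Real.log_inv]
    have := Real.log_lt_log hε hε1
    rw [Real.log_exp] at this
    linarith
  have hinv1 : 1 ≤ ε⁻¹ := (one_le_inv₀ hε).2 (by linarith)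
  have hr1 : ε⁻¹ ≤ ⌈ε⁻¹⌉₊ := Nat.le_ceil _
  have hr2 : (⌈ε⁻¹⌉₊ : ℝ) ≤ 2 * ε⁻¹ := by
    have := (Nat.ceil_lt_add_one (zero_le_one.trans hinv1)).le
    linarith
  have hg0 : 0 ≤ g ε := by
    have : 0 ≤ K₁ * g ε := (Nat.cast_nonneg q₁).trans hq₁
    exact nonneg_of_mul_nonneg_right this hK₁
  refine ⟨q₁ + q₂ + ⌈ε⁻¹⌉₊, ?_, fun N hN => ?_⟩
  · have h3 : ε⁻¹ ≤ ε⁻¹ * Real.log ε⁻¹ ^ 3 := le_mul_of_one_le_right (by positivity) (one_le_pow₀ hl1)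
    push_cast
    have h4 : 0 ≤ ε⁻¹ * Real.log ε⁻¹ ^ 3 := by positivity
    have h5 : 0 ≤ K₁ * (ε⁻¹ * Real.log ε⁻¹ ^ 3) := by positivity
    have h6 : 0 ≤ K₂ * g ε := by positivity
    nlinarith
  have hN0 : (0 : ℝ) < N := by exact_mod_cast hN
  by_cases hd : ⌊c * ε * N⌋₊ = 0
  · have hlt : c * ε * N < 1 := Nat.floor_eq_zero.1 hd
    refine (hasTest_of_degree_bound_lt_one ht hN hc hε hε2.le hlt (r := ⌈ε⁻¹⌉₊) ?_).mono
      (fun F hF => hmono _ _ F (hna _ F hF) (by omega)) (fun G hG => hG) (by norm_num) le_rfl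
    calc (1 : ℝ) = ε⁻¹ * ε := by field_simp
      _ ≤ _ := by gcongr
  · have hd1 : 1 ≤ ⌊c * ε * N⌋₊ := Nat.one_le_iff_ne_zero.2 hd
    set d := ⌊c * ε * N⌋₊ with hdd
    have hdle : (d : ℝ) ≤ c * ε * N := Nat.floor_le (by positivity)
    set Mem := (lowDegreeBlowUpCollection (SimpleGraph.cycleGraph t) (c * ε)).Mem (N := N)
    have T₁ : HasTest (N := N) (𝒟 q₁) Mem _ 0 (1 / 4) :=
      (ht₁ N d hN hdd hd1).acc_mono fun G hG => hG.2
    have T₂ : HasTest (N := N) (NonAdaptive q₂) Mem _ (1 / 8) (1 / 4) :=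
      (ht₂ N d hN hdd hd1).acc_mono fun G hG v => Nat.le_floor (by
        rw [← ncard_neighborSet]
        exact hG.1 v)
    refine (T₁.or T₂ (𝒞'' := 𝒟 (q₁ + q₂)) fun F F' h h' => hboth _ _ _ _ h (hna _ _ h')).mono
      (fun F hF => hmono _ _ F hF (by omega)) (fun G hG => ?_) (by norm_num) le_rfl
    by_contra hcon
    rw [not_or, not_or, not_not, not_not, not_not] at hcon
    obtain ⟨h1, h2, h3⟩ := hcon
    have hmin : min β 1 ≤ β := min_le_left _ _
    exact hfar ε hε N d hN hd1 hdle G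
      (h2.trans (mul_le_mul_of_nonneg_right hmin (by positivity))) (h3.trans hmin) h1 hG

theorem eventually_adaptivelyTestable {t : ℕ} (ht : 8 ≤ t) {c : ℝ} (hc : 1 ≤ c) :
    ∃ K : ℝ, 0 < K ∧ ∀ᶠ ε in 𝓝[>] (0 : ℝ), ∃ q : ℕ, (q : ℝ) ≤ K * (ε⁻¹ * Real.log ε⁻¹ ^ 3) ∧
      AdaptivelyTestable (lowDegreeBlowUpCollection (SimpleGraph.cycleGraph t) (c * ε)) ε q := by
  obtain ⟨K, hK, hev⟩ := eventually_hasTest_of_obstructions ht hc (fun {N} => Adaptive)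
    (fun q F h => h.adaptive) (fun q r F h hr => h.mono hr) (fun q q' F F' h h' => h.both h')
    (fun ε => ε⁻¹) (fun δ hδ => eventually_hasTest_obstructions_adaptive ht hc hδ)
  refine ⟨2 * K, by positivity, ?_⟩
  have hev' : ∀ᶠ ε in 𝓝[>] (0 : ℝ), ε ∈ Set.Ioo (0 : ℝ) (Real.exp (-1)) :=
    Ioo_mem_nhdsGT (Real.exp_pos _)
  filter_upwards [hev, hev'] with ε ⟨q, hq, h⟩ ⟨hε, hε1⟩
  refine ⟨q, hq.trans ?_, adaptivelyTestable_of_hasTest h⟩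
  have hl1 : 1 ≤ Real.log ε⁻¹ := by
    rw [Real.log_inv]
    have := Real.log_lt_log hε hε1
    rw [Real.log_exp] at this
    linarith
  have h3 : ε⁻¹ ≤ ε⁻¹ * Real.log ε⁻¹ ^ 3 := le_mul_of_one_le_right (by positivity) (one_le_pow₀ hl1)
  nlinarith

theorem eventually_nonAdaptivelyTestable {t : ℕ} (ht : 8 ≤ t) {c : ℝ} (hc : 1 ≤ c) :
    ∃ K : ℝ, 0 < K ∧ ∀ᶠ ε in 𝓝[>] (0 : ℝ), ∃ q : ℕ,
      (q : ℝ) ≤ K * (ε⁻¹ ^ (2 - 2 / (t : ℝ)) * Real.log ε⁻¹ ^ 3) ∧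
      NonAdaptivelyTestable (lowDegreeBlowUpCollection (SimpleGraph.cycleGraph t) (c * ε)) ε q := by
  obtain ⟨K, hK, hev⟩ := eventually_hasTest_of_obstructions ht hc (fun {N} => NonAdaptive)
    (fun q F h => h) (fun q r F h hr => h.mono hr) (fun q q' F F' h h' => h.both h')
    (fun ε => ε⁻¹ ^ (2 - 2 / (t : ℝ)))
    (fun δ hδ => eventually_hasTest_obstructions_nonAdaptive ht hc hδ)
  refine ⟨2 * K, by positivity, ?_⟩
  have hev' : ∀ᶠ ε in 𝓝[>] (0 : ℝ), ε ∈ Set.Ioo (0 : ℝ) (Real.exp (-1)) :=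
    Ioo_mem_nhdsGT (Real.exp_pos _)
  filter_upwards [hev, hev'] with ε ⟨q, hq, h⟩ ⟨hε, hε1⟩
  refine ⟨q, hq.trans ?_, nonAdaptivelyTestable_of_hasTest h⟩
  have hl1 : 1 ≤ Real.log ε⁻¹ := by
    rw [Real.log_inv]
    have := Real.log_lt_log hε hε1
    rw [Real.log_exp] at this
    linarith
  have hε2 : ε < 1 := hε1.trans (by rw [Real.exp_lt_one_iff]; norm_num)
  have hinv1 : 1 ≤ ε⁻¹ := (one_le_inv₀ hε).2 hε2.le
  have ht' : (2 : ℝ) / t ≤ 1 := by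
    rw [div_le_one (by exact_mod_cast (by omega : 0 < t))]
    exact_mod_cast (by omega : 2 ≤ t)
  have h4 : ε⁻¹ ≤ ε⁻¹ ^ (2 - 2 / (t : ℝ)) := by
    nth_rewrite 1 [← Real.rpow_one ε⁻¹]
    exact Real.rpow_le_rpow_of_exponent_le hinv1 (by linarith)
  have hlog : 1 ≤ Real.log ε⁻¹ ^ 3 := one_le_pow₀ hl1
  have h3 : ε⁻¹ ^ (2 - 2 / (t : ℝ)) ≤ ε⁻¹ ^ (2 - 2 / (t : ℝ)) * Real.log ε⁻¹ ^ 3 :=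
    le_mul_of_one_le_right (by positivity) hlog
  have h5 : ε⁻¹ * Real.log ε⁻¹ ^ 3 ≤ ε⁻¹ ^ (2 - 2 / (t : ℝ)) * Real.log ε⁻¹ ^ 3 := by gcongr
  calc K * (ε⁻¹ ^ (2 - 2 / (t : ℝ)) + ε⁻¹ * Real.log ε⁻¹ ^ 3)
      ≤ K * (ε⁻¹ ^ (2 - 2 / (t : ℝ)) * Real.log ε⁻¹ ^ 3 +
        ε⁻¹ ^ (2 - 2 / (t : ℝ)) * Real.log ε⁻¹ ^ 3) := by gcongr
    _ = _ := by ring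


/-! ### Random labellings -/

open Classical in
/-- Every label is used between `s` and `4 s` times. -/
def Balanced {V A : Type} [Fintype V] (s : ℕ) (f : V → A) : Prop :=
  ∀ z, s ≤ (Finset.univ.filter fun v => f v = z).card ∧
    (Finset.univ.filter fun v => f v = z).card ≤ 4 * s

open Classical in
theorem hits_eq_card {A : Type} {N : ℕ} (z : A) (f : Fin N → A) :
    hits (fun x => x = z) f = ((Finset.univ.filter fun v => f v = z).card : ℝ) := by
  rw [hits, ← sum_ind_mem]
  refine Finset.sum_congr rfl fun v _ => ind_congr ?_
  simp

/-- Each label is expected 2s times, so Chernoff bounds and a union bound over the labels suffice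
once s is large in terms of |A|. A tester must work for all N, so nothing limits s. -/
theorem exists_pr_not_balanced_le (A : Type) [Fintype A] [Nonempty A] :
    ∃ s : ℕ, 0 < s ∧
      pr (fun f : Fin (2 * s * Fintype.card A) → A => ¬ Balanced s f) ≤ 1 / 20 := by
  classical
  obtain ⟨K, hK⟩ : ∃ K : ℝ, K = Fintype.card A := ⟨_, rfl⟩
  have hK0 : 0 < K := hK ▸ Nat.cast_pos.2 Fintype.card_pos
  have hlim : Tendsto (fun s : ℕ => Real.exp (-(1 / 512 * (s : ℝ)))) atTop (𝓝 0) := by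
    refine Real.tendsto_exp_neg_atTop_nhds_zero.comp ?_
    exact tendsto_natCast_atTop_atTop.const_mul_atTop (by norm_num)
  have hev := hlim.eventually_lt_const (show (0 : ℝ) < 1 / (40 * K) by positivity)
  obtain ⟨s, hs, hs0⟩ := (hev.and (eventually_gt_atTop 0)).exists
  refine ⟨s, hs0, ?_⟩
  have hs0' : (0 : ℝ) < s := by exact_mod_cast hs0
  set N := 2 * s * Fintype.card A with hN
  have hNr : (N : ℝ) = 2 * s * K := by rw [hN, hK]; push_cast; ring
  have hz : ∀ z : A, pr (fun f : Fin N → A => ¬ (s ≤ (Finset.univ.filter fun v => f v = z).card ∧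
      (Finset.univ.filter fun v => f v = z).card ≤ 4 * s)) ≤ 1 / (20 * K) := by
    intro z
    have hpz : pr (fun x : A => x = z) = 1 / K := by
      have := pr_mem ({z} : Finset A)
      rw [hK]
      simpa using this
    have h1 := pr_many_hits_le (A := fun x : A => x = z) (r := N) (a := 1 / K) (γ := 1 / 4)
      (by positivity) (by norm_num) le_rfl hpz.le
    -- Here (1 + γ)·4/(5K) is exactly the probability 1/K of a label; the resulting threshold of
    -- 9s/5 hits is still above s.
    have h2 := pr_few_hits_le (A := fun x : A => x = z) (r := N) (a := 4 / 5 / K) (γ := 1 / 4)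
      (by positivity) (by norm_num) le_rfl (by rw [hpz]; ring_nf; exact le_rfl)
    have e1 : Real.exp (-((1 / 4 : ℝ) ^ 2 / 32 * (N * (1 / K)))) ≤
        Real.exp (-(1 / 512 * (s : ℝ))) := by
      refine Real.exp_le_exp.2 (neg_le_neg ?_)
      rw [hNr]
      field_simp
      linarith
    have e2 : Real.exp (-((1 / 4 : ℝ) ^ 2 / 32 * (N * (4 / 5 / K)))) ≤
        Real.exp (-(1 / 512 * (s : ℝ))) := by
      refine Real.exp_le_exp.2 (neg_le_neg ?_)
      rw [hNr]
      field_simp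
      linarith
    have hsum : 1 / (40 * K) + 1 / (40 * K) = 1 / (20 * K) := by field_simp; norm_num
    refine (pr_mono fun f hf => ?_).trans ((pr_or_le _ _).trans
      ((add_le_add ((h1.trans e1).trans hs.le) ((h2.trans e2).trans hs.le)).trans hsum.le))
    rw [hits_eq_card, hNr]
    have e3 : (1 + 1 / 4 / 2 : ℝ) * (2 * s * K * (1 / K)) = 9 / 4 * s := by
      field_simp; norm_num
    have e4 : (1 + 1 / 4 / 2 : ℝ) * (2 * s * K * (4 / 5 / K)) = 9 / 5 * s := by
      field_simp; norm_num
    rw [e3, e4]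
    rw [not_and_or, not_le, not_le] at hf
    rcases hf with hf | hf
    · right
      have : ((Finset.univ.filter fun v => f v = z).card : ℝ) < s := by exact_mod_cast hf
      linarith
    · left
      have : (4 : ℝ) * s < (Finset.univ.filter fun v => f v = z).card := by exact_mod_cast hf
      linarith
  have h := pr_exists_le (Finset.univ : Finset A) fun z (f : Fin N → A) =>
    ¬ (s ≤ (Finset.univ.filter fun v => f v = z).card ∧
      (Finset.univ.filter fun v => f v = z).card ≤ 4 * s)
  refine (pr_mono fun f hf => ?_).trans (h.trans ((Finset.sum_le_sum fun z _ => hz z).trans ?_))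
  · unfold Balanced at hf
    push Not at hf
    obtain ⟨z, hz⟩ := hf
    exact ⟨z, Finset.mem_univ _, fun h => absurd h.2 (not_le.2 (hz h.1))⟩
  · rw [Finset.sum_const, Finset.card_univ, nsmul_eq_mul, ← hK]
    exact le_of_eq (by field_simp)

/-! ### Two coverings of a cycle -/

/-- The labels: `B` copies of the two sheets of a covering of the `t`-cycle. -/
abbrev Cell (t B : ℕ) : Type := Fin B × Fin t × Bool

/-- Whether an edge of the `t`-cycle joins its first and its last vertex. -/
def wraps {t : ℕ} (i j : Fin t) : Bool :=
  decide ((i.val = 0 ∧ j.val + 1 = t) ∨ (j.val = 0 ∧ i.val + 1 = t))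

theorem wraps_comm {t : ℕ} (i j : Fin t) : wraps i j = wraps j i := by
  unfold wraps
  congr 1
  rw [or_comm]

/-- Labels in the same copy, over adjacent vertices of the cycle. -/
def baseGraph (t B : ℕ) : SimpleGraph (Cell t B) where
  Adj z w := z.1 = w.1 ∧ (SimpleGraph.cycleGraph t).Adj z.2.1 w.2.1
  symm := ⟨fun _ _ h => ⟨h.1.symm, h.2.symm⟩⟩
  loopless := ⟨fun _ h => (SimpleGraph.cycleGraph t).loopless.irrefl _ h.2⟩

/-- `2 B` disjoint copies of the `t`-cycle. -/
def splitGraph (t B : ℕ) : SimpleGraph (Cell t B) where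
  Adj z w := (baseGraph t B).Adj z w ∧ z.2.2 = w.2.2
  symm := ⟨fun _ _ h => ⟨h.1.symm, h.2.symm⟩⟩
  loopless := ⟨fun _ h => (baseGraph t B).loopless.irrefl _ h.1⟩

/-- `B` disjoint copies of the connected double cover of the `t`-cycle. -/
def coverGraph (t B : ℕ) : SimpleGraph (Cell t B) where
  Adj z w := (baseGraph t B).Adj z w ∧ (z.2.2 ^^ w.2.2) = wraps z.2.1 w.2.1
  symm := ⟨fun z w h => ⟨h.1.symm, by rw [Bool.xor_comm, h.2, wraps_comm]⟩⟩
  loopless := ⟨fun _ h => (baseGraph t B).loopless.irrefl _ h.1⟩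

theorem pr_baseGraph_adj_le {t B : ℕ} (ht : 3 ≤ t) (z : Cell t B) :
    pr (fun w => (baseGraph t B).Adj z w) ≤ 2 / (t * B : ℝ) := by
  classical
  obtain ⟨p, q, -, hpq⟩ := exists_cycle_neighbors ht z.2.1
  set S : Finset (Cell t B) := {z.1} ×ˢ ({p, q} ×ˢ Finset.univ) with hS
  have hcard : S.card ≤ 4 := by
    rw [hS, Finset.card_product, Finset.card_product, Finset.card_singleton, Finset.card_univ,
      Fintype.card_bool]
    have := Finset.card_le_two (a := p) (b := q)
    omega
  have hB : (0 : ℝ) < B := by exact_mod_cast z.1.pos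
  have ht0 : (0 : ℝ) < t := by exact_mod_cast (by omega : 0 < t)
  calc pr (fun w => (baseGraph t B).Adj z w) ≤ pr fun w => w ∈ S := by
        refine pr_mono fun w hw => ?_
        rw [hS, Finset.mem_product, Finset.mem_product, Finset.mem_singleton]
        refine ⟨hw.1.symm, ?_, Finset.mem_univ _⟩
        rw [Finset.mem_insert, Finset.mem_singleton]
        exact (hpq _).1 hw.2
    _ = S.card / (B * (t * 2)) := by
        rw [pr_mem]
        simp
    _ ≤ 4 / (B * (t * 2)) := by
        gcongr
        exact_mod_cast hcard
    _ = 2 / (t * B : ℝ) := by field_simp; norm_num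

theorem isBlowUpCollection_splitGraph (t B : ℕ) :
    IsBlowUpCollection (SimpleGraph.cycleGraph t) (splitGraph t B) := by
  classical
  let e := Fintype.equivFin (Fin B × Bool)
  refine ⟨_, fun z => e (z.1, z.2.2), fun i => ⟨fun z => z.1.2.1, fun u v => ?_⟩,
    fun u v huv hadj => huv ?_⟩
  · have huv := e.injective (u.2.trans v.2.symm)
    rw [Prod.mk.injEq] at huv
    exact ⟨fun h => h.1.2, fun h => ⟨⟨huv.1, h⟩, huv.2⟩⟩
  · exact congrArg e (Prod.ext hadj.1.1 hadj.2)

theorem deg_comap_splitGraph_le {V : Type} [Fintype V] {t B s : ℕ} (ht : 3 ≤ t)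
    {f : V → Cell t B} (hf : Balanced s f) (v : V) : deg ((splitGraph t B).comap f) v ≤ 8 * s := by
  classical
  obtain ⟨p, q, -, hpq⟩ := exists_cycle_neighbors ht (f v).2.1
  have hsub : nbhd ((splitGraph t B).comap f) v ⊆
      (Finset.univ.filter fun x => f x = ((f v).1, p, (f v).2.2)) ∪
        (Finset.univ.filter fun x => f x = ((f v).1, q, (f v).2.2)) := by
    intro x hx
    obtain ⟨⟨h1, h2⟩, h3⟩ := mem_nbhd.1 hx
    rw [Finset.mem_union, Finset.mem_filter, Finset.mem_filter]
    rcases (hpq _).1 h2 with h | h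
    · exact Or.inl ⟨Finset.mem_univ _, Prod.ext h1.symm (Prod.ext h h3.symm)⟩
    · exact Or.inr ⟨Finset.mem_univ _, Prod.ext h1.symm (Prod.ext h h3.symm)⟩
  refine (Finset.card_le_card hsub).trans ((Finset.card_union_le _ _).trans ?_)
  have h (z) : (Finset.univ.filter fun x => f x = z).card ≤ 4 * s := by convert (hf z).2
  exact (Nat.add_le_add (h _) (h _)).trans_eq (by ring)

/-- For t ≥ 5 the successor and the predecessor determine the vertex between them; in the 4-cycle
opposite vertices would be twins. -/
theorem twinFree_cycleGraph {t : ℕ} (ht : 5 ≤ t) : TwinFree (SimpleGraph.cycleGraph t) := by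
  intro i j h
  have hi := i.isLt
  have hj := j.isLt
  obtain ⟨a, ha, ha'⟩ : ∃ a : Fin t, (SimpleGraph.cycleGraph t).Adj i a ∧
      (a.val = i.val + 1 ∨ (a.val = 0 ∧ i.val + 1 = t)) := by
    by_cases h : i.val + 1 = t
    · refine ⟨⟨0, by omega⟩, ?_, Or.inr ⟨rfl, h⟩⟩
      rw [cycle_adj_iff (by omega)]
      exact Or.inr (Or.inr (Or.inr ⟨rfl, h⟩))
    · refine ⟨⟨i.val + 1, by omega⟩, ?_, Or.inl rfl⟩
      rw [cycle_adj_iff (by omega)]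
      exact Or.inl rfl
  obtain ⟨b, hb, hb'⟩ : ∃ b : Fin t, (SimpleGraph.cycleGraph t).Adj i b ∧
      (b.val + 1 = i.val ∨ (i.val = 0 ∧ b.val + 1 = t)) := by
    by_cases h : i.val = 0
    · refine ⟨⟨t - 1, by omega⟩, ?_, Or.inr ⟨h, by simp only; omega⟩⟩
      rw [cycle_adj_iff (by omega)]
      exact Or.inr (Or.inr (Or.inl ⟨h, by simp only; omega⟩))
    · refine ⟨⟨i.val - 1, by omega⟩, ?_, Or.inl (by simp only; omega)⟩
      rw [cycle_adj_iff (by omega)]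
      exact Or.inr (Or.inl (by simp only; omega))
  have h1 := (h a).1 ha
  have h2 := (h b).1 hb
  rw [cycle_adj_iff (by omega)] at h1 h2
  ext
  omega

/-- The connected double cover of a cycle is not a collection of blow-ups of the cycle. -/
theorem not_isBlowUpCollection_coverGraph {t B : ℕ} (ht : 5 ≤ t) (b : Fin B) :
    ¬ IsBlowUpCollection (SimpleGraph.cycleGraph t)
      ((coverGraph t B).comap fun j : Fin t × Bool => (b, j)) := by
  classical
  set D := (coverGraph t B).comap fun j : Fin t × Bool => (b, j) with hD
  have hadj : ∀ i j σ τ, D.Adj (i, σ) (j, τ) ↔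
      (SimpleGraph.cycleGraph t).Adj i j ∧ (σ ^^ τ) = wraps i j := fun i j σ τ =>
    ⟨fun h => ⟨h.1.2, h.2⟩, fun h => ⟨⟨rfl, h.1⟩, h.2⟩⟩
  rintro ⟨k, p, h1, h2⟩
  have hcong : ∀ x y, D.Adj x y → p x = p y := fun x y h => by
    by_contra hne
    exact h2 x y hne h
  -- Each sheet is joined by its edges that do not wrap, and one wrapping edge joins the two sheets.
  -- So the cover is connected and lies in one part.
  have hrow : ∀ σ : Bool, ∀ n : ℕ, ∀ hn : n < t, p (⟨n, hn⟩, σ) = p (⟨0, by omega⟩, σ) := by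
    intro σ n
    induction n with
    | zero => exact fun _ => rfl
    | succ n ih =>
      intro hn
      rw [← ih (by omega)]
      refine (hcong _ _ ((hadj _ _ _ _).2 ⟨?_, ?_⟩)).symm
      · rw [cycle_adj_iff (by omega)]
        exact Or.inl rfl
      · simp [wraps]
        omega
  have hsheet : p (⟨t - 1, by omega⟩, false) = p (⟨0, by omega⟩, true) := by
    refine hcong _ _ ((hadj _ _ _ _).2 ⟨?_, ?_⟩)
    · rw [cycle_adj_iff (by omega)]
      right; right; right
      exact ⟨rfl, by simp only; omega⟩
    · simp [wraps]
      omega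
  rw [hrow] at hsheet
  have hall : ∀ x, p x = p (⟨0, by omega⟩, false) := by
    rintro ⟨i, σ⟩
    rw [hrow σ i.val i.isLt]
    cases σ
    · rfl
    · exact hsheet.symm
  obtain ⟨f, hf⟩ := h1 (p (⟨0, by omega⟩, false))
  -- Two of the 2t vertices share a label among t and are therefore twins. Twins project to twins of
  -- the t-cycle, so they lie over the same vertex, and then the wrapping rule forces the same
  -- sheet.
  obtain ⟨x, y, hxy, hfxy⟩ := Fintype.exists_ne_map_eq_of_card_lt
    (fun x : Fin t × Bool => f ⟨x, hall x⟩) (by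
      rw [Fintype.card_prod, Fintype.card_fin, Fintype.card_bool]
      omega)
  have htwin : ∀ z, D.Adj x z ↔ D.Adj y z := fun z => by
    have ex := hf ⟨x, hall x⟩ ⟨z, hall z⟩
    have ey := hf ⟨y, hall y⟩ ⟨z, hall z⟩
    rw [hfxy, ← ey] at ex
    exact ex
  obtain ⟨i, σ⟩ := x
  obtain ⟨j, τ⟩ := y
  have hcyc : ∀ l, (SimpleGraph.cycleGraph t).Adj i l ↔ (SimpleGraph.cycleGraph t).Adj j l := by
    intro l
    constructor
    · intro h
      exact ((hadj _ _ _ _).1 ((htwin (l, σ ^^ wraps i l)).1 ((hadj _ _ _ _).2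
        ⟨h, by rw [← Bool.xor_assoc, Bool.xor_self, Bool.false_xor]⟩))).1
    · intro h
      exact ((hadj _ _ _ _).1 ((htwin (l, τ ^^ wraps j l)).2 ((hadj _ _ _ _).2
        ⟨h, by rw [← Bool.xor_assoc, Bool.xor_self, Bool.false_xor]⟩))).1
  have hij : i = j := twinFree_cycleGraph ht _ _ hcyc
  subst hij
  obtain ⟨l, l', -, hl⟩ := exists_cycle_neighbors (show 3 ≤ t by omega) i
  have hil : (SimpleGraph.cycleGraph t).Adj i l := (hl l).2 (Or.inl rfl)
  have e := ((hadj _ _ _ _).1 ((htwin (l, σ ^^ wraps i l)).1 ((hadj _ _ _ _).2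
        ⟨hil, by rw [← Bool.xor_assoc, Bool.xor_self, Bool.false_xor]⟩))).2
  apply hxy
  have : σ = τ := by
    revert e
    cases σ <;> cases τ <;> cases wraps i l <;> simp
  rw [this]


/-! ### Two random graphs -/

theorem pr_pair {J A : Type} [Fintype J] [DecidableEq J] [Fintype A] [Nonempty A] {i j : J}
    (hij : i ≠ j) (Q : A → A → Prop) :
    pr (fun T : J → A => Q (T i) (T j)) = pr fun q : A × A => Q q.1 q.2 := by
  have he : Function.Injective ![i, j] := by
    intro a b h
    fin_cases a <;> fin_cases b <;> simp_all [eq_comm]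
  have h1 := pr_comp_injective (V := A) he fun v => Q (v 0) (v 1)
  rw [← pr_equiv (finTwoArrowEquiv A) fun q => Q q.1 q.2]
  exact h1

open Classical in
theorem exists_injective_of_balanced {V A : Type} [Fintype V] {s : ℕ} {f : V → A}
    (hf : Balanced s f) :
    ∃ e : A → Fin s → V, ∀ z, Function.Injective (e z) ∧ ∀ a, f (e z a) = z := by
  refine ⟨fun z a => ((Finset.univ.filter fun v => f v = z).equivFin.symm
    (Fin.castLE (hf z).1 a)).val, fun z => ⟨fun a b h => ?_, fun a => ?_⟩⟩
  · have h1 := Equiv.injective _ (Subtype.ext h)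
    exact Fin.castLE_injective _ h1
  · have := ((Finset.univ.filter fun v => f v = z).equivFin.symm (Fin.castLE (hf z).1 a)).2
    exact (Finset.mem_filter.1 this).2

/-- Every collection of blow-ups of the `t`-cycle differs in many places from a blow-up of the
double covers of the cycle. -/
theorem mul_sq_le_gap {V : Type} [Fintype V] {t B s : ℕ} (ht : 5 ≤ t) (hs : 0 < s)
    {f : V → Cell t B} (hf : Balanced s f) {G' : SimpleGraph V}
    (hG' : IsBlowUpCollection (SimpleGraph.cycleGraph t) G') :
    (B : ℝ) * s ^ 2 ≤ gap ((coverGraph t B).comap f) G' * (Fintype.card V : ℝ) ^ 2 := by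
  classical
  have : Nonempty (Fin s) := ⟨⟨0, hs⟩⟩
  obtain ⟨e, he⟩ := exists_injective_of_balanced hf
  set ed : V × V → Prop := fun p =>
    ¬ (((coverGraph t B).comap f).Adj p.1 p.2 ↔ G'.Adj p.1 p.2) with hed
  have hblob : ∀ b : Fin B, (s : ℝ) ^ 2 ≤ ∑ p : (Fin t × Bool) × (Fin t × Bool),
      ∑ q : Fin s × Fin s, ind (ed (e (b, p.1) q.1, e (b, p.2) q.2)) := by
    intro b
    -- Any choice of one vertex per label in a copy induces the double cover, which is no blow-up
    -- collection, whereas `G'` induces one. So each of the s^(2t) choices contains a wrong pair,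
    -- and averaging gives s² wrong pairs for each copy.
    have h1 : pr (fun T : Fin t × Bool → Fin s =>
        ∃ p ∈ (Finset.univ : Finset ((Fin t × Bool) × (Fin t × Bool))),
          p.1 ≠ p.2 ∧ ed (e (b, p.1) (T p.1), e (b, p.2) (T p.2))) = 1 := by
      refine pr_eq_one fun T => ?_
      by_contra hcon
      have hcomap : G'.comap (fun j => e (b, j) (T j)) =
          (coverGraph t B).comap fun j : Fin t × Bool => (b, j) := by
        ext i j
        by_cases hij : i = j
        · subst hij
          simp
        · have h2 : ¬ ed (e (b, i) (T i), e (b, j) (T j)) := fun h =>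
            hcon ⟨(i, j), Finset.mem_univ _, hij, h⟩
          rw [hed, not_not] at h2
          simp only [SimpleGraph.comap_adj, (he _).2] at h2 ⊢
          exact h2.symm
      exact not_isBlowUpCollection_coverGraph ht b (hcomap ▸ hG'.comap _)
    have h2 := pr_exists_le (Finset.univ : Finset ((Fin t × Bool) × (Fin t × Bool)))
      fun p (T : Fin t × Bool → Fin s) =>
        p.1 ≠ p.2 ∧ ed (e (b, p.1) (T p.1), e (b, p.2) (T p.2))
    rw [h1] at h2
    have h3 : ∀ p : (Fin t × Bool) × (Fin t × Bool), (s : ℝ) ^ 2 *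
        pr (fun T : Fin t × Bool → Fin s =>
          p.1 ≠ p.2 ∧ ed (e (b, p.1) (T p.1), e (b, p.2) (T p.2))) ≤
        ∑ q : Fin s × Fin s, ind (ed (e (b, p.1) q.1, e (b, p.2) q.2)) := by
      intro p
      by_cases hp : p.1 = p.2
      · rw [pr_eq_zero fun T hT => hT.1 hp, mul_zero]
        exact Finset.sum_nonneg fun q _ => ind_nonneg _
      · rw [sum_eq_card_mul_avg, ← pr, ← pr_pair hp fun x y => ed (e (b, p.1) x, e (b, p.2) y),
          Fintype.card_prod, Fintype.card_fin]
        push_cast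
        rw [← sq]
        gcongr
        exact pr_mono fun T hT => hT.2
    calc (s : ℝ) ^ 2 = s ^ 2 * 1 := (mul_one _).symm
      _ ≤ s ^ 2 * _ := by gcongr
      _ = _ := Finset.mul_sum _ _ _
      _ ≤ _ := Finset.sum_le_sum fun p _ => h3 p
  have hinj : Function.Injective fun x : Fin B × ((Fin t × Bool) × (Fin t × Bool)) ×
      (Fin s × Fin s) => (e (x.1, x.2.1.1) x.2.2.1, e (x.1, x.2.1.2) x.2.2.2) := by
    rintro ⟨b, ⟨i, j⟩, a, c⟩ ⟨b', ⟨i', j'⟩, a', c'⟩ h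
    simp only [Prod.mk.injEq] at h
    have h1 := congrArg f h.1
    have h2 := congrArg f h.2
    rw [(he _).2, (he _).2, Prod.mk.injEq] at h1 h2
    obtain ⟨rfl, rfl⟩ := h1
    obtain ⟨-, rfl⟩ := h2
    rw [(he _).1 h.1, (he _).1 h.2]
  calc (B : ℝ) * s ^ 2 = ∑ _b : Fin B, (s : ℝ) ^ 2 := by simp
    _ ≤ ∑ b : Fin B, ∑ p : (Fin t × Bool) × (Fin t × Bool),
        ∑ q : Fin s × Fin s, ind (ed (e (b, p.1) q.1, e (b, p.2) q.2)) :=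
        Finset.sum_le_sum fun b _ => hblob b
    _ = ∑ x : Fin B × ((Fin t × Bool) × (Fin t × Bool)) × (Fin s × Fin s),
        ind (ed (e (x.1, x.2.1.1) x.2.2.1, e (x.1, x.2.1.2) x.2.2.2)) := by
        rw [Fintype.sum_prod_type]
        exact Finset.sum_congr rfl fun b _ => (Fintype.sum_prod_type
          fun y : ((Fin t × Bool) × (Fin t × Bool)) × (Fin s × Fin s) =>
            ind (ed (e (b, y.1.1) y.2.1, e (b, y.1.2) y.2.2))).symm
    _ = ∑ y ∈ Finset.univ.image fun x : Fin B × ((Fin t × Bool) × (Fin t × Bool)) ×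
        (Fin s × Fin s) => (e (x.1, x.2.1.1) x.2.2.1, e (x.1, x.2.1.2) x.2.2.2), ind (ed y) := by
        rw [Finset.sum_image fun x _ y _ h => hinj h]
    _ ≤ ∑ y, ind (ed y) := Finset.sum_le_univ_sum_of_nonneg fun y => ind_nonneg _
    _ = _ := by
        rcases isEmpty_or_nonempty V with hV | hV
        · simp [gap, pr, avg]
        · rw [sum_eq_card_mul_avg, gap, pr, Fintype.card_prod]
          push_cast
          ring

theorem isFar_comap_coverGraph {t B s N : ℕ} (ht : 5 ≤ t) (hs : 0 < s) (hN : N = 4 * s * t * B)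
    (hN0 : 0 < N) {c ε : ℝ} (hB : 32 * t ^ 2 * ε * B ≤ 1) {f : Fin N → Cell t B}
    (hf : Balanced s f) :
    IsFar (lowDegreeBlowUpCollection (SimpleGraph.cycleGraph t) (c * ε)) ε
      ((coverGraph t B).comap f) := by
  intro G' hG'
  have h1 := mul_sq_le_gap ht hs hf hG'.2
  rw [Fintype.card_fin, ← two_mul_editDistance hN0] at h1
  have h2 : ε * (N : ℝ) ^ 2 = (32 * t ^ 2 * ε * B) * (B * s ^ 2) / 2 := by
    rw [hN]
    push_cast
    ring
  have h3 : (32 * t ^ 2 * ε * B) * (B * s ^ 2) ≤ (B : ℝ) * s ^ 2 :=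
    mul_le_of_le_one_left (by positivity) hB
  linarith

theorem mem_comap_splitGraph {t B s N : ℕ} (ht : 5 ≤ t) (hN : N = 4 * s * t * B)
    {c ε : ℝ} (hB : 2 ≤ c * ε * t * B) {f : Fin N → Cell t B} (hf : Balanced s f) :
    (lowDegreeBlowUpCollection (SimpleGraph.cycleGraph t) (c * ε)).Mem
      ((splitGraph t B).comap f) := by
  refine ⟨fun v => ?_, (isBlowUpCollection_splitGraph t B).comap f⟩
  rw [ncard_neighborSet]
  have h1 : (deg ((splitGraph t B).comap f) v : ℝ) ≤ 8 * s := by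
    exact_mod_cast deg_comap_splitGraph_le (by omega) hf v
  refine h1.trans ?_
  rw [hN]
  push_cast
  calc (8 : ℝ) * s = 2 * (4 * s) := by ring
    _ ≤ (c * ε * t * B) * (4 * s) := by gcongr
    _ = _ := by ring

theorem mem_bot {t N : ℕ} (ht : 5 ≤ t) {c : ℝ} (hc : 0 ≤ c) :
    (lowDegreeBlowUpCollection (SimpleGraph.cycleGraph t) c).Mem (⊥ : SimpleGraph (Fin N)) := by
  refine ⟨fun v => ?_, isBlowUpCollection_bot _ ⟨0, by omega⟩⟩
  have : ((⊥ : SimpleGraph (Fin N)).neighborSet v) = ∅ := by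
    ext x; simp
  rw [this, Set.ncard_empty]
  push_cast
  positivity

/-! ### Averaging over the randomness of a tester -/

theorem map_apply_eq_tsum {A : Type} (μ : PMF A) (g : A → Bool) (b : Bool) :
    (μ.map g) b = ∑' x, μ x * ENNReal.ofReal (ind (g x = b)) := by
  classical
  rw [PMF.map_apply]
  refine tsum_congr fun x => ?_
  by_cases h : g x = b
  · rw [if_pos h.symm, ind_of h, ENNReal.ofReal_one, mul_one]
  · rw [if_neg fun e => h e.symm, ind_of_not h, ENNReal.ofReal_zero, mul_zero]

theorem sum_map_apply_eq_tsum {A Λ : Type} [Fintype Λ] [Nonempty Λ] (μ : PMF A) (g : Λ → A → Bool)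
    (b : Bool) :
    ∑ l, (μ.map (g l)) b = ∑' x, μ x * ENNReal.ofReal (Fintype.card Λ * pr fun l => g l x = b) := by
  simp only [map_apply_eq_tsum]
  rw [← Summable.tsum_finsetSum fun l _ => ENNReal.summable]
  refine tsum_congr fun x => ?_
  rw [← Finset.mul_sum, ← ENNReal.ofReal_sum_of_nonneg fun l _ => ind_nonneg _,
    sum_eq_card_mul_avg, pr]

/-- Some deterministic algorithm in the support of a tester distinguishes a random graph with the
property from a random graph that is far from it. -/
theorem IsTester.exists_distinguishing {P : GraphProperty} {ε : ℝ} {N : ℕ} {A Λ : Type} [Fintype Λ]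
    [Nonempty Λ] {run : SimpleGraph (Fin N) → A → Bool} {μ : PMF A} (h : IsTester P ε run μ)
    (G₁ G₂ : Λ → SimpleGraph (Fin N)) (h1 : pr (fun l => ¬ P.Mem (G₁ l)) ≤ 1 / 20)
    (h2 : pr (fun l => ¬ IsFar P ε (G₂ l)) ≤ 1 / 20) :
    ∃ x ∈ μ.support, pr (fun l => run (G₂ l) x = true) + 1 / 10 < pr fun l => run (G₁ l) x = true := by
  by_contra! hcon
  have hc : (0 : ℝ) < Fintype.card Λ := Nat.cast_pos.2 Fintype.card_pos
  -- If no algorithm distinguished, the two success probabilities would average to a sum of at most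
  -- 11/10; a tester guarantees 2·(2/3)·(19/20) = 19/15.
  have hup : ∑ l, (μ.map (run (G₁ l))) true + ∑ l, (μ.map (run (G₂ l))) false ≤
      ENNReal.ofReal (Fintype.card Λ * (11 / 10)) := by
    rw [sum_map_apply_eq_tsum μ (fun l => run (G₁ l)), sum_map_apply_eq_tsum μ (fun l => run (G₂ l)),
      ← ENNReal.tsum_add]
    calc _ ≤ ∑' x, μ x * ENNReal.ofReal (Fintype.card Λ * (11 / 10)) := by
          refine ENNReal.tsum_le_tsum fun x => ?_
          by_cases hx : x ∈ μ.support
          · rw [← mul_add, ← ENNReal.ofReal_add (mul_nonneg hc.le (pr_nonneg _))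
              (mul_nonneg hc.le (pr_nonneg _)), ← mul_add]
            gcongr
            have e1 : pr (fun l => run (G₂ l) x = false) = 1 - pr fun l => run (G₂ l) x = true := by
              rw [← pr_not]
              exact pr_congr fun l => by simp
            have := hcon x hx
            rw [e1]
            linarith
          · rw [PMF.mem_support_iff, not_not] at hx
            rw [hx]
            simp
      _ = _ := by rw [ENNReal.tsum_mul_right, PMF.tsum_coe, one_mul]
  have h23 : (2 / 3 : ENNReal) = ENNReal.ofReal (2 / 3) := by
    rw [ENNReal.ofReal_div_of_pos (by norm_num)]
    norm_num
  have hlow : ∀ (G : Λ → SimpleGraph (Fin N)) (b : Bool) (R : SimpleGraph (Fin N) → Prop),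
      (∀ H, R H → 2 / 3 < (μ.map (run H)) b) → pr (fun l => ¬ R (G l)) ≤ 1 / 20 →
      ENNReal.ofReal (Fintype.card Λ * (2 / 3 * (19 / 20))) ≤ ∑ l, (μ.map (run (G l))) b := by
    intro G b R hR hpr
    have h3 : (19 / 20 : ℝ) ≤ pr fun l => R (G l) := by
      rw [pr_not] at hpr
      linarith
    calc ENNReal.ofReal (Fintype.card Λ * (2 / 3 * (19 / 20)))
        ≤ ENNReal.ofReal (∑ l, 2 / 3 * ind (R (G l))) := by
          refine ENNReal.ofReal_le_ofReal ?_
          rw [← Finset.mul_sum, sum_eq_card_mul_avg, ← pr]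
          nlinarith
      _ = ∑ l, ENNReal.ofReal (2 / 3 * ind (R (G l))) :=
          ENNReal.ofReal_sum_of_nonneg fun l _ => mul_nonneg (by norm_num) (ind_nonneg _)
      _ ≤ _ := by
          refine Finset.sum_le_sum fun l _ => ?_
          by_cases hl : R (G l)
          · rw [ind_of hl, mul_one, ← h23]
            exact (hR _ hl).le
          · rw [ind_of_not hl, mul_zero, ENNReal.ofReal_zero]
            exact zero_le
  have h3 := (add_le_add (hlow G₁ true _ h.1 h1) (hlow G₂ false _ h.2 h2)).trans hup
  rw [← ENNReal.ofReal_add (by positivity) (by positivity),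
    ENNReal.ofReal_le_ofReal_iff (by positivity)] at h3
  nlinarith

/-! ### The adaptive lower bound -/

/-- Follow the branch on which every answer is "no edge": a graph with no edge among its queries is
indistinguishable from the empty graph. -/
theorem DecisionTree.exists_path {N : ℕ} (T : DecisionTree N) :
    ∃ l : List (Fin N × Fin N), l.length ≤ T.queryCount ∧
      ∀ G : SimpleGraph (Fin N), (∀ p ∈ l, ¬ G.Adj p.1 p.2) → T.run G = T.run ⊥ := by
  classical
  induction T with
  | answer b => exact ⟨[], le_rfl, fun G _ => rfl⟩
  | query u v T₁ T₀ _ ih₀ =>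
    obtain ⟨l, hl, h⟩ := ih₀
    refine ⟨(u, v) :: l, ?_, fun G hG => ?_⟩
    · rw [List.length_cons, DecisionTree.queryCount]
      have := le_max_right T₁.queryCount T₀.queryCount
      omega
    · have h1 := hG (u, v) List.mem_cons_self
      simp only at h1
      rw [DecisionTree.run, DecisionTree.run, if_neg h1, if_neg (by simp)]
      exact h G fun p hp => hG p (List.mem_cons_of_mem _ hp)

theorem pr_exists_mem_list_le {A Λ : Type} [Fintype Λ] (l : List A) (P : A → Λ → Prop) {a : ℝ}
    (h : ∀ x, pr (P x) ≤ a) : pr (fun ω => ∃ x ∈ l, P x ω) ≤ l.length * a := by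
  induction l with
  | nil =>
    rw [pr_eq_zero fun ω hω => by simp at hω]
    simp
  | cons x l ih =>
    refine (pr_mono fun ω hω => ?_).trans ((pr_or_le (P x) fun ω => ∃ x ∈ l, P x ω).trans
      ((add_le_add (h x) ih).trans (le_of_eq ?_)))
    · simpa using hω
    · push_cast [List.length_cons]
      ring

theorem pr_comap_baseGraph_adj_le {V : Type} [Fintype V] [DecidableEq V] {t B : ℕ} (ht : 3 ≤ t)
    (hB : 0 < B) (u v : V) :
    pr (fun f : V → Cell t B => ((baseGraph t B).comap f).Adj u v) ≤ 2 / (t * B : ℝ) := by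
  have : Nonempty (Cell t B) := ⟨(⟨0, hB⟩, ⟨0, by omega⟩, true)⟩
  by_cases huv : v = u
  · rw [pr_eq_zero fun f hf => hf.ne huv.symm]
    positivity
  · have h := pr_and_adj_le (V := Cell t B) (H := baseGraph t B) huv (P := fun _ => True)
      (fun _ _ => Iff.rfl) (fun f _ => pr_baseGraph_adj_le ht (f u))
    rw [pr_eq_one fun _ => trivial, mul_one] at h
    refine le_trans (pr_mono fun f hf => ?_) h
    exact ⟨trivial, hf⟩

/-- The empty graph has the property, so a tester must tell it from the far random cover graph. On
the branch of negative answers each query meets an edge with probability at most 2/(tB), so few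
queries rarely see one. -/
theorem lt_of_adaptivelyTestable {t B : ℕ} (ht : 5 ≤ t) (hB0 : 0 < B) {c ε : ℝ} (hcε : 0 ≤ c * ε)
    (hB : 32 * t ^ 2 * ε * B ≤ 1) {q : ℕ}
    (h : AdaptivelyTestable (lowDegreeBlowUpCollection (SimpleGraph.cycleGraph t) (c * ε)) ε q) :
    1 / 10 < q * (2 / (t * B : ℝ)) := by
  classical
  have : Nonempty (Cell t B) := ⟨(⟨0, hB0⟩, ⟨0, by omega⟩, true)⟩
  obtain ⟨s, hs, hbal⟩ := exists_pr_not_balanced_le (Cell t B)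
  have hcard : Fintype.card (Cell t B) = B * (t * 2) := by simp
  set N := 2 * s * Fintype.card (Cell t B) with hN
  have hN' : N = 4 * s * t * B := by rw [hN, hcard]; ring
  have hN0 : 0 < N := by rw [hN']; positivity
  obtain ⟨μ, hμ, htest⟩ := h N hN0
  obtain ⟨T, hT, hlt⟩ := htest.exists_distinguishing (Λ := Fin N → Cell t B) (fun _ => ⊥)
    (fun f => (coverGraph t B).comap f)
    (by
      rw [pr_eq_zero fun f hf => hf (mem_bot ht hcε)]
      norm_num)
    ((pr_mono fun f hf hb => hf (isFar_comap_coverGraph ht hs hN' hN0 hB hb)).trans hbal)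
  obtain ⟨l, hl, hpath⟩ := T.exists_path
  have h1 : pr (fun _ : Fin N → Cell t B => T.run ⊥ = true) ≤
      pr (fun f : Fin N → Cell t B => T.run ((coverGraph t B).comap f) = true) +
      l.length * (2 / (t * B : ℝ)) := by
    refine (pr_mono fun f hf => ?_).trans ((pr_or_le _ _).trans (add_le_add le_rfl
      (pr_exists_mem_list_le l (fun p (f : Fin N → Cell t B) =>
        ((baseGraph t B).comap f).Adj p.1 p.2) fun p =>
          pr_comap_baseGraph_adj_le (by omega) hB0 p.1 p.2)))
    by_cases hex : ∃ p ∈ l, ((baseGraph t B).comap f).Adj p.1 p.2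
    · exact Or.inr hex
    · left
      rw [hpath _ fun p hp (hadj : (coverGraph t B).Adj (f p.1) (f p.2)) => hex ⟨p, hp, hadj.1⟩]
      exact hf
  have h2 : (l.length : ℝ) ≤ q := by exact_mod_cast hl.trans (hμ T hT)
  have h3 : (l.length : ℝ) * (2 / (t * B : ℝ)) ≤ q * (2 / (t * B : ℝ)) := by gcongr
  linarith


/-! ### Gauges -/

section Gauge

variable {V : Type} {t : ℕ}

/-- A choice of sheets that turns the double cover of the cycle into the trivial one along the edges
of `F`. -/
def IsGauge (F : SimpleGraph V) (i : V → Fin t) (s : V → Bool) : Prop :=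
  ∀ u v, F.Adj u v → (s u ^^ s v) = wraps (i u) (i v)

theorem eq_of_walk {F : SimpleGraph V} (g : V → Bool) {u v : V} (p : F.Walk u v)
    (h : ∀ a ∈ p.support, ∀ b ∈ p.support, F.Adj a b → g a = g b) : g u = g v := by
  induction p with
  | nil => rfl
  | cons hadj p ih =>
    rw [h _ (SimpleGraph.Walk.start_mem_support _) _
      (by rw [SimpleGraph.Walk.support_cons]; exact List.mem_cons_of_mem _ p.start_mem_support) hadj]
    refine ih fun a ha b hb => h a ?_ b ?_
    · rw [SimpleGraph.Walk.support_cons]; exact List.mem_cons_of_mem _ ha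
    · rw [SimpleGraph.Walk.support_cons]; exact List.mem_cons_of_mem _ hb

/-- Removing the position `j` cuts the cycle into an interval. Being beyond `j` then changes only
across the wrapping edge, so it is a gauge away from `j`. -/
theorem lt_xor_lt_eq_wraps (ht : 3 ≤ t) {a b j : Fin t} (hab : (SimpleGraph.cycleGraph t).Adj a b)
    (ha : a ≠ j) (hb : b ≠ j) : (decide (j < a) ^^ decide (j < b)) = wraps a b := by
  rw [cycle_adj_iff ht] at hab
  have ha' : a.val ≠ j.val := fun h => ha (Fin.ext h)
  have hb' : b.val ≠ j.val := fun h => hb (Fin.ext h)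
  have hj := j.isLt
  unfold wraps
  simp only [Fin.lt_def]
  by_cases h1 : j.val < a.val <;> by_cases h2 : j.val < b.val <;>
    simp only [h1, h2, decide_true, decide_false, Bool.xor_self, Bool.xor_false, Bool.xor_true,
      Bool.not_false] <;> symm <;>
    simp only [decide_eq_true_eq, decide_eq_false_iff_not] <;> omega

/-- If a graph over the cycle has no gauge, then it has a closed walk through at least `t` distinct
vertices. -/
theorem exists_long_cycle_of_no_gauge [Finite V] (ht : 3 ≤ t) {R : SimpleGraph V} {i : V → Fin t}
    (hi : ∀ u v, R.Adj u v → (SimpleGraph.cycleGraph t).Adj (i u) (i v))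
    (hno : ¬ ∃ s, IsGauge R i s) :
    ∃ (u v : V) (q : R.Walk v u), R.Adj u v ∧ q.IsPath ∧ t ≤ q.length + 1 := by
  classical
  -- Take a maximal subgraph that has a gauge; adding any missing edge `u v` of `R` must close a
  -- cycle that obstructs every gauge.
  obtain ⟨F, hF⟩ := (Set.toFinite {F : SimpleGraph V | F ≤ R ∧ ∃ s, IsGauge F i s}).exists_maximal
    ⟨⊥, bot_le, fun _ => false, fun u v h => h.elim⟩
  obtain ⟨hFR, s, hs⟩ := hF.prop
  obtain ⟨u, v, hR, hFuv⟩ : ∃ u v, R.Adj u v ∧ ¬ F.Adj u v := by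
    by_contra! hcon
    exact hno ⟨s, fun u v h => hs u v (hcon u v h)⟩
  have hext : ∀ s' : V → Bool, IsGauge F i s' → (s' u ^^ s' v) ≠ wraps (i u) (i v) := by
    intro s' hs' he
    have hmem : F ⊔ SimpleGraph.edge u v ∈ {F : SimpleGraph V | F ≤ R ∧ ∃ s, IsGauge F i s} := by
      refine ⟨sup_le hFR ?_, s', fun a b hab => ?_⟩
      · intro a b hab
        rw [SimpleGraph.edge_adj] at hab
        rcases hab.1 with ⟨rfl, rfl⟩ | ⟨rfl, rfl⟩
        · exact hR
        · exact hR.symm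
      · rcases hab with hab | hab
        · exact hs' a b hab
        · rw [SimpleGraph.edge_adj] at hab
          rcases hab.1 with ⟨rfl, rfl⟩ | ⟨rfl, rfl⟩
          · exact he
          · rw [Bool.xor_comm, he, wraps_comm]
    have hle := hF.le_of_ge hmem le_sup_left
    refine hFuv (hle ?_)
    refine Or.inr ?_
    rw [SimpleGraph.edge_adj]
    exact ⟨Or.inl ⟨rfl, rfl⟩, hR.ne⟩
  have hsuv := hext s hs
  have hreach : F.Reachable v u := by
    by_contra hnr
    -- If `u` and `v` were in different components, flipping `s` on the component of `v` would keep
    -- it a gauge of `F` and repair the edge `u v`.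
    refine hext (fun x => s x ^^ decide (F.Reachable v x)) (fun a b hab => ?_) ?_
    · have : F.Reachable v a ↔ F.Reachable v b :=
        ⟨fun h => h.trans hab.reachable, fun h => h.trans hab.symm.reachable⟩
      rw [← hs a b hab]
      simp only [this]
      cases s a <;> cases s b <;> cases decide (F.Reachable v b) <;> rfl
    · simp only [hnr, SimpleGraph.Reachable.refl, decide_true, decide_false]
      revert hsuv
      cases s u <;> cases s v <;> cases wraps (i u) (i v) <;> simp
  obtain ⟨p, hp⟩ := hreach.exists_isPath
  refine ⟨u, v, p.mapLe hFR, hR, hp.mapLe hFR, ?_⟩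
  rw [SimpleGraph.Walk.length_mapLe]
  by_contra! hlt
  obtain ⟨j, hj⟩ : ∃ j : Fin t, j ∉ (p.support.map i).toFinset := by
    by_contra! hall
    have h1 : (Finset.univ : Finset (Fin t)) ⊆ (p.support.map i).toFinset := fun j _ => hall j
    have h2 := (Finset.card_le_card h1).trans (List.toFinset_card_le _)
    rw [Finset.card_univ, Fintype.card_fin, List.length_map, SimpleGraph.Walk.length_support] at h2
    omega
  have hne : ∀ x ∈ p.support, i x ≠ j := fun x hx h =>
    hj (by rw [List.mem_toFinset, List.mem_map]; exact ⟨x, hx, h⟩)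
  -- Along a path that misses the position `j`, the gauge `s` and the gauge from cutting at `j`
  -- differ by a constant. So `s` also fits the closing edge, a contradiction.
  have hg := eq_of_walk (fun x => s x ^^ decide (j < i x)) p fun a ha b hb hab => by
    have h1 := hs a b hab
    rw [← lt_xor_lt_eq_wraps ht (hi a b (hFR hab)) (hne a ha) (hne b hb)] at h1
    revert h1
    cases s a <;> cases s b <;> cases decide (j < i a) <;> cases decide (j < i b) <;> simp
  apply hsuv
  rw [← lt_xor_lt_eq_wraps ht (hi u v hR) (hne u p.end_mem_support) (hne v p.start_mem_support)]
  revert hg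
  cases s u <;> cases s v <;> cases decide (j < i u) <;> cases decide (j < i v) <;> simp

end Gauge

/-! ### Counting closed walks -/

section Walks

variable {V : Type} [Fintype V] [DecidableEq V]

/-- The Frobenius norm is submultiplicative, by Cauchy–Schwarz. -/
theorem sum_sq_pow_le {A : Matrix V V ℝ} {D : ℝ} (hA : ∑ u, ∑ v, A u v ^ 2 ≤ D ^ 2)
    (k : ℕ) : ∑ u, ∑ v, (A ^ (k + 1)) u v ^ 2 ≤ (D ^ (k + 1)) ^ 2 := by
  induction k with
  | zero => simpa using hA
  | succ k ih =>
    calc ∑ u, ∑ v, (A ^ (k + 1 + 1)) u v ^ 2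
        ≤ ∑ u, ∑ v, (∑ w, (A ^ (k + 1)) u w ^ 2) * ∑ w, A w v ^ 2 := by
          refine Finset.sum_le_sum fun u _ => Finset.sum_le_sum fun v _ => ?_
          rw [pow_succ A, Matrix.mul_apply]
          exact Finset.sum_mul_sq_le_sq_mul_sq _ _ _
      _ = (∑ u, ∑ w, (A ^ (k + 1)) u w ^ 2) * ∑ w, ∑ v, A w v ^ 2 := by
          rw [Finset.sum_mul]
          refine Finset.sum_congr rfl fun u _ => ?_
          rw [← Finset.mul_sum, Finset.sum_comm]
      _ ≤ (D ^ (k + 1)) ^ 2 * D ^ 2 := by gcongr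
      _ = _ := by ring

/-- The left side is the trace of A^(k+2); Cauchy–Schwarz bounds it by the Frobenius norms of A and
A^(k+1). -/
theorem sum_mul_pow_le {A : Matrix V V ℝ} {D : ℝ} (hD : 0 ≤ D) (hA : ∑ u, ∑ v, A u v ^ 2 ≤ D ^ 2)
    (k : ℕ) : ∑ u, ∑ v, A u v * (A ^ (k + 1)) v u ≤ D ^ (k + 2) := by
  refine abs_le_of_sq_le_sq' ?_ (by positivity) |>.2
  have h1 := sum_sq_pow_le hA k
  calc (∑ u, ∑ v, A u v * (A ^ (k + 1)) v u) ^ 2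
      = (∑ q : V × V, A q.1 q.2 * (A ^ (k + 1)) q.2 q.1) ^ 2 := by rw [Fintype.sum_prod_type]
    _ ≤ (∑ q : V × V, A q.1 q.2 ^ 2) * ∑ q : V × V, (A ^ (k + 1)) q.2 q.1 ^ 2 :=
        Finset.sum_mul_sq_le_sq_mul_sq _ _ _
    _ = (∑ u, ∑ v, A u v ^ 2) * ∑ u, ∑ v, (A ^ (k + 1)) u v ^ 2 := by
        rw [Fintype.sum_prod_type, Fintype.sum_prod_type_right]
    _ ≤ D ^ 2 * (D ^ (k + 1)) ^ 2 := by gcongr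
    _ = _ := by ring

/-- The number of closed walks in a graph with few edges. -/
theorem sum_card_walks_le (Q : SimpleGraph V) [DecidableRel Q.Adj] {D : ℝ} (hD : 0 ≤ D)
    (hQ : ((Finset.univ.filter fun p : V × V => Q.Adj p.1 p.2).card : ℝ) ≤ D ^ 2) (k : ℕ) :
    ∑ p ∈ Finset.univ.filter (fun p : V × V => Q.Adj p.1 p.2),
      ((Q.finsetWalkLength (k + 1) p.2 p.1).card : ℝ) ≤ D ^ (k + 2) := by
  have h1 : ∑ u, ∑ v, Q.adjMatrix ℝ u v ^ 2 ≤ D ^ 2 := by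
    refine le_trans (le_of_eq ?_) hQ
    rw [← Fintype.sum_prod_type fun p : V × V => Q.adjMatrix ℝ p.1 p.2 ^ 2, Finset.card_filter]
    push_cast
    refine Finset.sum_congr rfl fun p _ => ?_
    rw [SimpleGraph.adjMatrix_apply]
    split_ifs <;> simp
  refine le_trans (le_of_eq ?_) (sum_mul_pow_le hD h1 k)
  rw [← Fintype.sum_prod_type fun p : V × V =>
    Q.adjMatrix ℝ p.1 p.2 * (Q.adjMatrix ℝ ^ (k + 1)) p.2 p.1, Finset.sum_filter]
  refine Finset.sum_congr rfl fun p _ => ?_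
  rw [SimpleGraph.adjMatrix_apply, SimpleGraph.adjMatrix_pow_apply_eq_card_walk,
    SimpleGraph.card_set_walk_length_eq]
  split_ifs <;> simp

/-- The vertices are distinct, so after fixing the labels of the tail, the label of the head is
fresh and contributes one factor `a`. -/
theorem pr_isChain_le {A : Type} [Fintype A] [Nonempty A] {H : SimpleGraph A} {a : ℝ} (ha : 0 ≤ a)
    (hdeg : ∀ z, pr (fun w => H.Adj z w) ≤ a) (x : V) (l : List V) (hl : (x :: l).Nodup) :
    pr (fun f : V → A => List.IsChain (H.comap f).Adj (x :: l)) ≤ a ^ l.length := by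
  induction l generalizing x with
  | nil =>
    rw [List.length_nil, pow_zero]
    exact pr_le_one _
  | cons y l ih =>
    have hy := ih y hl.of_cons
    have hx : x ∉ y :: l := (List.nodup_cons.1 hl).1
    have hxy : x ≠ y := fun h => hx (h ▸ List.mem_cons_self)
    have h1 := pr_and_adj_le (V := A) (H := H) (ρ := a) hxy
      (P := fun f : V → A => List.IsChain (H.comap f).Adj (y :: l)) (fun f z => by
        have hcong : ∀ m : List V, x ∉ m → (List.IsChain (H.comap (Function.update f x z)).Adj m ↔
            List.IsChain (H.comap f).Adj m) := by
          intro m hm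
          have hne : ∀ u ∈ m, Function.update f x z u = f u := fun u hu =>
            Function.update_of_ne (fun h : u = x => hm (h ▸ hu)) _ _
          constructor
          · refine fun h => h.imp_of_mem_imp fun u v hu hv huv => ?_
            rwa [SimpleGraph.comap_adj, hne u hu, hne v hv] at huv
          · refine fun h => h.imp_of_mem_imp fun u v hu hv huv => ?_
            rwa [SimpleGraph.comap_adj, hne u hu, hne v hv]
        exact hcong _ hx) (fun f _ => hdeg (f y))
    calc pr (fun f : V → A => List.IsChain (H.comap f).Adj (x :: y :: l))
        ≤ pr fun f : V → A => List.IsChain (H.comap f).Adj (y :: l) ∧ H.Adj (f y) (f x) := by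
          refine pr_mono fun f hf => ?_
          rw [List.isChain_cons_cons] at hf
          exact ⟨hf.2, hf.1.symm⟩
      _ ≤ a * a ^ l.length := h1.trans (by gcongr)
      _ = _ := by rw [List.length_cons, pow_succ']

end Walks


/-! ### The non-adaptive lower bound -/

section

variable {V : Type} {t B : ℕ}

/-- The pairs in `Q` whose labels are in the same copy and over adjacent vertices of the cycle. -/
def linkGraph (Q : SimpleGraph V) (β : V → Fin B × Fin t) : SimpleGraph V where
  Adj u v := Q.Adj u v ∧ (β u).1 = (β v).1 ∧ (SimpleGraph.cycleGraph t).Adj (β u).2 (β v).2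
  symm := ⟨fun _ _ h => ⟨h.1.symm, h.2.1.symm, h.2.2.symm⟩⟩
  loopless := ⟨fun _ h => h.1.ne rfl⟩

open Classical in
/-- A gauge for the graph of linked pairs, if there is one. -/
noncomputable def chosenGauge (Q : SimpleGraph V) (β : V → Fin B × Fin t) : V → Bool :=
  if h : ∃ s, IsGauge (linkGraph Q β) (fun v => (β v).2) s then h.choose else fun _ => false

theorem chosenGauge_spec {Q : SimpleGraph V} {β : V → Fin B × Fin t}
    (h : ∃ s, IsGauge (linkGraph Q β) (fun v => (β v).2) s) :
    IsGauge (linkGraph Q β) (fun v => (β v).2) (chosenGauge Q β) := by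
  unfold chosenGauge
  rw [dif_pos h]
  exact h.choose_spec

/-- Changing the sheets according to the chosen gauge. -/
noncomputable def gaugeEquiv (Q : SimpleGraph V) : (V → Cell t B) ≃ (V → Cell t B) where
  toFun f v := ((f v).1, (f v).2.1, (f v).2.2 ^^ chosenGauge Q (fun v => ((f v).1, (f v).2.1)) v)
  invFun f v := ((f v).1, (f v).2.1, (f v).2.2 ^^ chosenGauge Q (fun v => ((f v).1, (f v).2.1)) v)
  -- The chosen gauge depends only on the copies and cycle positions, which the map leaves
  -- unchanged, so the map is an involution.
  left_inv f := by
    funext v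
    simp only [Bool.xor_assoc, Bool.xor_self, Bool.xor_false]
  right_inv f := by
    funext v
    simp only [Bool.xor_assoc, Bool.xor_self, Bool.xor_false]

/-- On a linked pair the change of sheets alters their xor by exactly the wrapping bit, which turns
the rule of one covering into that of the other; on a queried pair that is not linked both graphs
have no edge. -/
theorem splitGraph_gaugeEquiv_adj_iff {Q : SimpleGraph V} {f : V → Cell t B}
    (h : ∃ s, IsGauge (linkGraph Q fun v => ((f v).1, (f v).2.1)) (fun v => (f v).2.1) s) {u v : V}
    (huv : Q.Adj u v) :
    ((splitGraph t B).comap (gaugeEquiv Q f)).Adj u v ↔ ((coverGraph t B).comap f).Adj u v := by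
  have hs := chosenGauge_spec h
  refine and_congr_right fun (hb : (baseGraph t B).Adj (f u) (f v)) => ?_
  have h1 := hs u v ⟨huv, hb.1, hb.2⟩
  beta_reduce at h1
  rw [← h1]
  simp only [gaugeEquiv, Equiv.coe_fn_mk]
  cases (f u).2.2 <;> cases (f v).2.2 <;>
    cases chosenGauge Q (fun v => ((f v).1, (f v).2.1)) u <;>
    cases chosenGauge Q (fun v => ((f v).1, (f v).2.1)) v <;> simp

/-- A random labelling is unlikely to have no gauge on a graph with few edges. -/
theorem pr_no_gauge_le [Fintype V] [DecidableEq V] (ht : 3 ≤ t) (hB : 0 < B) (Q : SimpleGraph V) {D : ℝ}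
    (hD : 0 ≤ D) (hQ : (({p : V × V | Q.Adj p.1 p.2} : Set (V × V)).ncard : ℝ) ≤ D ^ 2)
    (hy : D * (2 / (t * B : ℝ)) ≤ 1 / 2) :
    pr (fun f : V → Cell t B => ¬ ∃ s, IsGauge (linkGraph Q fun v => ((f v).1, (f v).2.1))
      (fun v => (f v).2.1) s) ≤ 2 * D * (D * (2 / (t * B : ℝ))) ^ (t - 1) := by
  classical
  have : Nonempty (Cell t B) := ⟨(⟨0, hB⟩, ⟨0, by omega⟩, true)⟩
  set a : ℝ := 2 / (t * B : ℝ) with ha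
  have ha0 : 0 ≤ a := by positivity
  set E := Finset.univ.filter (fun p : V × V => Q.Adj p.1 p.2) with hE
  have hEc : (E.card : ℝ) ≤ D ^ 2 := by
    rw [← Set.ncard_coe_finset, hE, Finset.coe_filter]
    simpa using hQ
  set n := Fintype.card V
  have hwalk : ∀ k, ∀ p ∈ E, ∀ w : Q.Walk p.2 p.1, w.length = k →
      pr (fun f : V → Cell t B => w.support.Nodup ∧
        List.IsChain ((baseGraph t B).comap f).Adj w.support) ≤ a ^ k := by
    intro k p _ w hw
    by_cases hnd : w.support.Nodup
    · have h1 := w.length_support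
      rw [← SimpleGraph.Walk.cons_tail_support] at hnd h1 ⊢
      have h2 := pr_isChain_le ha0 (pr_baseGraph_adj_le ht) _ _ hnd
      rw [List.length_cons] at h1
      refine (pr_mono fun f hf => hf.2).trans (h2.trans_eq ?_)
      congr 1
      omega
    · rw [pr_eq_zero fun f hf => hnd hf.1]
      positivity
  -- At most D^(k+2) closed walks, and the k + 1 edges of the open path are all links with
  -- probability at most a^(k+1); the closing edge is only required to be queried.
  have hk : ∀ k, pr (fun f : V → Cell t B => ∃ p ∈ E, ∃ w ∈ Q.finsetWalkLength (k + 1) p.2 p.1,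
      w.support.Nodup ∧ List.IsChain ((baseGraph t B).comap f).Adj w.support) ≤
      D * (D * a) ^ (k + 1) := by
    intro k
    refine (pr_exists_le E fun p (f : V → Cell t B) =>
      ∃ w ∈ Q.finsetWalkLength (k + 1) p.2 p.1, w.support.Nodup ∧
        List.IsChain ((baseGraph t B).comap f).Adj w.support).trans ?_
    calc _ ≤ ∑ p ∈ E, ((Q.finsetWalkLength (k + 1) p.2 p.1).card : ℝ) * a ^ (k + 1) := by
          refine Finset.sum_le_sum fun p hp => ?_
          refine (pr_exists_le (Q.finsetWalkLength (k + 1) p.2 p.1) fun w (f : V → Cell t B) =>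
            w.support.Nodup ∧ List.IsChain ((baseGraph t B).comap f).Adj w.support).trans ?_
          rw [← nsmul_eq_mul]
          refine Finset.sum_le_card_nsmul _ _ _ fun w hw => ?_
          exact hwalk _ p hp w (SimpleGraph.mem_finsetWalkLength_iff.1 hw)
      _ ≤ D ^ (k + 2) * a ^ (k + 1) := by
          rw [← Finset.sum_mul]
          exact mul_le_mul_of_nonneg_right (sum_card_walks_le Q hD hEc k) (by positivity)
      _ = _ := by ring
  have h1 := pr_exists_le (Finset.Ico (t - 1) (n + t)) fun k (f : V → Cell t B) =>
    ∃ p ∈ E, ∃ w ∈ Q.finsetWalkLength k p.2 p.1,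
      w.support.Nodup ∧ List.IsChain ((baseGraph t B).comap f).Adj w.support
  -- Without a gauge there is a path of at least t - 1 linked pairs closed by a queried pair. Being
  -- a path, it has fewer edges than there are vertices, so finitely many lengths suffice, and they
  -- sum to a geometric series.
  refine (pr_mono fun f hf => ?_).trans (h1.trans ?_)
  · obtain ⟨u, v, q, hR, hq, hlen⟩ := exists_long_cycle_of_no_gauge ht
      (R := linkGraph Q fun v => ((f v).1, (f v).2.1)) (fun u v h => h.2.2) hf
    have hle : (linkGraph Q fun v => ((f v).1, (f v).2.1)) ≤ Q := fun u v h => h.1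
    refine ⟨q.length, Finset.mem_Ico.2 ⟨by omega, ?_⟩, (u, v), ?_, q.mapLe hle, ?_, ?_, ?_⟩
    · have : q.length < n := hq.length_lt
      omega
    · exact Finset.mem_filter.2 ⟨Finset.mem_univ _, hR.1⟩
    · rw [SimpleGraph.mem_finsetWalkLength_iff, SimpleGraph.Walk.length_mapLe]
    · rw [SimpleGraph.Walk.support_mapLe_eq_support]
      exact hq.support_nodup
    · rw [SimpleGraph.Walk.support_mapLe_eq_support]
      exact q.isChain_adj_support.imp fun x y h => ⟨h.2.1, h.2.2⟩
  · calc _ ≤ ∑ k ∈ Finset.Ico (t - 1) (n + t), D * (D * a) ^ k := by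
          refine Finset.sum_le_sum fun k hk' => ?_
          have := (Finset.mem_Ico.1 hk').1
          obtain ⟨k, rfl⟩ : ∃ k', k = k' + 1 := ⟨k - 1, by omega⟩
          exact hk k
      _ = D * ∑ k ∈ Finset.Ico (t - 1) (n + t), (D * a) ^ k := (Finset.mul_sum _ _ _).symm
      _ ≤ D * (2 * (D * a) ^ (t - 1)) := by
          gcongr
          have hDa : 0 ≤ D * a := by positivity
          refine (geom_sum_Ico_le_of_lt_one hDa (by linarith)).trans ?_
          rw [div_le_iff₀ (by linarith)]
          have : 0 ≤ (D * a) ^ (t - 1) := by positivity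
          nlinarith
      _ = _ := by ring

end

theorem NonAdaptiveAlgorithm.run_congr {N : ℕ} (A : NonAdaptiveAlgorithm N)
    {G G' : SimpleGraph (Fin N)} (h : ∀ p ∈ A.queries, G.Adj p.1 p.2 ↔ G'.Adj p.1 p.2) :
    A.run G = A.run G' := by
  classical
  unfold NonAdaptiveAlgorithm.run
  congr 1
  refine List.map_congr_left fun p hp => ?_
  simp only [h p hp]

/-- The change of sheets preserves the uniform distribution and makes both random graphs agree on
all queries, unless no gauge exists on the query graph. So the advantage of any algorithm is at most
the probability of that event. -/
theorem lt_of_nonAdaptivelyTestable {t B : ℕ} (ht : 5 ≤ t) (hB0 : 0 < B) {c ε : ℝ}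
    (hB : 32 * t ^ 2 * ε * B ≤ 1) (hB' : 2 ≤ c * ε * t * B) {q : ℕ}
    (h : NonAdaptivelyTestable (lowDegreeBlowUpCollection (SimpleGraph.cycleGraph t) (c * ε)) ε q)
    (hy : √(2 * q) * (2 / (t * B : ℝ)) ≤ 1 / 2) :
    1 / 10 < 2 * √(2 * q) * (√(2 * q) * (2 / (t * B : ℝ))) ^ (t - 1) := by
  classical
  have : Nonempty (Cell t B) := ⟨(⟨0, hB0⟩, ⟨0, by omega⟩, true)⟩
  obtain ⟨s, hs, hbal⟩ := exists_pr_not_balanced_le (Cell t B)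
  have hcard : Fintype.card (Cell t B) = B * (t * 2) := by simp
  set N := 2 * s * Fintype.card (Cell t B) with hN
  have hN' : N = 4 * s * t * B := by rw [hN, hcard]; ring
  have hN0 : 0 < N := by rw [hN']; positivity
  obtain ⟨μ, hμ, htest⟩ := h N hN0
  obtain ⟨A, hA, hlt⟩ := htest.exists_distinguishing (Λ := Fin N → Cell t B)
    (fun f => (splitGraph t B).comap f) (fun f => (coverGraph t B).comap f)
    ((pr_mono fun f hf hb => hf (mem_comap_splitGraph ht hN' hB' hb)).trans hbal)
    ((pr_mono fun f hf hb => hf (isFar_comap_coverGraph ht hs hN' hN0 hB hb)).trans hbal)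
  -- The symmetrized query set: at most 2q ordered pairs, hence D = √(2q).
  set Q : SimpleGraph (Fin N) :=
    { Adj := fun u v => u ≠ v ∧ ((u, v) ∈ A.queries ∨ (v, u) ∈ A.queries)
      symm := ⟨fun _ _ h => ⟨h.1.symm, h.2.symm⟩⟩
      loopless := ⟨fun _ h => h.1 rfl⟩ } with hQ
  have hQc : (({p : Fin N × Fin N | Q.Adj p.1 p.2} : Set (Fin N × Fin N)).ncard : ℝ) ≤
      √(2 * q) ^ 2 := by
    rw [Real.sq_sqrt (by positivity)]
    have hsub : {p : Fin N × Fin N | Q.Adj p.1 p.2} ⊆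
        ((A.queries ++ A.queries.map Prod.swap).toFinset : Set (Fin N × Fin N)) := by
      rintro ⟨u, v⟩ ⟨-, hp⟩
      rw [Finset.mem_coe, List.mem_toFinset, List.mem_append]
      rcases hp with hp | hp
      · exact Or.inl hp
      · exact Or.inr (List.mem_map.2 ⟨(v, u), hp, rfl⟩)
    have h1 := Set.ncard_le_ncard hsub (Finset.finite_toSet _)
    rw [Set.ncard_coe_finset] at h1
    have h2 := h1.trans (List.toFinset_card_le _)
    rw [List.length_append, List.length_map] at h2
    have h3 : A.queries.length ≤ q := hμ A hA
    exact_mod_cast (by omega : _ ≤ 2 * q)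
  have hgauge := pr_no_gauge_le (show 3 ≤ t by omega) hB0 Q (Real.sqrt_nonneg _) hQc hy
  have hle : pr (fun f : Fin N → Cell t B => A.run ((splitGraph t B).comap f) = true) ≤
      pr (fun f : Fin N → Cell t B => A.run ((coverGraph t B).comap f) = true) +
      pr (fun f : Fin N → Cell t B =>
        ¬ ∃ s, IsGauge (linkGraph Q fun v => ((f v).1, (f v).2.1)) (fun v => (f v).2.1) s) := by
    rw [← pr_equiv (gaugeEquiv Q) fun f : Fin N → Cell t B =>
      A.run ((splitGraph t B).comap f) = true]
    refine (pr_mono fun f hf => ?_).trans (pr_or_le _ _)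
    by_cases hex : ∃ s, IsGauge (linkGraph Q fun v => ((f v).1, (f v).2.1)) (fun v => (f v).2.1) s
    · left
      rw [← hf]
      refine (A.run_congr fun p hp => ?_).symm
      by_cases hne : p.1 = p.2
      · rw [hne]
        simp
      · exact splitGraph_gaugeEquiv_adj_iff hex ⟨hne, Or.inl hp⟩
    · exact Or.inr hex
  linarith


/-! ### The query complexities -/

/-- Farness requires B ≤ 1/(32t²ε), and taking the floor keeps B ≥ 1/(64t²ε). The degree bound for
the split graph then asks for c ≥ 128t, which is where the constant of the theorem comes from. -/
theorem exists_number_of_copies {t : ℕ} (ht : 0 < t) {ε : ℝ} (hε : 0 < ε)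
    (hε1 : 32 * t ^ 2 * ε ≤ 1) :
    ∃ B : ℕ, 0 < B ∧ 32 * t ^ 2 * ε * B ≤ 1 ∧ 2 ≤ 128 * t * ε * t * B ∧
      2 / (t * B : ℝ) ≤ 128 * t * ε := by
  have ht0 : (0 : ℝ) < t := by exact_mod_cast ht
  have hx : 0 < 32 * (t : ℝ) ^ 2 * ε := by positivity
  have h1 : 1 ≤ 1 / (32 * (t : ℝ) ^ 2 * ε) := by rwa [le_div_iff₀ hx, one_mul]
  set B := ⌊1 / (32 * (t : ℝ) ^ 2 * ε)⌋₊ with hB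
  have hB1 : 1 ≤ B := Nat.one_le_floor_iff _ |>.2 h1
  have hB1' : (1 : ℝ) ≤ B := by exact_mod_cast hB1
  have h2 : (B : ℝ) ≤ 1 / (32 * (t : ℝ) ^ 2 * ε) := Nat.floor_le (by positivity)
  have h3 : 1 / (32 * (t : ℝ) ^ 2 * ε) < B + 1 := Nat.lt_floor_add_one _
  rw [le_div_iff₀ hx] at h2
  rw [div_lt_iff₀ hx] at h3
  have h4 : 1 ≤ 2 * B * (32 * (t : ℝ) ^ 2 * ε) := by nlinarith
  refine ⟨B, hB1, by linarith, by nlinarith, ?_⟩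
  rw [div_le_iff₀ (by positivity)]
  nlinarith

theorem eventually_le_of_adaptivelyTestable {t : ℕ} (ht : 8 ≤ t) :
    ∃ κ : ℝ, 0 < κ ∧ ∀ᶠ ε in 𝓝[>] (0 : ℝ), ∀ q : ℕ,
      AdaptivelyTestable (lowDegreeBlowUpCollection (SimpleGraph.cycleGraph t) (128 * t * ε)) ε q →
      κ * ε⁻¹ ≤ q := by
  have ht0 : (0 : ℝ) < t := by exact_mod_cast (by omega : 0 < t)
  refine ⟨1 / (1280 * t), by positivity, ?_⟩
  have hev : ∀ᶠ ε in 𝓝[>] (0 : ℝ), ε ∈ Set.Ioo (0 : ℝ) (1 / (32 * t ^ 2)) :=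
    Ioo_mem_nhdsGT (by positivity)
  filter_upwards [hev] with ε ⟨hε, hε1⟩ q hq
  rw [lt_div_iff₀ (by positivity)] at hε1
  obtain ⟨B, hB0, hB, -, ha⟩ := exists_number_of_copies (by omega : 0 < t) hε (by linarith)
  have h1 := lt_of_adaptivelyTestable (by omega) hB0 (by positivity) hB hq
  have h2 : (1 : ℝ) / 10 ≤ q * (128 * t * ε) := h1.le.trans (by gcongr)
  rw [← div_eq_mul_inv, div_le_iff₀ hε, div_le_iff₀ (by positivity)]
  nlinarith

/-- Solves D^t a^(t-1) ≥ 1/20 with D = √(2q) and a = O(ε) for q. -/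
theorem eventually_le_of_nonAdaptivelyTestable {t : ℕ} (ht : 8 ≤ t) :
    ∃ κ : ℝ, 0 < κ ∧ ∀ᶠ ε in 𝓝[>] (0 : ℝ), ∀ q : ℕ,
      NonAdaptivelyTestable
        (lowDegreeBlowUpCollection (SimpleGraph.cycleGraph t) (128 * t * ε)) ε q →
      κ * ε⁻¹ ^ (2 - 2 / (t : ℝ)) ≤ q := by
  have ht0 : (0 : ℝ) < t := by exact_mod_cast (by omega : 0 < t)
  set κ₀ : ℝ := 1 / (20 * (128 * t) ^ (t - 1)) with hκ₀
  have hκ₀pos : 0 < κ₀ := by positivity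
  refine ⟨κ₀ ^ (2 / (t : ℝ)) / 2, by positivity, ?_⟩
  have hev : ∀ᶠ ε in 𝓝[>] (0 : ℝ), ε ∈ Set.Ioo (0 : ℝ)
      (min (1 / (32 * t ^ 2)) (1 / (128 * t * 2 ^ t))) :=
    Ioo_mem_nhdsGT (lt_min (by positivity) (by positivity))
  filter_upwards [hev] with ε ⟨hε, hεlt⟩ q hq
  have hε1 := hεlt.trans_le (min_le_left _ _)
  have hε2 := hεlt.trans_le (min_le_right _ _)
  rw [lt_div_iff₀ (by positivity)] at hε1 hε2
  obtain ⟨B, hB0, hB, hB', ha⟩ := exists_number_of_copies (by omega : 0 < t) hε (by linarith)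
  set a : ℝ := 2 / (t * B : ℝ) with hadef
  have ha0 : 0 < a := by positivity
  set D : ℝ := √(2 * q) with hD
  have hD0 : 0 ≤ D := Real.sqrt_nonneg _
  have hkey : 1 / 20 ≤ D ^ t * a ^ (t - 1) := by
    obtain ⟨n, rfl⟩ : ∃ n, t = n + 1 := ⟨t - 1, by omega⟩
    rw [Nat.add_sub_cancel]
    have e : D ^ (n + 1) * a ^ n = D * (D * a) ^ n := by ring
    rw [e]
    by_cases hy : D * a ≤ 1 / 2
    · have h1 := lt_of_nonAdaptivelyTestable (by omega) hB0 hB hB' hq hy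
      rw [Nat.add_sub_cancel] at h1
      linarith
    -- Here the geometric series is unavailable, but Da > 1/2 with a tiny makes D at least 2^(t-1),
    -- so the inequality holds outright.
    · rw [not_le] at hy
      have h2 : (1 / 2 : ℝ) ^ n ≤ (D * a) ^ n := by gcongr
      have h3 : a * 2 ^ (n + 1) ≤ 1 := by
        calc a * 2 ^ (n + 1) ≤ 128 * ((n + 1 : ℕ) : ℝ) * ε * 2 ^ (n + 1) := by gcongr
          _ ≤ 1 := by nlinarith
      have h5 : (2 : ℝ) ^ n ≤ D := by
        have h6 : a * 2 ^ (n + 1) ≤ 2 * (D * a) := h3.trans (by linarith)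
        have h7 : a * 2 ^ n ≤ a * D := by rw [pow_succ] at h6; linarith
        exact le_of_mul_le_mul_left h7 ha0
      calc (1 / 20 : ℝ) ≤ 2 ^ n * (1 / 2) ^ n := by
            rw [← mul_pow]
            norm_num
        _ ≤ _ := by gcongr
  have hDt : κ₀ * ε⁻¹ ^ (t - 1) ≤ D ^ t := by
    have h1 : 1 / 20 ≤ D ^ t * (128 * t * ε) ^ (t - 1) := hkey.trans (by gcongr)
    have h2 : κ₀ * ε⁻¹ ^ (t - 1) = 1 / 20 / (128 * t * ε) ^ (t - 1) := by
      rw [hκ₀, mul_pow (128 * (t : ℝ)) ε, inv_pow]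
      field_simp
    rw [h2, div_le_iff₀ (by positivity)]
    exact h1
  have h1 := Real.rpow_le_rpow (by positivity) hDt (show (0 : ℝ) ≤ 2 / t by positivity)
  have h2 : (D ^ t) ^ (2 / (t : ℝ)) = 2 * q := by
    rw [← Real.rpow_natCast, ← Real.rpow_mul hD0, mul_div_cancel₀ _ ht0.ne']
    rw [show (2 : ℝ) = ((2 : ℕ) : ℝ) by norm_num, Real.rpow_natCast, hD,
      Real.sq_sqrt (by positivity)]
    norm_num
  have h3 : (κ₀ * ε⁻¹ ^ (t - 1)) ^ (2 / (t : ℝ)) = κ₀ ^ (2 / (t : ℝ)) * ε⁻¹ ^ (2 - 2 / (t : ℝ)) := by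
    rw [Real.mul_rpow hκ₀pos.le (by positivity), ← Real.rpow_natCast ε⁻¹,
      ← Real.rpow_mul (by positivity)]
    congr 2
    rw [Nat.cast_sub (by omega)]
    field_simp
    push_cast
    ring
  rw [h2, h3] at h1
  linarith

/-- Two-sided bounds with powers of `log ε⁻¹` yield `Θ̃`-estimates. -/
theorem isSoftTheta_of_bounds {q Q : ℝ → ℕ} {p κ K κ' K' : ℝ} (hp1 : 1 ≤ p) (hp2 : p ≤ 2)
    (hκ : 0 < κ) (hK : 0 < K) (hκ' : 0 < κ') (hK' : 0 < K')
    (h1 : ∀ᶠ ε in 𝓝[>] (0 : ℝ), κ * ε⁻¹ ≤ q ε)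
    (h2 : ∀ᶠ ε in 𝓝[>] (0 : ℝ), (q ε : ℝ) ≤ K * (ε⁻¹ * Real.log ε⁻¹ ^ 3))
    (h3 : ∀ᶠ ε in 𝓝[>] (0 : ℝ), κ' * ε⁻¹ ^ p ≤ Q ε)
    (h4 : ∀ᶠ ε in 𝓝[>] (0 : ℝ), (Q ε : ℝ) ≤ K' * (ε⁻¹ ^ p * Real.log ε⁻¹ ^ 3)) :
    IsSoftTheta (𝓝[>] (0 : ℝ)) (fun ε => (q ε : ℝ)) (fun ε => ε⁻¹) ∧
      IsSoftTheta (𝓝[>] (0 : ℝ)) (fun ε => (Q ε : ℝ)) (fun ε => (q ε : ℝ) ^ p) := by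
  have hlog : ∀ᶠ ε in 𝓝[>] (0 : ℝ), 0 < ε ∧ 2 ≤ Real.log ε⁻¹ ∧ -Real.log κ ≤ Real.log ε⁻¹ / 2 := by
    have ht : Tendsto (fun ε : ℝ => Real.log ε⁻¹) (𝓝[>] 0) atTop :=
      Real.tendsto_log_atTop.comp tendsto_inv_nhdsGT_zero
    filter_upwards [self_mem_nhdsWithin, ht.eventually_ge_atTop 2,
      ht.eventually_ge_atTop (2 * -Real.log κ)] with ε h1 h2 h3
    exact ⟨h1, h2, by linarith⟩
  -- Since q ≥ κ/ε and p ≥ 1, powers of log ε⁻¹ can be replaced by powers of log (q^p).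
  have hL : ∀ᶠ ε in 𝓝[>] (0 : ℝ), 1 ≤ Real.log ((q ε : ℝ) ^ p) ∧
      Real.log ε⁻¹ ≤ 2 * Real.log ((q ε : ℝ) ^ p) := by
    filter_upwards [hlog, h1] with ε ⟨hε, hl2, hlκ⟩ hq
    have hq0 : 0 < (q ε : ℝ) := lt_of_lt_of_le (by positivity) hq
    have h5 := Real.log_le_log (by positivity) hq
    rw [Real.log_mul hκ.ne' (by positivity)] at h5
    rw [Real.log_rpow hq0]
    have h6 : Real.log ε⁻¹ / 2 ≤ Real.log (q ε) := by linarith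
    have h7 : Real.log (q ε) ≤ p * Real.log (q ε) :=
      le_mul_of_one_le_left (by linarith) hp1
    constructor <;> linarith
  -- Raising q to the power p ≤ 2 turns the third power of the logarithm into at most the sixth.
  refine ⟨⟨3, ?_, ?_⟩, 6, ?_, ?_⟩
  · refine Asymptotics.IsBigO.of_bound K ?_
    filter_upwards [h2, hlog] with ε hq ⟨hε, hl, _⟩
    rw [Real.norm_of_nonneg (by positivity), Real.norm_of_nonneg (by positivity)]
    exact hq
  · refine Asymptotics.IsBigO.of_bound κ⁻¹ ?_
    filter_upwards [h1, hlog] with ε hq ⟨hε, hl, _⟩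
    rw [Real.norm_of_nonneg (by positivity), Real.norm_of_nonneg (by positivity)]
    have hl3 : 1 ≤ Real.log ε⁻¹ ^ 3 := one_le_pow₀ (by linarith)
    calc ε⁻¹ = κ⁻¹ * (κ * ε⁻¹) := by field_simp
      _ ≤ κ⁻¹ * (q ε * Real.log ε⁻¹ ^ 3) := mul_le_mul_of_nonneg_left
        (hq.trans (le_mul_of_one_le_right (by positivity) hl3)) (by positivity)
  · refine Asymptotics.IsBigO.of_bound (K' * (κ⁻¹ ^ p * 8)) ?_
    filter_upwards [h1, h4, hlog, hL] with ε hq hQ ⟨hε, hl, _⟩ ⟨hL1, hL2⟩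
    rw [Real.norm_of_nonneg (by positivity), Real.norm_of_nonneg (by positivity)]
    have hεq : ε⁻¹ ≤ κ⁻¹ * q ε := by
      calc ε⁻¹ = κ⁻¹ * (κ * ε⁻¹) := by field_simp
        _ ≤ _ := by gcongr
    have hεp : ε⁻¹ ^ p ≤ κ⁻¹ ^ p * (q ε : ℝ) ^ p := by
      rw [← Real.mul_rpow (by positivity) (by positivity)]
      exact Real.rpow_le_rpow (by positivity) hεq (by linarith)
    set L := Real.log ((q ε : ℝ) ^ p)
    have hl3 : Real.log ε⁻¹ ^ 3 ≤ 8 * L ^ 6 := by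
      calc Real.log ε⁻¹ ^ 3 ≤ (2 * L) ^ 3 := by gcongr
        _ = 8 * L ^ 3 := by ring
        _ ≤ 8 * L ^ 6 := by
          gcongr
          norm_num
    calc (Q ε : ℝ) ≤ K' * (ε⁻¹ ^ p * Real.log ε⁻¹ ^ 3) := hQ
      _ ≤ K' * (κ⁻¹ ^ p * (q ε : ℝ) ^ p * (8 * L ^ 6)) := by gcongr
      _ = _ := by ring
  · refine Asymptotics.IsBigO.of_bound (K ^ p * κ'⁻¹ * 64) ?_
    filter_upwards [h2, h3, hlog, hL] with ε hq hQ ⟨hε, hl, _⟩ ⟨hL1, hL2⟩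
    rw [Real.norm_of_nonneg (by positivity), Real.norm_of_nonneg (by positivity)]
    set l := Real.log ε⁻¹ with hldef
    have hl3 : 1 ≤ l ^ 3 := one_le_pow₀ (by linarith)
    have hqp : (q ε : ℝ) ^ p ≤ K ^ p * (ε⁻¹ ^ p * l ^ 6) := by
      calc (q ε : ℝ) ^ p ≤ (K * (ε⁻¹ * l ^ 3)) ^ p :=
            Real.rpow_le_rpow (by positivity) hq (by linarith)
        _ = K ^ p * (ε⁻¹ ^ p * (l ^ 3) ^ p) := by
            rw [Real.mul_rpow hK.le (by positivity), Real.mul_rpow (by positivity) (by positivity)]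
        _ ≤ K ^ p * (ε⁻¹ ^ p * (l ^ 3) ^ (2 : ℝ)) := by gcongr
        _ = _ := by
            rw [show (2 : ℝ) = ((2 : ℕ) : ℝ) by norm_num, Real.rpow_natCast, ← pow_mul]
    set L := Real.log ((q ε : ℝ) ^ p)
    have hεp : ε⁻¹ ^ p ≤ κ'⁻¹ * Q ε := by
      calc ε⁻¹ ^ p = κ'⁻¹ * (κ' * ε⁻¹ ^ p) := by field_simp
        _ ≤ _ := by gcongr
    calc (q ε : ℝ) ^ p ≤ K ^ p * (ε⁻¹ ^ p * l ^ 6) := hqp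
      _ ≤ K ^ p * (κ'⁻¹ * Q ε * (2 * L) ^ 6) := by gcongr
      _ = _ := by ring

end DenseGraphTesting

theorem theorem1 (t : ℕ) (ht : 8 ≤ t) :
    ∃ c : ℝ, 1 < c ∧ ∃ q Q : ℝ → ℕ,
      (∀ᶠ ε in 𝓝[>] (0 : ℝ),
        IsAdaptiveQueryComplexity
          (lowDegreeBlowUpCollection (SimpleGraph.cycleGraph t) (c * ε)) ε (q ε) ∧
        IsNonAdaptiveQueryComplexity
          (lowDegreeBlowUpCollection (SimpleGraph.cycleGraph t) (c * ε)) ε (Q ε)) ∧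
      IsSoftTheta (𝓝[>] (0 : ℝ)) (fun ε => (q ε : ℝ)) (fun ε => ε⁻¹) ∧
      IsSoftTheta (𝓝[>] (0 : ℝ)) (fun ε => (Q ε : ℝ))
        (fun ε => (q ε : ℝ) ^ (2 - 2 / (t : ℝ))) := by
  have ht8 : (8 : ℝ) ≤ t := by exact_mod_cast ht
  have hc : (1 : ℝ) < 128 * t := by linarith
  obtain ⟨K, hK, hub⟩ := eventually_adaptivelyTestable ht hc.le
  obtain ⟨K', hK', hub'⟩ := eventually_nonAdaptivelyTestable ht hc.le
  obtain ⟨κ, hκ, hlb⟩ := eventually_le_of_adaptivelyTestable ht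
  obtain ⟨κ', hκ', hlb'⟩ := eventually_le_of_nonAdaptivelyTestable ht
  have ht1 : (2 : ℝ) / t ≤ 1 := by
    rw [div_le_one (by linarith)]
    linarith
  have ht2 : (0 : ℝ) ≤ 2 / t := by positivity
  set P : ℝ → GraphProperty := fun ε =>
    lowDegreeBlowUpCollection (SimpleGraph.cycleGraph t) (128 * t * ε) with hP
  have hq : ∀ᶠ ε in 𝓝[>] (0 : ℝ), IsAdaptiveQueryComplexity (P ε) ε
      (sInf {m | AdaptivelyTestable (P ε) ε m}) := by
    filter_upwards [hub] with ε ⟨m, _, hm⟩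
    exact ⟨Nat.sInf_mem ⟨m, hm⟩, fun n hn => Nat.sInf_le hn⟩
  have hQ : ∀ᶠ ε in 𝓝[>] (0 : ℝ), IsNonAdaptiveQueryComplexity (P ε) ε
      (sInf {m | NonAdaptivelyTestable (P ε) ε m}) := by
    filter_upwards [hub'] with ε ⟨m, _, hm⟩
    exact ⟨Nat.sInf_mem ⟨m, hm⟩, fun n hn => Nat.sInf_le hn⟩
  refine ⟨128 * t, hc, fun ε => sInf {m | AdaptivelyTestable (P ε) ε m},
    fun ε => sInf {m | NonAdaptivelyTestable (P ε) ε m}, hq.and hQ, ?_⟩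
  refine isSoftTheta_of_bounds (by linarith) (by linarith) hκ hK hκ' hK' ?_ ?_ ?_ ?_
  · filter_upwards [hlb, hq] with ε h hq
    exact h _ hq.1
  · filter_upwards [hub, hq] with ε ⟨m, hm, hm'⟩ hq
    exact le_trans (by exact_mod_cast hq.2 hm') hm
  · filter_upwards [hlb', hQ] with ε h hq
    exact h _ hq.1
  · filter_upwards [hub', hQ] with ε ⟨m, hm, hm'⟩ hq
    exact le_trans (by exact_mod_cast hq.2 hm') hm
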